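/- Let $\Omega\subset\mathbb{R}^3$ be a simply connected bounded Lipschitz domain whose boundary $\Gamma=\partial\Omega$ consists of planar walls, i.e. is contained in a finite union of planes, with outward unit normal $n$ (convexity is not assumed), and let $\mu>0$ be a constant. Write $(A:B)=\sum_{i,j}A_{ij}B_{ij}$, and for $u\in H^1(\Omega)^3$ let $$e(u)=\tfrac12\big(\nabla u+\nabla u^{T}\big)-\tfrac13(\operatorname{div}u)\,\mathbf 1$$ be the deviatoric strain; all derivatives are weak derivatives in $L^2(\Omega)$. Boundary values are understood in the sense of traces: the normal trace $n\cdot w$ of $w\in H(\operatorname{div},\Omega)$ and the tangential trace $n\times w$ of $w\in H(\operatorname{curl},\Omega)$ are the elements of $H^{-1/2}(\Gamma)$, resp. $H^{-1/2}(\Gamma)^3$, given for $\varphi\in H^1(\Omega)$ and $\Phi\in H^1(\Omega)^3$ by $$\int_\Gamma (n\cdot w)\,\varphi\,d\Gamma=\int_\Omega w\cdot\nabla\varphi+(\operatorname{div}w)\,\varphi\,d\Omega,\qquad \int_\Gamma (n\times w)\cdot\Phi\,d\Gamma=\int_\Omega \operatorname{curl}w\cdot\Phi-w\cdot\operatorname{curl}\Phi\,d\Omega,$$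 the integrals over $\Gamma$ being the duality pairings of $H^{-1/2}(\Gamma)$ with $H^{1/2}(\Gamma)$. $H_0(\operatorname{div},\Omega)$ and $H_0(\operatorname{curl},\Omega)$ denote the fields of $H(\operatorname{div},\Omega)$, resp. $H(\operatorname{curl},\Omega)$, with $n\cdot w=0$, resp. $n\times w=0$, on $\Gamma$. Let $u,v\in H^1(\Omega)^3$ with $\operatorname{div}u=0$ in $\Omega$. 1. If $n\times\operatorname{curl}u=0$ on $\Gamma$, i.e. $\operatorname{curl}u\in H_0(\operatorname{curl},\Omega)$, then the rows of $2\mu\,e(u)$ belong to $H(\operatorname{div},\Omega)$, so that the traction $2\mu\,e(u)n\in H^{-1/2}(\Gamma)^3$ is defined row by row as a normal trace, and $$\int_\Omega\mu\,\operatorname{curl}u\cdot\operatorname{curl}v\,d\Omega=\int_\Omega 2\mu\,e(u):e(v)\,d\Omega-\int_\Gamma 2\mu\,e(u)n\cdot v\,d\Gamma .$$ 2. If $u,v\in H_0(\operatorname{div},\Omega)$, or if $u,v\in H_0(\operatorname{curl},\Omega)$, then $$\int_\Omega\mu\,\operatorname{curl}u\cdot\operatorname{curl}v\,d\Omega=\int_\Omega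 2\mu\,e(u):e(v)\,d\Omega .$$ -/

import Mathlib

open MeasureTheory Set Topology
open scoped ContDiff NNReal

noncomputable section

/-- Euclidean three-space. -/
abbrev E3 : Type := EuclideanSpace ℝ (Fin 3)

/-! ### The domain -/

/-- `Ω` has a Lipschitz boundary: near every boundary point there are Cartesian coordinates
(a linear isometry `A`) and a Lipschitz function `γ` of the first two coordinates such that
`Ω` is locally the set of points lying strictly above the graph of `γ`. -/
def HasLipschitzBoundary (Ω : Set E3) : Prop :=
  ∀ x ∈ frontier Ω, ∃ (A : E3 ≃ₗᵢ[ℝ] E3) (K : ℝ≥0) (γ : EuclideanSpace ℝ (Fin 2) → ℝ),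
    LipschitzWith K γ ∧ ∀ᶠ y in 𝓝 x, (y ∈ Ω ↔ γ !₂[A y 0, A y 1] < A y 2)

/-- The boundary of `Ω` consists of planar walls: it is covered by finitely many planes
`{x | ⟪a, x⟫ = c}` with `a ≠ 0`. -/
def HasPlanarWalls (Ω : Set E3) : Prop :=
  ∃ P : Finset (E3 × ℝ), (∀ p ∈ P, p.1 ≠ 0) ∧
    ∀ x ∈ frontier Ω, ∃ p ∈ P, inner ℝ p.1 x = p.2

/-- A simply connected (in particular nonempty and connected) bounded Lipschitz domain in
three-space whose boundary consists of planar walls. It need not be convex. -/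
structure IsPolyhedralDomain (Ω : Set E3) : Prop where
  isOpen : IsOpen Ω
  isBounded : Bornology.IsBounded Ω
  isSimplyConnected : IsSimplyConnected Ω
  lipschitz : HasLipschitzBoundary Ω
  planar : HasPlanarWalls Ω

/-! ### Weak derivatives, `H¹`, `H(div)` and `H(curl)` -/

/-- The `i`-th classical partial derivative. -/
def pd (i : Fin 3) (φ : E3 → ℝ) (x : E3) : ℝ :=
  fderiv ℝ φ x (EuclideanSpace.single i 1)

/-- The classical gradient. -/
def classGrad (φ : E3 → ℝ) (x : E3) : E3 := !₂[pd 0 φ x, pd 1 φ x, pd 2 φ x]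

/-- The classical curl. -/
def classCurl (Φ : E3 → E3) (x : E3) : E3 :=
  !₂[pd 1 (fun y => Φ y 2) x - pd 2 (fun y => Φ y 1) x,
     pd 2 (fun y => Φ y 0) x - pd 0 (fun y => Φ y 2) x,
     pd 0 (fun y => Φ y 1) x - pd 1 (fun y => Φ y 0) x]

/-- Smooth functions (scalar or vector valued) with compact support in `Ω`. -/
structure IsTest {F : Type*} [NormedAddCommGroup F] [NormedSpace ℝ F]
    (Ω : Set E3) (φ : E3 → F) : Prop where
  contDiff : ContDiff ℝ ∞ φ
  hasCompactSupport : HasCompactSupport φ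
  tsupport_subset : tsupport φ ⊆ Ω

/-- Square integrability over `Ω`. -/
def MemL2 {F : Type*} [NormedAddCommGroup F] (Ω : Set E3) (f : E3 → F) : Prop :=
  MemLp f 2 (volume.restrict Ω)

/-- `g ∈ L²(Ω)` is the weak gradient of the scalar function `f`. -/
def IsWeakGrad (Ω : Set E3) (f : E3 → ℝ) (g : E3 → E3) : Prop :=
  MemL2 Ω g ∧ ∀ Φ : E3 → E3, IsTest Ω Φ →
    ∫ x in Ω, f x * (∑ i, pd i (fun y => Φ y i) x) = -∫ x in Ω, inner ℝ (g x) (Φ x)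

/-- `d ∈ L²(Ω)` is the weak divergence of the vector field `u`. -/
def IsWeakDiv (Ω : Set E3) (u : E3 → E3) (d : E3 → ℝ) : Prop :=
  MemL2 Ω d ∧ ∀ φ : E3 → ℝ, IsTest Ω φ →
    ∫ x in Ω, inner ℝ (u x) (classGrad φ x) = -∫ x in Ω, d x * φ x

/-- `w ∈ L²(Ω)` is the weak curl of the vector field `u`. -/
def IsWeakCurl (Ω : Set E3) (u w : E3 → E3) : Prop :=
  MemL2 Ω w ∧ ∀ Φ : E3 → E3, IsTest Ω Φ →
    ∫ x in Ω, inner ℝ (u x) (classCurl Φ x) = ∫ x in Ω, inner ℝ (w x) (Φ x)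

/-- The scalar space `H¹(Ω)`. -/
def MemH1 (Ω : Set E3) (f : E3 → ℝ) : Prop :=
  MemL2 Ω f ∧ ∃ g, IsWeakGrad Ω f g

/-- The vector valued space `H¹(Ω) = [H¹(Ω)]³`. -/
def MemH1Vec (Ω : Set E3) (u : E3 → E3) : Prop :=
  ∀ j, MemH1 Ω (fun x => u x j)

/-- The space `H(div, Ω)`. -/
def MemHdiv (Ω : Set E3) (u : E3 → E3) : Prop :=
  MemL2 Ω u ∧ ∃ d, IsWeakDiv Ω u d

/-- The space `H(curl, Ω)`. -/
def MemHcurl (Ω : Set E3) (u : E3 → E3) : Prop :=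
  MemL2 Ω u ∧ ∃ w, IsWeakCurl Ω u w

open Classical in
/-- The weak gradient of `f ∈ H¹(Ω)` (unique almost everywhere in `Ω`). -/
def wgrad (Ω : Set E3) (f : E3 → ℝ) : E3 → E3 :=
  if h : ∃ g, IsWeakGrad Ω f g then h.choose else 0

open Classical in
/-- The weak divergence of `u ∈ H(div, Ω)` (unique almost everywhere in `Ω`). -/
def wdiv (Ω : Set E3) (u : E3 → E3) : E3 → ℝ :=
  if h : ∃ d, IsWeakDiv Ω u d then h.choose else 0

open Classical in
/-- The weak curl of `u ∈ H(curl, Ω)` (unique almost everywhere in `Ω`). -/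
def wcurl (Ω : Set E3) (u : E3 → E3) : E3 → E3 :=
  if h : ∃ w, IsWeakCurl Ω u w then h.choose else 0

/-! ### Strain -/

/-- The Jacobian matrix `(grad u) j i = ∂ᵢ uⱼ` of `u ∈ H¹(Ω)`. -/
def gradVec (Ω : Set E3) (u : E3 → E3) (x : E3) : Matrix (Fin 3) (Fin 3) ℝ :=
  Matrix.of fun j i => wgrad Ω (fun y => u y j) x i

/-- The deviatoric strain `e(u) = sym (grad u) - (1/3) (div u) 1`. -/
def devStrain (Ω : Set E3) (u : E3 → E3) (x : E3) : Matrix (Fin 3) (Fin 3) ℝ :=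
  (1 / 2 : ℝ) • (gradVec Ω u x + (gradVec Ω u x).transpose)
    - (1 / 3 * wdiv Ω u x : ℝ) • (1 : Matrix (Fin 3) (Fin 3) ℝ)

/-- The double contraction `A : B = ∑ᵢⱼ Aᵢⱼ Bᵢⱼ`. -/
def ddot (A B : Matrix (Fin 3) (Fin 3) ℝ) : ℝ := ∑ i, ∑ j, A i j * B i j

/-- The `j`-th row of a tensor field, as a vector field. -/
def rowField (σ : E3 → Matrix (Fin 3) (Fin 3) ℝ) (j : Fin 3) (x : E3) : E3 :=
  WithLp.toLp 2 (σ x j)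

/-! ### Boundary traces

The normal and tangential traces take values in the dual `H^{-1/2}(Γ)` of the space
`H^{1/2}(Γ)` of traces of `H¹(Ω)`, and they are defined by Green's formulas, `n` being the
outward unit normal. For fields that are smooth up to the boundary they are the surface
integrals written in the comments. -/

/-- The normal trace of `u ∈ H(div, Ω)` applied to the trace of `φ ∈ H¹(Ω)`:
`∫_Γ (n · u) φ dΓ = ∫_Ω u · grad φ + (div u) φ dΩ`. -/
def normalTrace (Ω : Set E3) (u : E3 → E3) (φ : E3 → ℝ) : ℝ :=
  ∫ x in Ω, (inner ℝ (u x) (wgrad Ω φ x) + wdiv Ω u x * φ x)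

/-- The tangential trace of `u ∈ H(curl, Ω)` applied to the trace of `Φ ∈ H¹(Ω)³`:
`∫_Γ (n × u) · Φ dΓ = ∫_Ω (curl u) · Φ - u · (curl Φ) dΩ`. -/
def tangentialTrace (Ω : Set E3) (u Φ : E3 → E3) : ℝ :=
  ∫ x in Ω, (inner ℝ (wcurl Ω u x) (Φ x) - inner ℝ (u x) (wcurl Ω Φ x))

/-- The space `H₀(div, Ω)`: fields of `H(div, Ω)` with `n · u = 0` on `Γ`. -/
def MemH0div (Ω : Set E3) (u : E3 → E3) : Prop :=
  MemHdiv Ω u ∧ ∀ φ : E3 → ℝ, MemH1 Ω φ → normalTrace Ω u φ = 0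

/-- The space `H₀(curl, Ω)`: fields of `H(curl, Ω)` with `n × u = 0` on `Γ`. -/
def MemH0curl (Ω : Set E3) (u : E3 → E3) : Prop :=
  MemHcurl Ω u ∧ ∀ Φ : E3 → E3, MemH1Vec Ω Φ → tangentialTrace Ω u Φ = 0

/-- A tensor field of class `[L²(Ω)]^{3×3}` whose row-wise divergence is in `L²(Ω)³`, so that
its traction `σ n ∈ H^{-1/2}(Γ)³` is defined. -/
def MemHdivTensor (Ω : Set E3) (σ : E3 → Matrix (Fin 3) (Fin 3) ℝ) : Prop :=
  ∀ j, MemHdiv Ω (rowField σ j)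

/-- The traction `σ n` applied to the trace of `v ∈ H¹(Ω)³`, that is `∫_Γ σ n · v dΓ`:
the sum over the rows `σⱼ` of `∫_Γ (n · σⱼ) vⱼ dΓ`. -/
def tractionPairing (Ω : Set E3) (σ : E3 → Matrix (Fin 3) (Fin 3) ℝ) (v : E3 → E3) : ℝ :=
  ∑ j, normalTrace Ω (rowField σ j) (fun x => v x j)

end

open Filter
open scoped Convolution Manifold

noncomputable section

/-! ### Test functions -/

theorem IsTest.mono {F : Type*} [NormedAddCommGroup F] [NormedSpace ℝ F] {V W : Set E3}
    {φ : E3 → F} (h : IsTest V φ) (hVW : V ⊆ W) : IsTest W φ :=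
  ⟨h.contDiff, h.hasCompactSupport, h.tsupport_subset.trans hVW⟩

theorem IsTest.continuous {F : Type*} [NormedAddCommGroup F] [NormedSpace ℝ F] {W : Set E3}
    {φ : E3 → F} (h : IsTest W φ) : Continuous φ := h.contDiff.continuous

theorem IsTest.differentiable {F : Type*} [NormedAddCommGroup F] [NormedSpace ℝ F] {W : Set E3}
    {φ : E3 → F} (h : IsTest W φ) : Differentiable ℝ φ :=
  h.contDiff.differentiable (by simp)

theorem IsTest.continuous_fderiv {F : Type*} [NormedAddCommGroup F] [NormedSpace ℝ F]
    {W : Set E3} {φ : E3 → F} (h : IsTest W φ) : Continuous (fderiv ℝ φ) :=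
  h.contDiff.continuous_fderiv (by simp)

theorem IsTest.exists_bound {F : Type*} [NormedAddCommGroup F] [NormedSpace ℝ F]
    {W : Set E3} {φ : E3 → F} (h : IsTest W φ) :
    ∃ C, 0 ≤ C ∧ (∀ x, ‖φ x‖ ≤ C) ∧ ∀ x, ‖fderiv ℝ φ x‖ ≤ C := by
  obtain ⟨C, hC⟩ := h.hasCompactSupport.exists_bound_of_continuous h.continuous
  obtain ⟨D, hD⟩ := (h.hasCompactSupport.fderiv ℝ).exists_bound_of_continuous h.continuous_fderiv
  exact ⟨max C D, (norm_nonneg _).trans ((hC 0).trans (le_max_left _ _)),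
    fun x => (hC x).trans (le_max_left _ _), fun x => (hD x).trans (le_max_right _ _)⟩

theorem IsTest.eq_zero {F : Type*} [NormedAddCommGroup F] [NormedSpace ℝ F] {W : Set E3}
    {φ : E3 → F} (h : IsTest W φ) {x : E3} (hx : x ∉ W) : φ x = 0 :=
  image_eq_zero_of_notMem_tsupport fun hm => hx (h.tsupport_subset hm)

theorem IsTest.fderiv_eq_zero {F : Type*} [NormedAddCommGroup F] [NormedSpace ℝ F] {W : Set E3}
    {φ : E3 → F} (h : IsTest W φ) {x : E3} (hx : x ∉ W) : fderiv ℝ φ x = 0 :=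
  image_eq_zero_of_notMem_tsupport fun hm =>
    hx (h.tsupport_subset (tsupport_fderiv_subset ℝ hm))

theorem IsTest.fderiv_apply {F : Type*} [NormedAddCommGroup F] [NormedSpace ℝ F] {W : Set E3}
    {φ : E3 → F} (h : IsTest W φ) (e : E3) : IsTest W (fun x => fderiv ℝ φ x e) :=
  ⟨(h.contDiff.fderiv_right (m := ∞) (by simp)).clm_apply contDiff_const,
    h.hasCompactSupport.fderiv_apply ℝ e,
    (tsupport_fderiv_apply_subset ℝ e).trans h.tsupport_subset⟩

theorem IsTest.mul_left {W : Set E3} {φ η : E3 → ℝ} (h : IsTest W φ) (hη : ContDiff ℝ ∞ η) :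
    IsTest W (fun x => η x * φ x) :=
  ⟨hη.mul h.contDiff, h.hasCompactSupport.mul_left,
    (tsupport_mul_subset_right).trans h.tsupport_subset⟩

theorem IsTest.add {W : Set E3} {φ ψ : E3 → ℝ} (h : IsTest W φ) (h' : IsTest W ψ) :
    IsTest W (fun x => φ x + ψ x) :=
  ⟨h.contDiff.add h'.contDiff, h.hasCompactSupport.add h'.hasCompactSupport,
    (tsupport_add φ ψ).trans (union_subset h.tsupport_subset h'.tsupport_subset)⟩

theorem IsTest.const_mul {W : Set E3} {φ : E3 → ℝ} (h : IsTest W φ) (c : ℝ) :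
    IsTest W (fun x => c * φ x) := h.mul_left contDiff_const

theorem IsTest.sub {W : Set E3} {φ ψ : E3 → ℝ} (h : IsTest W φ) (h' : IsTest W ψ) :
    IsTest W (fun x => φ x - ψ x) := by
  simpa [sub_eq_add_neg] using h.add (h'.const_mul (-1))

theorem IsTest.smul_const {F : Type*} [NormedAddCommGroup F] [NormedSpace ℝ F] {W : Set E3}
    {φ : E3 → ℝ} (h : IsTest W φ) (c : F) : IsTest W (fun x => φ x • c) :=
  ⟨h.contDiff.smul contDiff_const, h.hasCompactSupport.smul_right,
    (closure_mono fun x hx => by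
      simp only [Function.mem_support] at hx ⊢
      exact fun h0 => hx (by simp [h0])).trans h.tsupport_subset⟩

theorem IsTest.comp_isometry {W : Set E3} {φ : E3 → ℝ} (h : IsTest W φ) (R : E3 → E3)
    (hR : ContDiff ℝ ∞ R) (hRR : Function.Involutive R) (hW : ∀ x, R x ∈ W → x ∈ W) :
    IsTest W (fun x => φ (R x)) := by
  have hh : IsHomeomorph R := (Homeomorph.mk ⟨R, R, hRR, hRR⟩ hR.continuous hR.continuous).isHomeomorph
  have hs : tsupport (fun x => φ (R x)) ⊆ R ⁻¹' tsupport φ := by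
    refine closure_minimal (fun x hx => subset_closure hx)
      ((isClosed_tsupport φ).preimage hR.continuous)
  refine ⟨h.contDiff.comp hR, ?_, fun x hx => hW x (h.tsupport_subset (hs hx))⟩
  exact h.hasCompactSupport.comp_isClosedEmbedding hh.isClosedEmbedding

/-! ### A smooth step -/

/-- A smooth step from `0` on `(-∞, 1]` to `1` on `[2, ∞)`. -/
def step (s : ℝ) : ℝ := Real.smoothTransition (s - 1)

theorem contDiff_step : ContDiff ℝ ∞ step :=
  Real.smoothTransition.contDiff.comp (contDiff_id.sub contDiff_const)

theorem step_zero {s : ℝ} (h : s ≤ 1) : step s = 0 :=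
  Real.smoothTransition.zero_of_nonpos (by linarith)

theorem step_one {s : ℝ} (h : 2 ≤ s) : step s = 1 :=
  Real.smoothTransition.one_of_one_le (by linarith)

theorem step_nonneg (s : ℝ) : 0 ≤ step s := Real.smoothTransition.nonneg _

theorem step_le_one (s : ℝ) : step s ≤ 1 := Real.smoothTransition.le_one _

theorem deriv_step_lt {s : ℝ} (h : s < 1) : deriv step s = 0 := by
  have : step =ᶠ[𝓝 s] fun _ => 0 := by
    filter_upwards [eventually_lt_nhds h] with y hy using step_zero hy.le
  rw [this.deriv_eq]; simp

theorem deriv_step_gt {s : ℝ} (h : 2 < s) : deriv step s = 0 := by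
  have : step =ᶠ[𝓝 s] fun _ => 1 := by
    filter_upwards [eventually_gt_nhds h] with y hy using step_one hy.le
  rw [this.deriv_eq]; simp

theorem exists_deriv_step_bound : ∃ C, 0 ≤ C ∧ ∀ s, |deriv step s| ≤ C := by
  obtain ⟨C, hC⟩ := (isCompact_Icc (a := (1 : ℝ)) (b := 2)).exists_bound_of_continuousOn
    (contDiff_step.continuous_deriv (by simp)).continuousOn
  refine ⟨C, (norm_nonneg _).trans (hC 1 (by norm_num)), fun s => ?_⟩
  have h0 : 0 ≤ C := (norm_nonneg _).trans (hC 1 (by norm_num))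
  rcases lt_or_ge s 1 with h | h
  · rw [deriv_step_lt h]; simpa
  rcases lt_or_ge 2 s with h' | h'
  · rw [deriv_step_gt h']; simpa
  exact hC s ⟨h, h'⟩

theorem fderiv_step_comp_mul {q ζ : E3 → ℝ} {k : ℝ} {x : E3} (hq : DifferentiableAt ℝ q x)
    (hζ : DifferentiableAt ℝ ζ x) (v : E3) :
    fderiv ℝ (fun y => step (k * q y) * ζ y) x v =
      step (k * q x) * fderiv ℝ ζ x v + deriv step (k * q x) * (k * fderiv ℝ q x v) * ζ x := by
  have h1 : HasFDerivAt (fun y => k * q y) (k • fderiv ℝ q x) x := hq.hasFDerivAt.const_mul k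
  have h2 : HasDerivAt step (deriv step (k * q x)) (k * q x) :=
    ((contDiff_step.differentiable (by simp)) _).hasDerivAt
  have h3 := (h2.comp_hasFDerivAt x h1).mul hζ.hasFDerivAt
  have h4 : fderiv ℝ (fun y => step (k * q y) * ζ y) x = _ := h3.fderiv
  rw [h4]
  simp
  ring

theorem IsTest.step_mul {W W' : Set E3} {q ζ : E3 → ℝ} (h : IsTest W ζ) (hq : ContDiff ℝ ∞ q)
    (k : ℝ) (hW : ∀ x ∈ W, 1 ≤ k * q x → x ∈ W') :
    IsTest W' (fun x => step (k * q x) * ζ x) := by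
  have hc : ContDiff ℝ ∞ (fun x => step (k * q x)) := contDiff_step.comp (contDiff_const.mul hq)
  have h1 := h.mul_left hc
  refine ⟨h1.contDiff, h1.hasCompactSupport, fun x hx => hW x (h1.tsupport_subset hx) ?_⟩
  have : tsupport (fun x => step (k * q x) * ζ x) ⊆ {x | 1 ≤ k * q x} := by
    refine closure_minimal (fun x hx => ?_)
      (isClosed_le continuous_const (continuous_const.mul hq.continuous))
    by_contra hlt
    exact hx (by simp [step_zero (not_le.1 hlt).le])
  exact this hx

/-! ### Weak divergence with prescribed test functions -/

/-- `∫_V ζ β + ∂_F ζ = 0` for all smooth `ζ` with compact support in `W`. If `W = V`, then `β` is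
the weak divergence of `F`; if `W` is larger, then moreover the normal trace of `F` vanishes on
`W ∩ ∂V`. -/
def WeakDivOn (V W : Set E3) (F : E3 → E3) (β : E3 → ℝ) : Prop :=
  ∀ ζ : E3 → ℝ, IsTest W ζ → ∫ x in V, (ζ x * β x + fderiv ℝ ζ x (F x)) = 0

/-- `A` is the weak Jacobian of `u` on `V`, tested with functions supported in `W`. -/
def WeakJacOn (V W : Set E3) (u : E3 → E3) (A : E3 → E3 →L[ℝ] E3) : Prop :=
  ∀ c e : E3, WeakDivOn V W (fun x => (inner ℝ (u x) c : ℝ) • e) (fun x => inner ℝ (A x e) c)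

theorem WeakDivOn.mono {V W W' : Set E3} {F : E3 → E3} {β : E3 → ℝ} (h : WeakDivOn V W F β)
    (hW : W' ⊆ W) : WeakDivOn V W' F β := fun ζ hζ => h ζ (hζ.mono hW)

theorem IsTest.integrableOn_mul {V W : Set E3} {ζ β : E3 → ℝ} (h : IsTest W ζ)
    (hβ : IntegrableOn β V) : IntegrableOn (fun x => ζ x * β x) V := by
  obtain ⟨C, _, hC, _⟩ := h.exists_bound
  exact hβ.bdd_mul h.continuous.aestronglyMeasurable (ae_of_all _ hC)

theorem aestronglyMeasurable_clm_apply {F G : Type*} [NormedAddCommGroup F] [NormedSpace ℝ F]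
    [NormedAddCommGroup G] [NormedSpace ℝ G] {μ : Measure E3} {L : E3 → F →L[ℝ] G} {f : E3 → F}
    (hL : AEStronglyMeasurable L μ) (hf : AEStronglyMeasurable f μ) :
    AEStronglyMeasurable (fun x => L x (f x)) μ :=
  (isBoundedBilinearMap_apply (𝕜 := ℝ) (E := F) (F := G)).continuous.comp_aestronglyMeasurable
    (hL.prodMk hf)

theorem IsTest.integrableOn_fderiv {V W : Set E3} {ζ : E3 → ℝ} {F : E3 → E3} (h : IsTest W ζ)
    (hF : IntegrableOn F V) : IntegrableOn (fun x => fderiv ℝ ζ x (F x)) V := by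
  obtain ⟨C, _, _, hC⟩ := h.exists_bound
  refine (hF.norm.const_mul C).mono' (aestronglyMeasurable_clm_apply
    h.continuous_fderiv.aestronglyMeasurable hF.aestronglyMeasurable) (ae_of_all _ fun x => ?_)
  exact ((fderiv ℝ ζ x).le_opNorm _).trans (mul_le_mul_of_nonneg_right (hC x) (norm_nonneg _))

theorem IsTest.integrableOn_add {V W : Set E3} {ζ β : E3 → ℝ} {F : E3 → E3} (h : IsTest W ζ)
    (hF : IntegrableOn F V) (hβ : IntegrableOn β V) :
    IntegrableOn (fun x => ζ x * β x + fderiv ℝ ζ x (F x)) V :=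
  (h.integrableOn_mul hβ).add (h.integrableOn_fderiv hF)

theorem MemL2.integrableOn {F : Type*} [NormedAddCommGroup F] {V : Set E3} {f : E3 → F}
    (h : MemL2 V f) (hV : volume V ≠ ⊤) : IntegrableOn f V := by
  have : IsFiniteMeasure (volume.restrict V) := ⟨by simpa using hV.lt_top⟩
  exact MemLp.integrable (by norm_num) h

/-! ### Removing walls and lines by cutting off -/

theorem tendsto_step_atTop {s : ℝ} (hs : 0 < s) :
    Tendsto (fun k : ℕ => step (k * s)) atTop (𝓝 1) := by
  refine tendsto_const_nhds.congr' ?_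
  filter_upwards [(tendsto_natCast_atTop_atTop (R := ℝ)).eventually_ge_atTop (2 / s)] with k hk
  rw [step_one]
  rwa [div_le_iff₀ hs] at hk

theorem eventually_deriv_step_eq_zero {s : ℝ} (hs : 0 < s) :
    ∀ᶠ k : ℕ in atTop, deriv step (k * s) = 0 := by
  filter_upwards [(tendsto_natCast_atTop_atTop (R := ℝ)).eventually_gt_atTop (2 / s)] with k hk
  rw [deriv_step_gt]
  rwa [div_lt_iff₀ hs] at hk

theorem mul_deriv_step_le {C : ℝ} (hC : ∀ s, |deriv step s| ≤ C) {k s : ℝ} (hk : 0 ≤ k)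
    (hs : 0 ≤ s) : |deriv step (k * s)| * (k * s) ≤ 2 * C := by
  rcases lt_or_ge 2 (k * s) with h | h
  · rw [deriv_step_gt h]
    have := (abs_nonneg _).trans (hC 0)
    simpa
  · have h1 := hC (k * s)
    have h2 : 0 ≤ k * s := mul_nonneg hk hs
    nlinarith [abs_nonneg (deriv step (k * s))]

/-- The part of the wall identity in which the cutoff is not differentiated. -/
theorem tendsto_integral_step_mul {V : Set E3} {q : E3 → ℝ} {H : E3 → ℝ} (hq : Continuous q)
    (hH : IntegrableOn H V) (hpos : ∀ᵐ x ∂volume.restrict V, 0 < q x) :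
    Tendsto (fun k : ℕ => ∫ x in V, step (k * q x) * H x) atTop (𝓝 (∫ x in V, H x)) := by
  refine tendsto_integral_of_dominated_convergence (fun x => ‖H x‖) (fun k => ?_) hH.norm
    (fun k => ?_) ?_
  · exact ((contDiff_step.continuous.comp (continuous_const.mul hq)).aestronglyMeasurable).mul
      hH.aestronglyMeasurable
  · refine ae_of_all _ fun x => ?_
    rw [norm_mul, Real.norm_eq_abs, abs_of_nonneg (step_nonneg _)]
    exact mul_le_of_le_one_left (norm_nonneg _) (step_le_one _)
  · filter_upwards [hpos] with x hx
    simpa using (tendsto_step_atTop hx).mul_const (H x)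

/-- If the identity holds for cut off functions and the commutator tends to zero, then it holds. -/
theorem integral_eq_zero_of_step {V W : Set E3} {F : E3 → E3} {β : E3 → ℝ} {q ζ : E3 → ℝ}
    (hF : IntegrableOn F V) (hβ : IntegrableOn β V) (hζ : IsTest W ζ) (hq : ContDiff ℝ ∞ q)
    (hpos : ∀ᵐ x ∂volume.restrict V, 0 < q x)
    (h : ∀ k : ℕ, ∫ x in V, (step (k * q x) * ζ x * β x +
      fderiv ℝ (fun y => step (k * q y) * ζ y) x (F x)) = 0)
    (hlim : Tendsto (fun k : ℕ => ∫ x in V,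
      deriv step (k * q x) * (k * fderiv ℝ q x (F x)) * ζ x) atTop (𝓝 0)) :
    ∫ x in V, (ζ x * β x + fderiv ℝ ζ x (F x)) = 0 := by
  have hH := hζ.integrableOn_add hF hβ
  have h1 := tendsto_integral_step_mul hq.continuous hH hpos
  have h2 : ∀ k : ℕ, ∫ x in V, step (k * q x) * (ζ x * β x + fderiv ℝ ζ x (F x)) =
      - ∫ x in V, deriv step (k * q x) * (k * fderiv ℝ q x (F x)) * ζ x := by
    intro k
    have hc : Continuous (fun x => step (k * q x)) :=
      contDiff_step.continuous.comp (continuous_const.mul hq.continuous)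
    have hi1 : IntegrableOn (fun x => step (k * q x) * (ζ x * β x + fderiv ℝ ζ x (F x))) V := by
      refine hH.bdd_mul (c := 1) hc.aestronglyMeasurable (ae_of_all _ fun x => ?_)
      rw [Real.norm_eq_abs, abs_of_nonneg (step_nonneg _)]
      exact step_le_one _
    have hζk : IsTest W (fun x => step (k * q x) * ζ x) :=
      hζ.mul_left (contDiff_step.comp (contDiff_const.mul hq))
    have hi2 := hζk.integrableOn_add hF hβ
    have heq : ∀ x, step (k * q x) * ζ x * β x +
        fderiv ℝ (fun y => step (k * q y) * ζ y) x (F x) =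
        step (k * q x) * (ζ x * β x + fderiv ℝ ζ x (F x)) +
        deriv step (k * q x) * (k * fderiv ℝ q x (F x)) * ζ x := fun x => by
      rw [fderiv_step_comp_mul (hq.differentiable (by simp) x) (hζ.differentiable x)]
      ring
    have hi3 : IntegrableOn (fun x => deriv step (k * q x) * (k * fderiv ℝ q x (F x)) * ζ x) V := by
      refine (hi2.sub hi1).congr (ae_of_all _ fun x => ?_)
      simp only [Pi.sub_apply]
      rw [heq]; ring
    have := h k
    simp_rw [heq] at this
    rw [integral_add hi1 hi3] at this
    linarith
  simp_rw [h2] at h1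
  have h3 := tendsto_nhds_unique h1 hlim.neg
  simpa using h3

/-- The affine function measuring the signed distance from a plane. -/
def wallDist (n x₀ x : E3) : ℝ := inner ℝ n (x - x₀)

theorem contDiff_wallDist (n x₀ : E3) : ContDiff ℝ ∞ (wallDist n x₀) :=
  contDiff_const.inner ℝ (contDiff_id.sub contDiff_const)

theorem fderiv_wallDist (n x₀ x v : E3) : fderiv ℝ (wallDist n x₀) x v = inner ℝ n v := by
  have : HasFDerivAt (wallDist n x₀) (innerSL ℝ n) x :=
    (innerSL ℝ n).hasFDerivAt.comp x ((hasFDerivAt_id x).sub_const x₀)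
  rw [this.fderiv]; rfl

/-- The part of a ball on the positive side of a plane through its centre. -/
def halfBall (n x₀ : E3) (r : ℝ) : Set E3 := {x ∈ Metric.ball x₀ r | 0 < wallDist n x₀ x}

theorem isOpen_halfBall (n x₀ : E3) (r : ℝ) : IsOpen (halfBall n x₀ r) :=
  Metric.isOpen_ball.inter (isOpen_lt continuous_const (contDiff_wallDist n x₀).continuous)

theorem WeakDivOn.integral_halfBall {n x₀ : E3} {r : ℝ} {F : E3 → E3} {β g ζ : E3 → ℝ}
    (h : WeakDivOn (halfBall n x₀ r) (halfBall n x₀ r) F β)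
    (hF : IntegrableOn F (halfBall n x₀ r)) (hβ : IntegrableOn β (halfBall n x₀ r))
    (hg : IntegrableOn g (halfBall n x₀ r)) (hζ : IsTest (Metric.ball x₀ r) ζ)
    (hb : ∀ x ∈ halfBall n x₀ r, |ζ x * inner ℝ n (F x)| ≤ wallDist n x₀ x * g x) :
    ∫ x in halfBall n x₀ r, (ζ x * β x + fderiv ℝ ζ x (F x)) = 0 := by
  set V := halfBall n x₀ r with hVdef
  have hVm : MeasurableSet V := (isOpen_halfBall n x₀ r).measurableSet
  have hq := contDiff_wallDist n x₀
  have hpos : ∀ᵐ x ∂volume.restrict V, 0 < wallDist n x₀ x :=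
    (ae_restrict_mem hVm).mono fun x hx => hx.2
  refine integral_eq_zero_of_step hF hβ hζ hq hpos (fun k => ?_) ?_
  · refine h _ (hζ.step_mul hq k fun x hx h1 => ⟨hx, ?_⟩)
    by_contra hle
    have : (k : ℝ) * wallDist n x₀ x ≤ 0 :=
      mul_nonpos_of_nonneg_of_nonpos k.cast_nonneg (not_lt.1 hle)
    linarith
  · obtain ⟨C, hC0, hC⟩ := exists_deriv_step_bound
    have h0 : (0 : ℝ) = ∫ x in V, (0 : ℝ) := by simp
    rw [h0]
    refine tendsto_integral_of_dominated_convergence (fun x => 2 * C * g x) (fun k => ?_)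
      (hg.const_mul _) (fun k => ?_) ?_
    · simp_rw [fderiv_wallDist]
      have hc : Continuous (fun x => deriv step (k * wallDist n x₀ x)) :=
        (contDiff_step.continuous_deriv (by simp)).comp (continuous_const.mul hq.continuous)
      have hm : AEStronglyMeasurable (fun x => inner ℝ n (F x)) (volume.restrict V) :=
        aestronglyMeasurable_const.inner hF.aestronglyMeasurable
      exact (hc.aestronglyMeasurable.mul (hm.const_mul _)).mul
        hζ.continuous.aestronglyMeasurable
    · filter_upwards [ae_restrict_mem hVm] with x hx
      rw [fderiv_wallDist]
      have h1 := hb x hx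
      have h2 := mul_deriv_step_le hC (k.cast_nonneg (α := ℝ)) hx.2.le
      have hgx : 0 ≤ g x := by
        have := (abs_nonneg _).trans h1
        exact nonneg_of_mul_nonneg_right this hx.2
      calc ‖deriv step (k * wallDist n x₀ x) * (k * inner ℝ n (F x)) * ζ x‖
          = |deriv step (k * wallDist n x₀ x)| * k * |ζ x * inner ℝ n (F x)| := by
            rw [Real.norm_eq_abs, ← abs_of_nonneg (k.cast_nonneg (α := ℝ)), ← abs_mul, ← abs_mul,
              abs_of_nonneg (k.cast_nonneg (α := ℝ))]
            congr 1; ring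
        _ ≤ |deriv step (k * wallDist n x₀ x)| * k * (wallDist n x₀ x * g x) := by gcongr
        _ = (|deriv step (k * wallDist n x₀ x)| * (k * wallDist n x₀ x)) * g x := by ring
        _ ≤ 2 * C * g x := by gcongr
    · filter_upwards [hpos] with x hx
      refine tendsto_const_nhds.congr' ?_
      filter_upwards [eventually_deriv_step_eq_zero hx] with k hk
      simp [hk]

/-! ### Lines are removable -/

/-- A smooth function comparable to the squared distance from the line `⟪a, x⟫ = c`,
`⟪b, x⟫ = d`. -/
def lineSq (a b : E3) (c d : ℝ) (x : E3) : ℝ := (inner ℝ a x - c) ^ 2 + (inner ℝ b x - d) ^ 2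

theorem contDiff_lineSq (a b : E3) (c d : ℝ) : ContDiff ℝ ∞ (lineSq a b c d) :=
  (((contDiff_const.inner ℝ contDiff_id).sub contDiff_const).pow 2).add
    (((contDiff_const.inner ℝ contDiff_id).sub contDiff_const).pow 2)

theorem lineSq_nonneg (a b : E3) (c d : ℝ) (x : E3) : 0 ≤ lineSq a b c d x := by
  unfold lineSq; positivity

theorem abs_fderiv_lineSq_le (a b : E3) (c d : ℝ) (x v : E3) :
    |fderiv ℝ (lineSq a b c d) x v| ≤
      2 * (‖a‖ + ‖b‖) * Real.sqrt (lineSq a b c d x) * ‖v‖ := by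
  have h1 : ∀ (a : E3) (c : ℝ), HasFDerivAt (fun x : E3 => inner ℝ a x - c) (innerSL ℝ a) x :=
    fun a c => (innerSL ℝ a).hasFDerivAt.sub_const c
  have h2 : HasFDerivAt (lineSq a b c d) _ x := ((h1 a c).pow 2).add ((h1 b d).pow 2)
  rw [h2.fderiv]
  have ha : |inner ℝ a x - c| ≤ Real.sqrt (lineSq a b c d x) :=
    Real.abs_le_sqrt (by unfold lineSq; nlinarith [sq_nonneg (inner ℝ b x - d)])
  have hb : |inner ℝ b x - d| ≤ Real.sqrt (lineSq a b c d x) :=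
    Real.abs_le_sqrt (by unfold lineSq; nlinarith [sq_nonneg (inner ℝ a x - c)])
  have hav : |inner ℝ a v| ≤ ‖a‖ * ‖v‖ := abs_real_inner_le_norm a v
  have hbv : |inner ℝ b v| ≤ ‖b‖ * ‖v‖ := abs_real_inner_le_norm b v
  simp only [add_apply, smul_apply, innerSL_apply_apply,
    smul_eq_mul, nsmul_eq_mul]
  refine (abs_add_le _ _).trans ?_
  norm_num [abs_mul]
  have e1 := mul_le_mul ha hav (abs_nonneg _) (Real.sqrt_nonneg _)
  have e2 := mul_le_mul hb hbv (abs_nonneg _) (Real.sqrt_nonneg _)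
  nlinarith

theorem exists_linearIndependent_cons {a b : E3} (hab : LinearIndependent ℝ ![a, b]) :
    ∃ m : E3, ∀ x : E3, inner ℝ a x = 0 → inner ℝ b x = 0 → inner ℝ m x = 0 → x = 0 := by
  have hlt : Module.finrank ℝ (Submodule.span ℝ (range ![a, b])) = 2 := by
    simpa using finrank_span_eq_card hab
  have hperp : Module.finrank ℝ (Submodule.span ℝ (range ![a, b]))ᗮ = 1 := by
    have := Submodule.finrank_add_finrank_orthogonal (Submodule.span ℝ (range ![a, b]))
    rw [hlt, finrank_euclideanSpace_fin] at this
    omega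
  obtain ⟨m, hm0, hm⟩ := finrank_eq_one_iff'.1 hperp
  refine ⟨m, fun x ha hb hmx => ?_⟩
  have hx : x ∈ (Submodule.span ℝ (range ![a, b]))ᗮ := by
    rw [Submodule.mem_orthogonal]
    intro y hy
    refine Submodule.span_induction (p := fun y _ => inner ℝ y x = 0) ?_ (by simp) ?_ ?_ hy
    · rintro y ⟨i, rfl⟩
      fin_cases i
      · exact ha
      · exact hb
    · intro y z _ _ h1 h2
      rw [inner_add_left, h1, h2, add_zero]
    · intro t y _ h1
      rw [real_inner_smul_left, h1, mul_zero]
  obtain ⟨t, ht⟩ := hm ⟨x, hx⟩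
  have ht' : t • (m : E3) = x := congrArg Subtype.val ht
  rw [← ht', real_inner_smul_right] at hmx
  rcases mul_eq_zero.1 hmx with h | h
  · rw [← ht', h, zero_smul]
  · rw [inner_self_eq_zero] at h
    exact absurd (Subtype.ext h) hm0

theorem exists_volume_lineSq_le {a b : E3} (hab : LinearIndependent ℝ ![a, b]) (c d M : ℝ) :
    ∃ C : ℝ, 0 ≤ C ∧ ∀ s, 0 ≤ s →
      volume ({x | lineSq a b c d x ≤ s} ∩ Metric.closedBall 0 M) ≤ ENNReal.ofReal (C * s) := by
  obtain ⟨m, hm⟩ := exists_linearIndependent_cons hab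
  let L : E3 →ₗ[ℝ] (Fin 3 → ℝ) := LinearMap.pi
    ![(innerSL ℝ a).toLinearMap, (innerSL ℝ b).toLinearMap, (innerSL ℝ m).toLinearMap]
  have hL : ∀ x, L x = ![inner ℝ a x, inner ℝ b x, inner ℝ m x] := by
    intro x; ext i; fin_cases i <;> rfl
  have hinj : Function.Injective L := by
    rw [← LinearMap.ker_eq_bot, LinearMap.ker_eq_bot']
    intro x hx
    rw [hL] at hx
    exact hm x (congrFun hx 0) (congrFun hx 1) (congrFun hx 2)
  let e : E3 ≃L[ℝ] (Fin 3 → ℝ) :=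
    (LinearEquiv.ofInjectiveOfFinrankEq L hinj (by simp)).toContinuousLinearEquiv
  have he : ∀ x, e x = L x := fun x => rfl
  set μ' : Measure (Fin 3 → ℝ) := Measure.map e volume with hμ'
  have : μ'.IsAddHaarMeasure := e.isAddHaarMeasure_map volume
  have hμ := Measure.isAddLeftInvariant_eq_smul μ' (volume : Measure (Fin 3 → ℝ))
  set κ := Measure.addHaarScalarFactor μ' (volume : Measure (Fin 3 → ℝ))
  refine ⟨κ * (8 * |‖m‖ * M|), by positivity, fun s hs => ?_⟩
  set B : Set (Fin 3 → ℝ) := Icc ![c - √s, d - √s, -|‖m‖ * M|] ![c + √s, d + √s, |‖m‖ * M|]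
  have hsub : {x | lineSq a b c d x ≤ s} ∩ Metric.closedBall 0 M ⊆ e ⁻¹' B := by
    rintro x ⟨hx, hxM⟩
    have hx' : (inner ℝ a x - c) ^ 2 + (inner ℝ b x - d) ^ 2 ≤ s := hx
    have h1 : |inner ℝ a x - c| ≤ √s :=
      Real.abs_le_sqrt (by nlinarith [sq_nonneg (inner ℝ b x - d)])
    have h2 : |inner ℝ b x - d| ≤ √s :=
      Real.abs_le_sqrt (by nlinarith [sq_nonneg (inner ℝ a x - c)])
    have h3 : |inner ℝ m x| ≤ |‖m‖ * M| := by
      refine (abs_real_inner_le_norm m x).trans ((mul_le_mul_of_nonneg_left ?_ (norm_nonneg _)).trans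
        (le_abs_self _))
      simpa using hxM
    rw [abs_le] at h1 h2 h3
    rw [mem_preimage, he, hL]
    constructor
    · intro i; fin_cases i
      · show c - √s ≤ inner ℝ a x
        linarith
      · show d - √s ≤ inner ℝ b x
        linarith
      · exact h3.1
    · intro i; fin_cases i
      · show inner ℝ a x ≤ c + √s
        linarith
      · show inner ℝ b x ≤ d + √s
        linarith
      · exact h3.2
  refine (measure_mono hsub).trans (le_of_eq ?_)
  rw [← Measure.map_apply e.continuous.measurable measurableSet_Icc, ← hμ', hμ,
    Measure.smul_apply, Real.volume_Icc_pi, Fin.prod_univ_three]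
  have k1 : (![c + √s, d + √s, |‖m‖ * M|] : Fin 3 → ℝ) 0 - (![c - √s, d - √s, -|‖m‖ * M|] : Fin 3 → ℝ) 0
    = 2 * √s := by simp; ring
  have k2 : (![c + √s, d + √s, |‖m‖ * M|] : Fin 3 → ℝ) 1 - (![c - √s, d - √s, -|‖m‖ * M|] : Fin 3 → ℝ) 1
    = 2 * √s := by simp; ring
  have k3 : (![c + √s, d + √s, |‖m‖ * M|] : Fin 3 → ℝ) 2 - (![c - √s, d - √s, -|‖m‖ * M|] : Fin 3 → ℝ) 2
    = 2 * |‖m‖ * M| := by simp; ring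
  rw [k1, k2, k3, ← ENNReal.ofReal_mul (by positivity), ← ENNReal.ofReal_mul (by positivity),
    ENNReal.smul_def, smul_eq_mul, ← ENNReal.ofReal_coe_nnreal, ← ENNReal.ofReal_mul (by positivity)]
  congr 1
  have := Real.mul_self_sqrt hs
  linear_combination (κ : ℝ) * 8 * |‖m‖ * M| * this

/-- A line has zero capacity: it can be removed from the support condition on test functions if
the field is square integrable. -/
theorem WeakDivOn.remove_line {V S : Set E3} {F : E3 → E3} {β : E3 → ℝ} {a b : E3} {c d : ℝ}
    (hV : Bornology.IsBounded V) (hVm : MeasurableSet V) (hab : LinearIndependent ℝ ![a, b])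
    (hF : MemL2 V F) (hβ : IntegrableOn β V)
    (h : WeakDivOn V (S ∪ {x | inner ℝ a x = c ∧ inner ℝ b x = d})ᶜ F β) :
    WeakDivOn V Sᶜ F β := by
  intro ζ hζ
  obtain ⟨M, hM⟩ := hV.subset_closedBall 0
  have hVfin : volume V ≠ ⊤ := hV.measure_lt_top.ne
  obtain ⟨C, hC0, hC⟩ := exists_volume_lineSq_le hab c d M
  set q := lineSq a b c d with hqdef
  have hq : ContDiff ℝ ∞ q := contDiff_lineSq a b c d
  have hvol : ∀ s, 0 ≤ s → volume ({x | q x ≤ s} ∩ V) ≤ ENNReal.ofReal (C * s) := fun s hs =>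
    (measure_mono (inter_subset_inter_right _ hM)).trans (hC s hs)
  have hpos : ∀ᵐ x ∂volume.restrict V, 0 < q x := by
    rw [ae_iff, Measure.restrict_apply' hVm]
    have := hvol 0 le_rfl
    simpa using this
  have hFi : IntegrableOn F V := hF.integrableOn hVfin
  refine integral_eq_zero_of_step hFi hβ hζ hq hpos (fun k => ?_) ?_
  · refine h _ (hζ.step_mul hq k fun x hx h1 => ?_)
    rintro (hxS | ⟨h2, h3⟩)
    · exact hx hxS
    · have : q x = 0 := by simp [hqdef, lineSq, h2, h3]
      rw [this] at h1
      norm_num at h1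
  obtain ⟨D, hD0, hD⟩ := exists_deriv_step_bound
  obtain ⟨Z, hZ0, hZ, -⟩ := hζ.exists_bound
  set N := 2 * (‖a‖ + ‖b‖) with hN
  have hN0 : 0 ≤ N := by positivity
  have hF2 : IntegrableOn (fun x => ‖F x‖ ^ 2) V := hF.integrable_norm_pow (by norm_num)
  have hFlim : Tendsto (fun k : ℕ => ∫ x in V, indicator {x | k * q x ≤ 2} (fun x => ‖F x‖ ^ 2) x)
      atTop (𝓝 0) := by
    have h0 : (0 : ℝ) = ∫ x in V, (0 : ℝ) := by simp
    rw [h0]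
    refine tendsto_integral_of_dominated_convergence (fun x => ‖F x‖ ^ 2) (fun k => ?_) hF2
      (fun k => ?_) ?_
    · exact hF2.aestronglyMeasurable.indicator
        (isClosed_le (continuous_const.mul hq.continuous) continuous_const).measurableSet
    · refine ae_of_all _ fun x => ?_
      refine (norm_indicator_le_norm_self _ _).trans ?_
      rw [Real.norm_eq_abs, abs_of_nonneg (by positivity)]
    · filter_upwards [hpos] with x hx
      refine tendsto_const_nhds.congr' ?_
      filter_upwards [(tendsto_natCast_atTop_atTop (R := ℝ)).eventually_gt_atTop (2 / q x)]
        with k hk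
      rw [div_lt_iff₀ hx] at hk
      rw [indicator_of_notMem]
      simpa using hk
  have key : ∀ l : ℝ, 0 < l → ∀ k : ℕ, 0 < k →
      ‖∫ x in V, deriv step (k * q x) * (k * fderiv ℝ q x (F x)) * ζ x‖ ≤
      D * N * Z * (l * (4 * C) +
        l⁻¹ * ∫ x in V, indicator {x | k * q x ≤ 2} (fun x => ‖F x‖ ^ 2) x) := by
    intro l hl k hk
    have hk' : (0 : ℝ) < k := by exact_mod_cast hk
    set T : Set E3 := {x | k * q x ≤ 2} with hT
    have hTm : MeasurableSet T :=
      (isClosed_le (continuous_const.mul hq.continuous) continuous_const).measurableSet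
    have hTeq : T = {x | q x ≤ 2 / k} := by
      ext x; simp only [hT, mem_ofPred_eq]; rw [le_div_iff₀ hk', mul_comm]
    have hTV : volume.real (T ∩ V) ≤ C * (2 / k) := by
      rw [hTeq]
      exact ENNReal.toReal_le_of_le_ofReal (by positivity) (hvol _ (by positivity))
    have hint1 : IntegrableOn (indicator T (fun _ => (2 * k : ℝ))) V :=
      (integrableOn_const hVfin).indicator hTm
    have hint2 : IntegrableOn (indicator T (fun x => ‖F x‖ ^ 2)) V := hF2.indicator hTm
    have hbound : ∀ x, ‖deriv step (k * q x) * (k * fderiv ℝ q x (F x)) * ζ x‖ ≤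
        D * N * Z * (l * indicator T (fun _ => (2 * k : ℝ)) x +
          l⁻¹ * indicator T (fun x => ‖F x‖ ^ 2) x) := by
      intro x
      by_cases hx : x ∈ T
      · rw [indicator_of_mem hx, indicator_of_mem hx]
        have h1 := abs_fderiv_lineSq_le a b c d x (F x)
        have hx2 : k * q x ≤ 2 := hx
        have hs : k * √(q x) ≤ √(2 * k) := by
          refine Real.le_sqrt_of_sq_le ?_
          rw [mul_pow, Real.sq_sqrt (lineSq_nonneg _ _ _ _ _)]
          nlinarith
        have hy : √(2 * k) * ‖F x‖ ≤ l * (2 * k) + l⁻¹ * ‖F x‖ ^ 2 := by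
          have h2k : √(2 * k) ^ 2 = 2 * k := Real.sq_sqrt (by positivity)
          have hsq := sq_nonneg (l * √(2 * k) - ‖F x‖)
          have e3 : 0 ≤ l * √(2 * k) * ‖F x‖ := by positivity
          have e1 : l * (2 * k) + l⁻¹ * ‖F x‖ ^ 2 =
              l⁻¹ * ((l * √(2 * k)) ^ 2 + ‖F x‖ ^ 2) := by
            rw [mul_pow, h2k]; field_simp
          have e2 : √(2 * k) * ‖F x‖ = l⁻¹ * (l * √(2 * k) * ‖F x‖) := by field_simp
          rw [e1, e2]
          refine mul_le_mul_of_nonneg_left ?_ (by positivity)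
          nlinarith
        rw [norm_mul, norm_mul, norm_mul, Real.norm_eq_abs, Real.norm_eq_abs, Real.norm_eq_abs,
          abs_of_pos hk']
        calc |deriv step (k * q x)| * (k * |fderiv ℝ q x (F x)|) * ‖ζ x‖
            ≤ D * (k * (N * √(q x) * ‖F x‖)) * Z := by
              gcongr
              · exact hD _
              · exact hZ x
          _ = D * N * Z * (k * √(q x) * ‖F x‖) := by ring
          _ ≤ D * N * Z * (√(2 * k) * ‖F x‖) := by gcongr
          _ ≤ _ := by gcongr
      · rw [indicator_of_notMem hx, indicator_of_notMem hx]
        rw [deriv_step_gt (not_le.1 hx)]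
        simp
    refine (norm_integral_le_of_norm_le
      (((hint1.const_mul l).add (hint2.const_mul l⁻¹)).const_mul (D * N * Z))
      (ae_of_all _ hbound)).trans ?_
    simp only [Pi.add_apply]
    rw [integral_const_mul, integral_add (hint1.const_mul l) (hint2.const_mul l⁻¹),
      integral_const_mul, integral_const_mul, integral_indicator hTm,
      setIntegral_const, measureReal_restrict_apply hTm, smul_eq_mul]
    have : volume.real (T ∩ V) * (2 * k) ≤ 4 * C := by
      refine (mul_le_mul_of_nonneg_right hTV (by positivity)).trans (le_of_eq ?_)
      field_simp
      ring
    gcongr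
  rw [Metric.tendsto_atTop]
  intro ε hε
  set Q := D * N * Z + 1 with hQ
  have hP0 : 0 ≤ D * N * Z := by positivity
  have hQ0 : 0 < Q := by positivity
  set l := ε / (2 * Q * (4 * C + 1)) with hl
  have hl0 : 0 < l := by positivity
  obtain ⟨k₀, hk₀⟩ := Metric.tendsto_atTop.1 hFlim (ε * l / (2 * Q)) (by positivity)
  refine ⟨max k₀ 1, fun k hk => ?_⟩
  rw [dist_zero_right]
  have h1 := hk₀ k ((le_max_left _ _).trans hk)
  rw [dist_zero_right, Real.norm_eq_abs] at h1
  have h2 := (le_abs_self _).trans_lt h1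
  refine (key l hl0 k ((le_max_right _ _).trans hk)).trans_lt ?_
  set I := ∫ x in V, indicator {x | k * q x ≤ 2} (fun x => ‖F x‖ ^ 2) x
  have hI0 : 0 ≤ I := integral_nonneg fun x => indicator_nonneg (fun _ _ => by positivity) _
  calc D * N * Z * (l * (4 * C) + l⁻¹ * I) ≤ Q * (l * (4 * C + 1) + l⁻¹ * I) := by
        gcongr <;> linarith
    _ = Q * (l * (4 * C + 1)) + Q * l⁻¹ * I := by ring
    _ < Q * (l * (4 * C + 1)) + Q * l⁻¹ * (ε * l / (2 * Q)) := by gcongr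
    _ = ε := by
      have e1 : Q * (l * (4 * C + 1)) = ε / 2 := by rw [hl]; field_simp
      have e2 : Q * l⁻¹ * (ε * l / (2 * Q)) = ε / 2 := by field_simp
      rw [e1, e2]; ring

/-! ### Localization -/

theorem IsTest.sum_integral_eq_zero {V W : Set E3} {F : E3 → E3} {β : E3 → ℝ} {ι : Type*}
    (s : Finset ι) (ζ : ι → E3 → ℝ) (hF : IntegrableOn F V) (hβ : IntegrableOn β V)
    (hζ : ∀ i ∈ s, IsTest W (ζ i))
    (h : ∀ i ∈ s, ∫ x in V, (ζ i x * β x + fderiv ℝ (ζ i) x (F x)) = 0) :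
    ∫ x in V, ((∑ i ∈ s, ζ i x) * β x + fderiv ℝ (fun y => ∑ i ∈ s, ζ i y) x (F x)) = 0 := by
  have heq : ∀ x, (∑ i ∈ s, ζ i x) * β x + fderiv ℝ (fun y => ∑ i ∈ s, ζ i y) x (F x) =
      ∑ i ∈ s, (ζ i x * β x + fderiv ℝ (ζ i) x (F x)) := by
    intro x
    rw [fderiv_fun_sum fun i hi => (hζ i hi).differentiable x, Finset.sum_add_distrib,
      Finset.sum_mul]
    simp
  simp_rw [heq]
  rw [integral_finsetSum _ fun i hi => (hζ i hi).integrableOn_add hF hβ]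
  exact Finset.sum_eq_zero h

theorem WeakDivOn.of_local {V W : Set E3} {F : E3 → E3} {β : E3 → ℝ} (hV : IsOpen V)
    (hF : IntegrableOn F V) (hβ : IntegrableOn β V)
    (h : ∀ x ∈ W, x ∈ closure V → ∃ U, IsOpen U ∧ x ∈ U ∧ WeakDivOn V U F β) :
    WeakDivOn V W F β := by
  intro ζ hζ
  set K := tsupport ζ ∩ closure V with hK
  have hK' : ∀ x : K, ∃ U, IsOpen U ∧ (x : E3) ∈ U ∧ WeakDivOn V U F β := fun x =>
    h x (hζ.tsupport_subset x.2.1) x.2.2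
  choose U hUo hxU hU using hK'
  obtain ⟨f, hf⟩ := SmoothPartitionOfUnity.exists_isSubordinate 𝓘(ℝ, E3)
    ((isClosed_tsupport ζ).inter isClosed_closure) U hUo
    (fun x hx => mem_iUnion.2 ⟨⟨x, hx⟩, hxU _⟩)
  have hfin : {i | (Function.support (f i) ∩ tsupport ζ).Nonempty}.Finite :=
    f.locallyFinite.finite_nonempty_inter_compact hζ.hasCompactSupport
  set s := hfin.toFinset with hs
  have hfd : ∀ i, ContDiff ℝ ∞ (f i) := fun i => (f i).contMDiff.contDiff
  have htest : ∀ i, IsTest W (fun x => f i x * ζ x) := fun i => hζ.mul_left (hfd i)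
  have htest' : ∀ i, IsTest (U i) (fun x => f i x * ζ x) := fun i =>
    ⟨(htest i).contDiff, (htest i).hasCompactSupport, tsupport_mul_subset_left.trans (hf i)⟩
  have hsum := IsTest.sum_integral_eq_zero s (fun i x => f i x * ζ x) hF hβ
    (fun i _ => htest i) (fun i _ => hU i _ (htest' i))
  have heq : ∀ x ∈ V, ∑ i ∈ s, f i x * ζ x = ζ x := by
    intro x hx
    rw [← Finset.sum_mul]
    by_cases hxζ : x ∈ tsupport ζ
    · have h1 := f.sum_eq_one (x := x) ⟨hxζ, subset_closure hx⟩
      rw [finsum_eq_sum_of_support_subset (s := s) _ ?_] at h1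
      · rw [h1, one_mul]
      · intro i hi
        simp only [hs, Finite.coe_toFinset]
        exact ⟨x, hi, hxζ⟩
    · rw [image_eq_zero_of_notMem_tsupport hxζ, mul_zero]
  rw [← hsum]
  refine setIntegral_congr_fun hV.measurableSet fun x hx => ?_
  have hev : (fun y => ∑ i ∈ s, f i y * ζ y) =ᶠ[𝓝 x] ζ := by
    filter_upwards [hV.mem_nhds hx] with y hy using heq y hy
  rw [heq x hx, hev.fderiv_eq]

/-! ### The null Lagrangian in the interior -/

/-- The standard basis vectors. -/
abbrev stdVec (i : Fin 3) : E3 := EuclideanSpace.single i 1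

/-- The trace of an endomorphism of Euclidean space. -/
def tr (L : E3 →L[ℝ] E3) : ℝ := ∑ i, L (stdVec i) i

theorem sum_smul_stdVec (v : E3) : ∑ i, v i • stdVec i = v := by
  ext j; fin_cases j <;> simp [Fin.sum_univ_three]

theorem tr_add (L M : E3 →L[ℝ] E3) : tr (L + M) = tr L + tr M := by
  simp [tr, Finset.sum_add_distrib]

theorem tr_smul (c : ℝ) (L : E3 →L[ℝ] E3) : tr (c • L) = c * tr L := by
  simp [tr, Finset.mul_sum]

theorem tr_comp (L M : E3 →L[ℝ] E3) :
    tr (L ∘L M) = ∑ i, ∑ j, M (stdVec i) j * L (stdVec j) i := by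
  unfold tr
  refine Finset.sum_congr rfl fun i _ => ?_
  rw [ContinuousLinearMap.comp_apply]
  conv_lhs => rw [← sum_smul_stdVec (M (stdVec i))]
  simp

theorem tr_comp_comm (L M : E3 →L[ℝ] E3) : tr (L ∘L M) = tr (M ∘L L) := by
  rw [tr_comp, tr_comp, Finset.sum_comm]
  simp_rw [mul_comm]

theorem abs_tr_le (L : E3 →L[ℝ] E3) : |tr L| ≤ 3 * ‖L‖ := by
  unfold tr
  refine (Finset.abs_sum_le_sum_abs _ _).trans ?_
  have : ∀ i ∈ Finset.univ, |L (stdVec i) i| ≤ ‖L‖ := fun i _ => by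
    have h1 : ‖L (stdVec i) i‖ ≤ ‖L (stdVec i)‖ := PiLp.norm_apply_le _ i
    have h2 := L.le_opNorm (stdVec i)
    rw [PiLp.norm_single, norm_one, mul_one] at h2
    exact h1.trans h2
  refine (Finset.sum_le_sum this).trans (by simp)

theorem continuous_tr : Continuous tr := by
  unfold tr
  refine continuous_finsetSum _ fun i _ => ?_
  fun_prop

theorem WeakJacOn.coord {V W : Set E3} {u : E3 → E3} {A : E3 → E3 →L[ℝ] E3}
    (h : WeakJacOn V W u A) (i j : Fin 3) {ζ : E3 → ℝ} (hζ : IsTest W ζ) :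
    ∫ x in V, (ζ x * A x (stdVec i) j + u x j * fderiv ℝ ζ x (stdVec i)) = 0 := by
  have := h (stdVec j) (stdVec i) ζ hζ
  simpa [EuclideanSpace.inner_single_right] using this

theorem IsTest.coord {W : Set E3} {X : E3 → E3} (h : IsTest W X) (i : Fin 3) :
    IsTest W (fun x => X x i) := by
  refine ⟨contDiff_euclidean.1 h.contDiff i,
    h.hasCompactSupport.comp_left (g := fun y : E3 => y i) rfl,
    (tsupport_comp_subset (g := fun y : E3 => y i) rfl _).trans h.tsupport_subset⟩

theorem fderiv_coord {X : E3 → E3} {x : E3} (h : DifferentiableAt ℝ X x) (i : Fin 3) (v : E3) :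
    fderiv ℝ (fun y => X y i) x v = fderiv ℝ X x v i := by
  have := ((EuclideanSpace.proj i : E3 →L[ℝ] ℝ).hasFDerivAt.comp x h.hasFDerivAt).fderiv
  exact congrArg (fun L : E3 →L[ℝ] ℝ => L v) this

theorem memLp_clm_apply {V : Set E3} {A : E3 → E3 →L[ℝ] E3} (hA : MemL2 V A) (e : E3) :
    MemL2 V (fun x => A x e) :=
  ((ContinuousLinearMap.apply ℝ E3 e).comp_memLp' hA)

theorem memLp_coord {V : Set E3} {u : E3 → E3} (hu : MemL2 V u) (j : Fin 3) :
    MemL2 V (fun x => u x j) :=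
  ((EuclideanSpace.proj j : E3 →L[ℝ] ℝ).comp_memLp' hu)

theorem integral_null_lagrangian {U : Set E3} (hU : volume U ≠ ⊤) {X z : E3 → E3}
    {B : E3 → E3 →L[ℝ] E3} (hX : IsTest U X) (hz : MemL2 U z) (hB : MemL2 U B)
    (hzB : WeakJacOn U U z B) :
    ∫ x in U, (tr (fderiv ℝ X x ∘L B x) - tr (fderiv ℝ X x) * tr (B x)) = 0 := by
  set ψ : Fin 3 → Fin 3 → E3 → ℝ := fun i j x => fderiv ℝ (fun y => X y i) x (stdVec j) with hψ
  have hψt : ∀ i j, IsTest U (ψ i j) := fun i j => (hX.coord i).fderiv_apply _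
  have hsymm : ∀ i j x, fderiv ℝ (ψ i j) x (stdVec i) = fderiv ℝ (ψ i i) x (stdVec j) := by
    intro i j x
    have hc : ContDiffAt ℝ 2 (fun y => X y i) x := (contDiff_infty.1 (hX.coord i).contDiff 2).contDiffAt
    have hs := hc.isSymmSndFDerivAt (by simp)
    have hd : DifferentiableAt ℝ (fderiv ℝ (fun y => X y i)) x :=
      (((hX.coord i).contDiff.fderiv_right (m := ∞) (by simp)).differentiable (by simp)) x
    have hf : ∀ v w : E3, fderiv ℝ (fun y => fderiv ℝ (fun y => X y i) y v) x w =
        fderiv ℝ (fderiv ℝ (fun y => X y i)) x w v := fun v w => by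
      rw [fderiv_clm_apply hd (differentiableAt_const v)]
      simp
    simp only [hψ]
    rw [hf, hf]
    exact hs _ _
  set T : Fin 3 → Fin 3 → E3 → ℝ := fun i j x =>
    (ψ i j x * B x (stdVec i) j + z x j * fderiv ℝ (ψ i j) x (stdVec i)) -
    (ψ i i x * B x (stdVec j) j + z x j * fderiv ℝ (ψ i i) x (stdVec j)) with hT
  have hi : ∀ i j k l m, IntegrableOn
      (fun x => ψ i j x * B x (stdVec k) l + z x l * fderiv ℝ (ψ i j) x (stdVec m)) U := by
    intro i j k l m
    refine ((hψt i j).integrableOn_mul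
      ((memLp_coord (memLp_clm_apply hB (stdVec k)) l).integrableOn hU)).add ?_
    have := ((hψt i j).fderiv_apply (stdVec m)).integrableOn_mul ((memLp_coord hz l).integrableOn hU)
    exact this.congr (ae_of_all _ fun x => mul_comm _ _)
  have heq : ∀ x, tr (fderiv ℝ X x ∘L B x) - tr (fderiv ℝ X x) * tr (B x) =
      ∑ i, ∑ j, T i j x := by
    intro x
    rw [tr_comp]
    unfold tr
    rw [Finset.sum_mul_sum, ← Finset.sum_sub_distrib]
    refine Finset.sum_congr rfl fun i _ => ?_
    rw [← Finset.sum_sub_distrib]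
    refine Finset.sum_congr rfl fun j _ => ?_
    simp only [hT, hsymm]
    simp only [hψ, fderiv_coord (hX.differentiable x)]
    ring
  simp_rw [heq]
  have hTi : ∀ i j, IntegrableOn (T i j) U := fun i j => (hi i j i j i).sub (hi i i j j j)
  rw [integral_finsetSum _ fun i _ => integrable_finsetSum _ fun j _ => hTi i j]
  refine Finset.sum_eq_zero fun i _ => ?_
  rw [integral_finsetSum _ fun j _ => hTi i j]
  refine Finset.sum_eq_zero fun j _ => ?_
  simp only [hT]
  rw [integral_sub (hi i j i j i) (hi i i j j j), hzB.coord i j (hψt i j), hzB.coord j j (hψt i i),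
    sub_zero]

/-! ### Convergence of integrals with converging majorants -/

theorem tendsto_integral_of_tendsto_majorant {α : Type*} [MeasurableSpace α] {μ : Measure α}
    {f g : ℕ → α → ℝ} {F G : α → ℝ} (hf : ∀ k, AEStronglyMeasurable (f k) μ)
    (hF : Integrable F μ) (hg : ∀ k, Integrable (g k) μ) (hG : Integrable G μ)
    (hfg : ∀ k, ∀ᵐ x ∂μ, |f k x| ≤ g k x) (hFG : ∀ᵐ x ∂μ, |F x| ≤ G x)
    (hlimf : ∀ᵐ x ∂μ, Tendsto (fun k => f k x) atTop (𝓝 (F x)))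
    (hlimg : ∀ᵐ x ∂μ, Tendsto (fun k => g k x) atTop (𝓝 (G x)))
    (hint : Tendsto (fun k => ∫ x, g k x ∂μ) atTop (𝓝 (∫ x, G x ∂μ))) :
    Tendsto (fun k => ∫ x, f k x ∂μ) atTop (𝓝 (∫ x, F x ∂μ)) := by
  have hfi : ∀ k, Integrable (f k) μ := fun k => (hg k).mono' (hf k) (hfg k)
  have hd : ∀ k, Integrable (fun x => |f k x - F x|) μ := fun k => ((hfi k).sub hF).abs
  have hmin : ∀ k, Integrable (fun x => min |f k x - F x| (2 * G x)) μ := fun k =>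
    (hd k).inf (hG.const_mul 2)
  have hmax : ∀ k, Integrable (fun x => max (G x - g k x) 0) μ := fun k => (hG.sub (hg k)).pos_part
  have hgG : ∀ k, Integrable (fun x => g k x - G x) μ := fun k => (hg k).sub hG
  have h1 : Tendsto (fun k => ∫ x, min |f k x - F x| (2 * G x) ∂μ) atTop (𝓝 0) := by
    suffices h : Tendsto _ _ (𝓝 (∫ _, (0 : ℝ) ∂μ)) by rwa [integral_zero] at h
    refine tendsto_integral_of_dominated_convergence (fun x => 2 * G x)
      (fun k => (hmin k).aestronglyMeasurable) (hG.const_mul 2)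
      (fun k => ?_) ?_
    · filter_upwards [hFG] with x hx
      have hGx : 0 ≤ G x := (abs_nonneg _).trans hx
      rw [Real.norm_eq_abs, abs_of_nonneg (le_min (abs_nonneg _) (by linarith))]
      exact min_le_right _ _
    · filter_upwards [hFG, hlimf] with x hx hl
      have hGx : 0 ≤ G x := (abs_nonneg _).trans hx
      have : Tendsto (fun k => |f k x - F x|) atTop (𝓝 0) := by
        simpa using (hl.sub_const (F x)).abs
      simpa [hGx] using this.min (tendsto_const_nhds (x := 2 * G x))
  have h2 : Tendsto (fun k => ∫ x, max (G x - g k x) 0 ∂μ) atTop (𝓝 0) := by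
    suffices h : Tendsto _ _ (𝓝 (∫ _, (0 : ℝ) ∂μ)) by rwa [integral_zero] at h
    refine tendsto_integral_of_dominated_convergence G
      (fun k => (hmax k).aestronglyMeasurable) hG (fun k => ?_) ?_
    · filter_upwards [hFG, hfg k] with x hx hx'
      have hGx : 0 ≤ G x := (abs_nonneg _).trans hx
      have hgx : 0 ≤ g k x := (abs_nonneg _).trans hx'
      rw [Real.norm_eq_abs, abs_of_nonneg (le_max_right _ _)]
      exact max_le (by linarith) hGx
    · filter_upwards [hlimg] with x hl
      simpa using (hl.const_sub (G x)).max (tendsto_const_nhds (x := (0 : ℝ)))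
  have h3 := (h1.add (hint.sub_const (∫ x, G x ∂μ))).add h2
  rw [sub_self, add_zero, add_zero] at h3
  rw [tendsto_iff_norm_sub_tendsto_zero]
  refine squeeze_zero (fun _ => norm_nonneg _) (fun k => ?_) h3
  have hmg : Integrable (fun x => min |f k x - F x| (2 * G x) + (g k x - G x)) μ :=
    (hmin k).add (hgG k)
  rw [← integral_sub (hfi k) hF, ← integral_sub (hg k) hG,
    ← integral_add (hmin k) (hgG k), ← integral_add hmg (hmax k)]
  refine (norm_integral_le_integral_norm _).trans ?_
  refine integral_mono_ae ((hfi k).sub hF).norm (hmg.add (hmax k)) ?_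
  filter_upwards [hfg k, hFG] with x hx hx'
  have h4 : |f k x - F x| ≤ g k x + G x := (abs_sub _ _).trans (add_le_add hx hx')
  simp only [Real.norm_eq_abs]
  rcases min_cases |f k x - F x| (2 * G x) with ⟨h5, _⟩ | ⟨h5, _⟩ <;>
  rcases max_cases (G x - g k x) 0 with ⟨h6, _⟩ | ⟨h6, _⟩ <;> linarith

section

/-! ### Mollification -/

/-- A sequence of bump functions shrinking to the origin. -/
def shrinkingBump (k : ℕ) : ContDiffBump (0 : E3) where
  rIn := 1 / (2 * (k + 1))
  rOut := 1 / (k + 1)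
  rIn_pos := by positivity
  rIn_lt_rOut := by
    apply one_div_lt_one_div_of_lt <;> nlinarith [k.cast_nonneg (α := ℝ)]

/-- The mollifying kernels. -/
def kern (k : ℕ) : E3 → ℝ := (shrinkingBump k).normed volume

theorem contDiff_kern (k : ℕ) : ContDiff ℝ ∞ (kern k) := (shrinkingBump k).contDiff_normed

theorem kern_nonneg (k : ℕ) (x : E3) : 0 ≤ kern k x := (shrinkingBump k).nonneg_normed x

theorem hasCompactSupport_kern (k : ℕ) : HasCompactSupport (kern k) :=
  (shrinkingBump k).hasCompactSupport_normed

theorem integral_kern (k : ℕ) : ∫ x, kern k x = 1 := (shrinkingBump k).integral_normed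

theorem integrable_kern (k : ℕ) : Integrable (kern k) :=
  (contDiff_kern k).continuous.integrable_of_hasCompactSupport (hasCompactSupport_kern k)

theorem tsupport_kern (k : ℕ) : tsupport (kern k) = Metric.closedBall 0 (1 / (k + 1)) :=
  (shrinkingBump k).tsupport_normed_eq

variable {F : Type*} [NormedAddCommGroup F] [NormedSpace ℝ F]

/-- Mollification. -/
def moll (k : ℕ) (h : E3 → F) : E3 → F :=
  kern k ⋆[ContinuousLinearMap.lsmul ℝ ℝ, volume] h

theorem moll_apply (k : ℕ) (h : E3 → F) (x : E3) : moll k h x = ∫ t, kern k t • h (x - t) := rfl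

theorem integrable_kern_smul (k : ℕ) {h : E3 → F} (hh : LocallyIntegrable h) (x : E3) :
    Integrable (fun t => kern k t • h (x - t)) :=
  ((hasCompactSupport_kern k).convolutionExists_left (ContinuousLinearMap.lsmul ℝ ℝ)
    (contDiff_kern k).continuous hh) x

theorem contDiff_moll (k : ℕ) {h : E3 → F} (hh : LocallyIntegrable h) :
    ContDiff ℝ ∞ (moll k h) :=
  (hasCompactSupport_kern k).contDiff_convolution_left _ (contDiff_kern k) hh

theorem ae_tendsto_moll [CompleteSpace F] {h : E3 → F} (hh : LocallyIntegrable h) :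
    ∀ᵐ x, Tendsto (fun k => moll k h x) atTop (𝓝 (h x)) := by
  refine ContDiffBump.ae_convolution_tendsto_right_of_locallyIntegrable (K := 2)
    (φ := shrinkingBump) (l := atTop) ?_ (Eventually.of_forall fun k => ?_) hh
  · exact tendsto_one_div_add_atTop_nhds_zero_nat
  · show (1 : ℝ) / (k + 1) ≤ 2 * (1 / (2 * (k + 1)))
    apply le_of_eq; field_simp

theorem clm_moll {G : Type*} [NormedAddCommGroup G] [NormedSpace ℝ G] [CompleteSpace F]
    [CompleteSpace G] (L : F →L[ℝ] G) (k : ℕ) {h : E3 → F} (hh : LocallyIntegrable h) (x : E3) :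
    moll k (fun y => L (h y)) x = L (moll k h x) := by
  rw [moll_apply, moll_apply, ← L.integral_comp_comm (integrable_kern_smul k hh x)]
  simp

theorem norm_moll_sq_le (k : ℕ) {h : E3 → F} (hh : LocallyIntegrable h)
    (hh2 : LocallyIntegrable (fun x => ‖h x‖ ^ 2)) (x : E3) :
    ‖moll k h x‖ ^ 2 ≤ moll k (fun x => ‖h x‖ ^ 2) x := by
  set m := ∫ t, kern k t * ‖h (x - t)‖ with hm
  have hi1 : Integrable (fun t => kern k t * ‖h (x - t)‖) := by
    refine (integrable_kern_smul k hh x).norm.congr (ae_of_all _ fun t => ?_)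
    simp [norm_smul, abs_of_nonneg (kern_nonneg k t)]
  have hi2 : Integrable (fun t => kern k t * ‖h (x - t)‖ ^ 2) := integrable_kern_smul k hh2 x
  have h1 : ‖moll k h x‖ ≤ m := by
    refine (norm_integral_le_integral_norm _).trans (le_of_eq (integral_congr_ae
      (ae_of_all _ fun t => ?_)))
    simp [norm_smul, abs_of_nonneg (kern_nonneg k t)]
  have h2 : 0 ≤ ∫ t, kern k t * (‖h (x - t)‖ - m) ^ 2 :=
    integral_nonneg fun t => mul_nonneg (kern_nonneg k t) (sq_nonneg _)
  have h3 : ∫ t, kern k t * (‖h (x - t)‖ - m) ^ 2 =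
      (∫ t, kern k t * ‖h (x - t)‖ ^ 2) - 2 * m * m + m ^ 2 := by
    have hi3 : Integrable (fun t => kern k t * ‖h (x - t)‖ ^ 2 - 2 * m * (kern k t * ‖h (x - t)‖)) :=
      hi2.sub (hi1.const_mul _)
    calc _ = ∫ t, (kern k t * ‖h (x - t)‖ ^ 2 - 2 * m * (kern k t * ‖h (x - t)‖) +
          m ^ 2 * kern k t) := by congr 1; ext t; ring
      _ = _ := by
        rw [integral_add hi3 ((integrable_kern k).const_mul _),
          integral_sub hi2 (hi1.const_mul _), integral_const_mul, integral_const_mul,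
          integral_kern, mul_one]
  have h4 : m ^ 2 ≤ moll k (fun x => ‖h x‖ ^ 2) x := by
    show m ^ 2 ≤ ∫ t, kern k t * ‖h (x - t)‖ ^ 2
    nlinarith
  exact (pow_le_pow_left₀ (norm_nonneg _) h1 2).trans h4

theorem integral_moll (k : ℕ) {h : E3 → ℝ} (hh : Integrable h) : ∫ x, moll k h x = ∫ x, h x := by
  unfold moll
  rw [integral_convolution _ (integrable_kern k) hh, integral_kern]
  simp

theorem integrable_moll (k : ℕ) {h : E3 → ℝ} (hh : Integrable h) : Integrable (moll k h) :=
  (integrable_kern k).integrable_convolution _ hh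

theorem fderiv_moll_apply (k : ℕ) {h : E3 → ℝ} (hh : LocallyIntegrable h) (x e : E3) :
    fderiv ℝ (moll k h) x e = ∫ t, fderiv ℝ (kern k) (x - t) e * h t := by
  have h1 := (hasCompactSupport_kern k).hasFDerivAt_convolution_left
    (ContinuousLinearMap.lsmul ℝ ℝ) ((contDiff_kern k).of_le (by exact_mod_cast le_top)) hh x
  have h2 : fderiv ℝ (moll k h) x = _ := h1.fderiv
  have h3 := ((hasCompactSupport_kern k).fderiv ℝ).convolutionExists_left
    ((ContinuousLinearMap.lsmul ℝ ℝ : ℝ →L[ℝ] ℝ →L[ℝ] ℝ).precompL E3)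
    ((contDiff_kern k).continuous_fderiv (by simp)) hh x
  rw [h2, convolution_eq_swap, ContinuousLinearMap.integral_apply h3.integrable_swap]
  rfl

theorem fderiv_moll_indicator {U : Set E3} (hUm : MeasurableSet U) (hU : volume U ≠ ⊤)
    {w : E3 → E3} {A : E3 → E3 →L[ℝ] E3} (hw : MemL2 U w) (hA : MemL2 U A)
    (hwA : WeakJacOn U U w A) {k : ℕ} {x : E3} (hx : Metric.closedBall x (1 / (k + 1)) ⊆ U) :
    fderiv ℝ (moll k (U.indicator w)) x = moll k (U.indicator A) x := by
  have hwi : Integrable (U.indicator w) := (integrable_indicator_iff hUm).2 (hw.integrableOn hU)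
  have hAi : Integrable (U.indicator A) := (integrable_indicator_iff hUm).2 (hA.integrableOn hU)
  ext e j
  have hd : DifferentiableAt ℝ (moll k (U.indicator w)) x :=
    (contDiff_moll k hwi.locallyIntegrable).differentiable (by simp) x
  rw [← fderiv_coord hd]
  have e1 : (fun y => moll k (U.indicator w) y j) =
      moll k (fun y => (EuclideanSpace.proj j : E3 →L[ℝ] ℝ) (U.indicator w y)) := by
    ext y
    exact (clm_moll (EuclideanSpace.proj j : E3 →L[ℝ] ℝ) k hwi.locallyIntegrable y).symm
  set L : (E3 →L[ℝ] E3) →L[ℝ] ℝ :=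
    (EuclideanSpace.proj j : E3 →L[ℝ] ℝ) ∘L (ContinuousLinearMap.apply ℝ E3 e) with hL
  have e2 : moll k (U.indicator A) x e j = moll k (fun y => L (U.indicator A y)) x :=
    (clm_moll L k hAi.locallyIntegrable x).symm
  have hwi' : Integrable (fun y => (EuclideanSpace.proj j : E3 →L[ℝ] ℝ) (U.indicator w y)) :=
    (EuclideanSpace.proj j : E3 →L[ℝ] ℝ).integrable_comp hwi
  rw [e1, e2, fderiv_moll_apply k hwi'.locallyIntegrable]
  set ψ : E3 → ℝ := fun t => kern k (x - t) with hψ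
  have hψt : IsTest U ψ := by
    refine ⟨(contDiff_kern k).comp (contDiff_const.sub contDiff_id), ?_, ?_⟩
    · exact (hasCompactSupport_kern k).comp_homeomorph (Homeomorph.subLeft x)
    · have : tsupport ψ ⊆ {t | x - t ∈ tsupport (kern k)} :=
        closure_minimal (fun t ht => subset_closure ht)
          ((isClosed_tsupport _).preimage (continuous_const.sub continuous_id))
      refine this.trans fun t ht => hx ?_
      rw [mem_ofPred_eq, tsupport_kern] at ht
      simpa [dist_eq_norm, norm_sub_rev] using ht
  have hψd : ∀ t, fderiv ℝ ψ t e = - fderiv ℝ (kern k) (x - t) e := by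
    intro t
    have h1 : HasFDerivAt (fun t : E3 => x - t) (-ContinuousLinearMap.id ℝ E3) t :=
      (hasFDerivAt_id t).const_sub x
    have h2 := (((contDiff_kern k).differentiable (by simp)) (x - t)).hasFDerivAt.comp t h1
    have h3 : fderiv ℝ ψ t = _ := h2.fderiv
    rw [h3]; simp
  have hjac := hwA (stdVec j) e ψ hψt
  have i1 : IntegrableOn (fun t => ψ t * A t e j) U :=
    hψt.integrableOn_mul ((memLp_coord (memLp_clm_apply hA e) j).integrableOn hU)
  have i2 : IntegrableOn (fun t => w t j * fderiv ℝ ψ t e) U := by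
    have := (hψt.fderiv_apply e).integrableOn_mul ((memLp_coord hw j).integrableOn hU)
    exact this.congr (ae_of_all _ fun t => mul_comm _ _)
  have hjac' : ∫ t in U, (ψ t * A t e j + w t j * fderiv ℝ ψ t e) = 0 := by
    simpa [EuclideanSpace.inner_single_right] using hjac
  rw [integral_add i1 i2] at hjac'
  have k1 : ∫ t, fderiv ℝ (kern k) (x - t) e *
      (EuclideanSpace.proj j : E3 →L[ℝ] ℝ) (U.indicator w t) =
      - ∫ t in U, w t j * fderiv ℝ ψ t e := by
    rw [← integral_indicator hUm, ← integral_neg]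
    refine integral_congr_ae (ae_of_all _ fun t => ?_)
    by_cases ht : t ∈ U
    · simp [ht, hψd, mul_comm]
    · simp [ht]
  have k2 : moll k (fun y => L (U.indicator A y)) x = ∫ t in U, ψ t * A t e j := by
    unfold moll
    rw [convolution_eq_swap, ← integral_indicator hUm]
    refine integral_congr_ae (ae_of_all _ fun t => ?_)
    by_cases ht : t ∈ U
    · simp [ht, hψ, hL]
    · simp [ht]
  rw [k1, k2]
  linarith

end

/-! ### The flux of the null Lagrangian -/

/-- The flux `B X - (tr B) X` with `X = G ∘ w`. -/
def lagFlux (G w : E3 → E3) (B : E3 → E3 →L[ℝ] E3) (x : E3) : E3 :=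
  B x (G (w x)) - tr (B x) • G (w x)

/-- The null Lagrangian `tr (D B) - tr D tr B` with `D = D(G ∘ w)`. -/
def lagDens (G w : E3 → E3) (A B : E3 → E3 →L[ℝ] E3) (x : E3) : ℝ :=
  tr ((fderiv ℝ G (w x) ∘L A x) ∘L B x) - tr (fderiv ℝ G (w x) ∘L A x) * tr (B x)

theorem norm_lagFlux_le {G w : E3 → E3} {B : E3 → E3 →L[ℝ] E3} {M : ℝ} (hG : ∀ y, ‖G y‖ ≤ M)
    (x : E3) : ‖lagFlux G w B x‖ ≤ 4 * M * ‖B x‖ := by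
  have h1 : ‖B x (G (w x))‖ ≤ ‖B x‖ * M := (B x).le_opNorm_of_le (hG _)
  have h2 : ‖tr (B x) • G (w x)‖ ≤ 3 * ‖B x‖ * M := by
    rw [norm_smul]
    exact mul_le_mul (abs_tr_le _) (hG _) (norm_nonneg _) (by positivity)
  have := norm_sub_le (B x (G (w x))) (tr (B x) • G (w x))
  unfold lagFlux
  linarith

theorem abs_lagDens_le {G w : E3 → E3} {A B : E3 → E3 →L[ℝ] E3} {M : ℝ}
    (hG : ∀ y, ‖fderiv ℝ G y‖ ≤ M) (x : E3) :
    |lagDens G w A B x| ≤ 6 * M * (‖A x‖ ^ 2 + ‖B x‖ ^ 2) := by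
  have hM : 0 ≤ M := (norm_nonneg _).trans (hG 0)
  have h0 : ‖fderiv ℝ G (w x) ∘L A x‖ ≤ M * ‖A x‖ :=
    (ContinuousLinearMap.opNorm_comp_le _ _).trans
      (mul_le_mul_of_nonneg_right (hG _) (norm_nonneg _))
  have h1 : |tr ((fderiv ℝ G (w x) ∘L A x) ∘L B x)| ≤ 3 * (M * ‖A x‖ * ‖B x‖) :=
    (abs_tr_le _).trans (mul_le_mul_of_nonneg_left ((ContinuousLinearMap.opNorm_comp_le _ _).trans
      (mul_le_mul_of_nonneg_right h0 (norm_nonneg _))) (by norm_num))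
  have h2 : |tr (fderiv ℝ G (w x) ∘L A x) * tr (B x)| ≤ 3 * (M * ‖A x‖) * (3 * ‖B x‖) := by
    rw [abs_mul]
    exact mul_le_mul ((abs_tr_le _).trans (mul_le_mul_of_nonneg_left h0 (by norm_num)))
      (abs_tr_le _) (abs_nonneg _) (by positivity)
  have h3 := abs_sub (tr ((fderiv ℝ G (w x) ∘L A x) ∘L B x))
    (tr (fderiv ℝ G (w x) ∘L A x) * tr (B x))
  have h4 : 12 * (M * (‖A x‖ * ‖B x‖)) ≤ 6 * M * (‖A x‖ ^ 2 + ‖B x‖ ^ 2) := by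
    have := mul_nonneg hM (sq_nonneg (‖A x‖ - ‖B x‖))
    nlinarith
  unfold lagDens
  linarith

theorem aestronglyMeasurable_lagFlux {μ : Measure E3} {G w : E3 → E3} {B : E3 → E3 →L[ℝ] E3}
    (hG : Continuous G) (hw : AEStronglyMeasurable w μ) (hB : AEStronglyMeasurable B μ) :
    AEStronglyMeasurable (lagFlux G w B) μ := by
  have h1 := hG.comp_aestronglyMeasurable hw
  exact (aestronglyMeasurable_clm_apply hB h1).sub
    ((continuous_tr.comp_aestronglyMeasurable hB).smul h1)

theorem aestronglyMeasurable_clm_comp {μ : Measure E3} {A B : E3 → E3 →L[ℝ] E3}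
    (hA : AEStronglyMeasurable A μ) (hB : AEStronglyMeasurable B μ) :
    AEStronglyMeasurable (fun x => A x ∘L B x) μ :=
  (isBoundedBilinearMap_comp (𝕜 := ℝ) (E := E3) (F := E3) (G := E3)).continuous.comp_aestronglyMeasurable
    (hA.prodMk hB)

theorem aestronglyMeasurable_lagDens {μ : Measure E3} {G w : E3 → E3} {A B : E3 → E3 →L[ℝ] E3}
    (hG : ContDiff ℝ ∞ G) (hw : AEStronglyMeasurable w μ) (hA : AEStronglyMeasurable A μ)
    (hB : AEStronglyMeasurable B μ) : AEStronglyMeasurable (lagDens G w A B) μ := by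
  have h1 := aestronglyMeasurable_clm_comp
    ((hG.continuous_fderiv (by simp)).comp_aestronglyMeasurable hw) hA
  exact (continuous_tr.comp_aestronglyMeasurable (aestronglyMeasurable_clm_comp h1 hB)).sub
    ((continuous_tr.comp_aestronglyMeasurable h1).mul (continuous_tr.comp_aestronglyMeasurable hB))

theorem memL2_lagFlux {V : Set E3} {G w : E3 → E3} {B : E3 → E3 →L[ℝ] E3} {M : ℝ}
    (hG : Continuous G) (hGM : ∀ y, ‖G y‖ ≤ M) (hw : MemL2 V w) (hB : MemL2 V B) :
    MemL2 V (lagFlux G w B) :=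
  MemLp.of_le_mul hB (aestronglyMeasurable_lagFlux hG hw.1 hB.1)
    (ae_of_all _ fun x => norm_lagFlux_le hGM x)

theorem integrableOn_lagDens {V : Set E3} {G w : E3 → E3} {A B : E3 → E3 →L[ℝ] E3} {M : ℝ}
    (hG : ContDiff ℝ ∞ G) (hGM : ∀ y, ‖fderiv ℝ G y‖ ≤ M) (hw : MemL2 V w) (hA : MemL2 V A)
    (hB : MemL2 V B) : IntegrableOn (lagDens G w A B) V :=
  (((hA.integrable_norm_pow (by norm_num)).add (hB.integrable_norm_pow (by norm_num))).const_mul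
    (6 * M)).mono' (aestronglyMeasurable_lagDens hG hw.1 hA.1 hB.1)
    (ae_of_all _ fun x => abs_lagDens_le hGM x)

theorem lagDens_add_lagFlux {G W : E3 → E3} {ζ : E3 → ℝ} {B : E3 → E3 →L[ℝ] E3} {x : E3}
    (hG : Differentiable ℝ G) (hW : DifferentiableAt ℝ W x) (hζ : DifferentiableAt ℝ ζ x) :
    tr (fderiv ℝ (fun y => ζ y • G (W y)) x ∘L B x) -
      tr (fderiv ℝ (fun y => ζ y • G (W y)) x) * tr (B x) =
    ζ x * lagDens G W (fderiv ℝ W) B x + fderiv ℝ ζ x (lagFlux G W B x) := by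
  have h1 := hζ.hasFDerivAt.smul ((hG (W x)).hasFDerivAt.comp x hW.hasFDerivAt)
  have h2 : fderiv ℝ (fun y => ζ y • G (W y)) x = _ := h1.fderiv
  have h3 : ∀ (l : E3 →L[ℝ] ℝ) (v : E3), tr (l.smulRight v) = l v := by
    intro l v
    conv_rhs => rw [← sum_smul_stdVec v]
    simp [tr, mul_comm]
  have h4 : ∀ (l : E3 →L[ℝ] ℝ) (v : E3) (L : E3 →L[ℝ] E3),
      tr ((l.smulRight v) ∘L L) = l (L v) := by
    intro l v L
    exact h3 (l ∘L L) v
  rw [h2]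
  simp only [Function.comp_apply, ContinuousLinearMap.add_comp, tr_add,
    ContinuousLinearMap.smul_comp, tr_smul, h3, h4, lagDens, lagFlux, map_sub, map_smul,
    smul_eq_mul]
  ring

theorem tendsto_lag {ζ : ℝ} {l : E3 →L[ℝ] ℝ} {G : E3 → E3} (hG : ContDiff ℝ ∞ G)
    {W : ℕ → E3} {A : ℕ → E3 →L[ℝ] E3} {W' : E3} {A' B : E3 →L[ℝ] E3}
    (hW : Tendsto W atTop (𝓝 W')) (hA : Tendsto A atTop (𝓝 A')) :
    Tendsto (fun k => ζ * (tr ((fderiv ℝ G (W k) ∘L A k) ∘L B) -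
      tr (fderiv ℝ G (W k) ∘L A k) * tr B) + l (B (G (W k)) - tr B • G (W k))) atTop
      (𝓝 (ζ * (tr ((fderiv ℝ G W' ∘L A') ∘L B) -
      tr (fderiv ℝ G W' ∘L A') * tr B) + l (B (G W') - tr B • G W'))) := by
  have hcomp : ∀ {L : ℕ → E3 →L[ℝ] E3} {N : ℕ → E3 →L[ℝ] E3} {L' N' : E3 →L[ℝ] E3},
      Tendsto L atTop (𝓝 L') → Tendsto N atTop (𝓝 N') →
      Tendsto (fun k => L k ∘L N k) atTop (𝓝 (L' ∘L N')) := by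
    intro L N L' N' hL hN
    have hc : Continuous (fun p : (E3 →L[ℝ] E3) × (E3 →L[ℝ] E3) => p.1 ∘L p.2) :=
      (isBoundedBilinearMap_comp (𝕜 := ℝ) (E := E3) (F := E3) (G := E3)).continuous
    exact (hc.tendsto (L', N')).comp (hL.prodMk_nhds hN)
  have h0 : Tendsto (fun k => G (W k)) atTop (𝓝 (G W')) := (hG.continuous.tendsto W').comp hW
  have h1 : Tendsto (fun k => fderiv ℝ G (W k)) atTop (𝓝 (fderiv ℝ G W')) :=
    ((hG.continuous_fderiv (by simp)).tendsto W').comp hW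
  have h2 : Tendsto (fun k => fderiv ℝ G (W k) ∘L A k) atTop (𝓝 (fderiv ℝ G W' ∘L A')) :=
    hcomp h1 hA
  have h3 : Tendsto (fun k => (fderiv ℝ G (W k) ∘L A k) ∘L B) atTop
      (𝓝 ((fderiv ℝ G W' ∘L A') ∘L B)) :=
    hcomp h2 tendsto_const_nhds
  have h4 : Tendsto (fun k => tr (fderiv ℝ G (W k) ∘L A k)) atTop
      (𝓝 (tr (fderiv ℝ G W' ∘L A'))) := (continuous_tr.tendsto _).comp h2
  have h5 : Tendsto (fun k => tr ((fderiv ℝ G (W k) ∘L A k) ∘L B)) atTop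
      (𝓝 (tr ((fderiv ℝ G W' ∘L A') ∘L B))) := (continuous_tr.tendsto _).comp h3
  have h6 : Tendsto (fun k => B (G (W k))) atTop (𝓝 (B (G W'))) := (B.continuous.tendsto _).comp h0
  have h7 : Tendsto (fun k => B (G (W k)) - tr B • G (W k)) atTop (𝓝 (B (G W') - tr B • G W')) :=
    h6.sub (h0.const_smul (tr B))
  have h8 : Tendsto (fun k => l (B (G (W k)) - tr B • G (W k))) atTop
      (𝓝 (l (B (G W') - tr B • G W'))) := (l.continuous.tendsto _).comp h7
  exact ((h5.sub (h4.mul_const (tr B))).const_mul ζ).add h8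

theorem weakDivOn_lagFlux {U : Set E3} (hUo : IsOpen U) (hU : volume U ≠ ⊤) {G w z : E3 → E3}
    {A B : E3 → E3 →L[ℝ] E3} {M : ℝ} (hG : ContDiff ℝ ∞ G) (hGM : ∀ y, ‖G y‖ ≤ M)
    (hGM' : ∀ y, ‖fderiv ℝ G y‖ ≤ M) (hw : MemL2 U w) (hA : MemL2 U A) (hz : MemL2 U z)
    (hB : MemL2 U B) (hwA : WeakJacOn U U w A) (hzB : WeakJacOn U U z B) :
    WeakDivOn U U (lagFlux G w B) (lagDens G w A B) := by
  intro ζ hζ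
  have hUm := hUo.measurableSet
  have hM : 0 ≤ M := (norm_nonneg _).trans (hGM 0)
  obtain ⟨Z, hZ0, hZ, hZ'⟩ := hζ.exists_bound
  set w' := U.indicator w with hw'
  set A' := U.indicator A with hA'
  set B' := U.indicator B with hB'
  have hwi : Integrable w' := (integrable_indicator_iff hUm).2 (hw.integrableOn hU)
  have hAi : Integrable A' := (integrable_indicator_iff hUm).2 (hA.integrableOn hU)
  have hBi : Integrable B' := (integrable_indicator_iff hUm).2 (hB.integrableOn hU)
  have hA2 : Integrable (fun x => ‖A' x‖ ^ 2) :=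
    ((memLp_indicator_iff_restrict hUm).2 hA).integrable_norm_pow (by norm_num)
  have hB2 : Integrable (fun x => ‖B' x‖ ^ 2) :=
    ((memLp_indicator_iff_restrict hUm).2 hB).integrable_norm_pow (by norm_num)
  set f : ℕ → E3 → ℝ := fun k x => ζ x * lagDens G (moll k w') (moll k A') B' x +
    fderiv ℝ ζ x (lagFlux G (moll k w') B' x) with hf
  set f₀ : E3 → ℝ := fun x => ζ x * lagDens G w' A' B' x + fderiv ℝ ζ x (lagFlux G w' B' x)
    with hf₀
  set g₀ : E3 → ℝ := fun x => Z * (6 * M * (‖A' x‖ ^ 2 + ‖B' x‖ ^ 2)) + Z * (4 * M * ‖B' x‖)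
    with hg₀
  set g : ℕ → E3 → ℝ := fun k x =>
    Z * (6 * M * (moll k (fun y => ‖A' y‖ ^ 2) x + ‖B' x‖ ^ 2)) + Z * (4 * M * ‖B' x‖) with hg
  have hg₀i : Integrable g₀ :=
    (((hA2.add hB2).const_mul _).const_mul _).add ((hBi.norm.const_mul _).const_mul _)
  have hgi : ∀ k, Integrable (g k) := fun k =>
    ((((integrable_moll k hA2).add hB2).const_mul _).const_mul _).add
      ((hBi.norm.const_mul _).const_mul _)
  have hbd : ∀ (W : E3 → E3) (D : E3 → E3 →L[ℝ] E3) x,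
      |ζ x * lagDens G W D B' x + fderiv ℝ ζ x (lagFlux G W B' x)| ≤
      Z * (6 * M * (‖D x‖ ^ 2 + ‖B' x‖ ^ 2)) + Z * (4 * M * ‖B' x‖) := by
    intro W D x
    refine (abs_add_le _ _).trans (add_le_add ?_ ?_)
    · rw [abs_mul]
      exact mul_le_mul (hZ x) (abs_lagDens_le hGM' x) (abs_nonneg _) hZ0
    · exact ((fderiv ℝ ζ x).le_opNorm _).trans
        (mul_le_mul (hZ' x) (norm_lagFlux_le hGM x) (norm_nonneg _) hZ0)
  have hfm : ∀ (W : E3 → E3) (D : E3 → E3 →L[ℝ] E3), AEStronglyMeasurable W volume →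
      AEStronglyMeasurable D volume → AEStronglyMeasurable
      (fun x => ζ x * lagDens G W D B' x + fderiv ℝ ζ x (lagFlux G W B' x)) volume := by
    intro W D hWm hDm
    exact (hζ.continuous.aestronglyMeasurable.mul
      (aestronglyMeasurable_lagDens hG hWm hDm hBi.1)).add
      (aestronglyMeasurable_clm_apply hζ.continuous_fderiv.aestronglyMeasurable
        (aestronglyMeasurable_lagFlux hG.continuous hWm hBi.1))
  have hmw : ∀ k, ContDiff ℝ ∞ (moll k w') := fun k => contDiff_moll k hwi.locallyIntegrable
  have hlim : Tendsto (fun k => ∫ x, f k x) atTop (𝓝 (∫ x, f₀ x)) := by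
    refine tendsto_integral_of_tendsto_majorant (g := g) (G := g₀) (fun k => ?_) ?_ hgi hg₀i
      (fun k => ae_of_all _ fun x => ?_) (ae_of_all _ fun x => hbd _ _ x) ?_ ?_ ?_
    · exact hfm _ _ (hmw k).continuous.aestronglyMeasurable
        (contDiff_moll k hAi.locallyIntegrable).continuous.aestronglyMeasurable
    · exact hg₀i.mono' (hfm _ _ hwi.1 hAi.1) (ae_of_all _ fun x => hbd _ _ x)
    · refine (hbd _ _ x).trans ?_
      have := norm_moll_sq_le k hAi.locallyIntegrable hA2.locallyIntegrable x
      simp only [hg]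
      gcongr
    · filter_upwards [ae_tendsto_moll hwi.locallyIntegrable,
        ae_tendsto_moll hAi.locallyIntegrable] with x h1 h2
      exact tendsto_lag hG h1 h2
    · filter_upwards [ae_tendsto_moll hA2.locallyIntegrable] with x h1
      exact ((((h1.add_const _).const_mul _).const_mul _).add_const _)
    · refine tendsto_const_nhds.congr fun k => ?_
      have hgen : ∀ a : E3 → ℝ, Integrable a →
          ∫ x, (Z * (6 * M * (a x + ‖B' x‖ ^ 2)) + Z * (4 * M * ‖B' x‖)) =
          Z * (6 * M * ((∫ x, a x) + ∫ x, ‖B' x‖ ^ 2)) + ∫ x, Z * (4 * M * ‖B' x‖) := by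
        intro a ha
        have h1 : Integrable (fun x => Z * (6 * M * (a x + ‖B' x‖ ^ 2))) :=
          ((ha.add hB2).const_mul _).const_mul _
        rw [integral_add h1 ((hBi.norm.const_mul _).const_mul _), integral_const_mul,
          integral_const_mul, integral_add ha hB2]
      simp only [hg₀, hg]
      rw [hgen _ hA2, hgen _ (integrable_moll k hA2), integral_moll k hA2]
  have hzero : ∀ᶠ k in atTop, ∫ x, f k x = 0 := by
    obtain ⟨δ, hδ, hδU⟩ := hζ.hasCompactSupport.isCompact.exists_cthickening_subset_open hUo
      hζ.tsupport_subset
    have hk : ∀ᶠ k : ℕ in atTop, (1 : ℝ) / (k + 1) < δ :=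
      tendsto_one_div_add_atTop_nhds_zero_nat.eventually (gt_mem_nhds hδ)
    filter_upwards [hk] with k hk
    have hball : ∀ x ∈ tsupport ζ, Metric.closedBall x (1 / (k + 1)) ⊆ U := fun x hx =>
      ((Metric.closedBall_subset_closedBall hk.le).trans
        (Metric.closedBall_subset_cthickening hx δ)).trans hδU
    have hX : IsTest U (fun y => ζ y • G (moll k w' y)) := by
      have h1 : tsupport (fun y => ζ y • G (moll k w' y)) ⊆ tsupport ζ :=
        tsupport_smul_subset_left ζ _
      exact ⟨hζ.contDiff.smul (hG.comp (hmw k)), hζ.hasCompactSupport.smul_right,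
        h1.trans hζ.tsupport_subset⟩
    have hnull := integral_null_lagrangian hU hX hz hB hzB
    have hoff : ∀ x, x ∉ U → f k x = 0 := fun x hx => by
      simp [hf, hζ.eq_zero hx, hζ.fderiv_eq_zero hx]
    rw [← setIntegral_eq_integral_of_forall_compl_eq_zero hoff, ← hnull]
    refine setIntegral_congr_fun hUm fun x hx => ?_
    rw [lagDens_add_lagFlux (hG.differentiable (by simp))
      ((hmw k).differentiable (by simp) x) (hζ.differentiable x)]
    simp only [hf]
    by_cases hxζ : x ∈ tsupport ζ
    · simp only [lagDens, lagFlux, hw', hA', hB',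
        fderiv_moll_indicator hUm hU hw hA hwA (hball x hxζ), indicator_of_mem hx]
    · rw [image_eq_zero_of_notMem_tsupport hxζ, image_eq_zero_of_notMem_tsupport
        fun h => hxζ (tsupport_fderiv_subset ℝ h)]
      simp
  have h0 : ∫ x, f₀ x = 0 := by
    refine tendsto_nhds_unique hlim (tendsto_const_nhds.congr' ?_)
    filter_upwards [hzero] with k hk using hk.symm
  have hoff : ∀ x, x ∉ U → f₀ x = 0 := fun x hx => by
    simp [hf₀, hζ.eq_zero hx, hζ.fderiv_eq_zero hx]
  rw [← h0, ← setIntegral_eq_integral_of_forall_compl_eq_zero hoff]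
  refine setIntegral_congr_fun hUm fun x hx => ?_
  simp only [hf₀, lagDens, lagFlux, hw', hA', hB', indicator_of_mem hx]

/-! ### Reflection in a wall -/

/-- The linear reflection in the plane orthogonal to `n`. -/
def reflDir (n : E3) : E3 ≃ₗᵢ[ℝ] E3 := (ℝ ∙ n)ᗮ.reflection

/-- The reflection in the plane through `x₀` orthogonal to `n`. -/
def reflPt (n x₀ x : E3) : E3 := x₀ + reflDir n (x - x₀)

theorem reflDir_apply {n : E3} (hn : ‖n‖ = 1) (v : E3) :
    reflDir n v = v - (2 * inner ℝ n v) • n := by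
  unfold reflDir
  rw [Submodule.reflection_orthogonal_apply, Submodule.reflection_singleton_apply, hn]
  simp [mul_smul, two_smul]

theorem reflDir_reflDir (n v : E3) : reflDir n (reflDir n v) = v :=
  Submodule.reflection_reflection _ v

theorem inner_reflDir_left (n v w : E3) : inner ℝ (reflDir n v) w = inner ℝ v (reflDir n w) := by
  conv_lhs => rw [← reflDir_reflDir n w]
  exact (reflDir n).inner_map_map _ _

theorem reflPt_reflPt (n x₀ x : E3) : reflPt n x₀ (reflPt n x₀ x) = x := by
  simp [reflPt, reflDir_reflDir]

theorem contDiff_reflPt (n x₀ : E3) : ContDiff ℝ ∞ (reflPt n x₀) :=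
  contDiff_const.add ((reflDir n).contDiff.comp (contDiff_id.sub contDiff_const))

theorem hasFDerivAt_reflPt (n x₀ x : E3) :
    HasFDerivAt (reflPt n x₀) ((reflDir n : E3 ≃L[ℝ] E3) : E3 →L[ℝ] E3) x := by
  have h := ((reflDir n : E3 ≃L[ℝ] E3) : E3 →L[ℝ] E3).hasFDerivAt.comp x
    ((hasFDerivAt_id x).sub_const x₀)
  exact h.const_add x₀

theorem measurePreserving_reflPt (n x₀ : E3) :
    MeasurePreserving (reflPt n x₀) volume volume :=
  (measurePreserving_add_left volume x₀).comp
    ((reflDir n).measurePreserving.comp (measurePreserving_sub_right volume x₀))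

theorem measurableEmbedding_reflPt (n x₀ : E3) : MeasurableEmbedding (reflPt n x₀) :=
  (Homeomorph.mk ⟨reflPt n x₀, reflPt n x₀, reflPt_reflPt n x₀, reflPt_reflPt n x₀⟩
    (contDiff_reflPt n x₀).continuous (contDiff_reflPt n x₀).continuous).measurableEmbedding

theorem wallDist_reflPt {n : E3} (hn : ‖n‖ = 1) (x₀ x : E3) :
    wallDist n x₀ (reflPt n x₀ x) = - wallDist n x₀ x := by
  simp only [wallDist, reflPt, add_sub_cancel_left, reflDir_apply hn, inner_sub_right,
    real_inner_smul_right, real_inner_self_eq_norm_sq, hn]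
  ring

theorem reflPt_mem_ball {n x₀ x : E3} {r : ℝ} :
    reflPt n x₀ x ∈ Metric.ball x₀ r ↔ x ∈ Metric.ball x₀ r := by
  simp [reflPt, Metric.mem_ball, dist_eq_norm, -map_sub]

theorem norm_sub_reflPt {n : E3} (hn : ‖n‖ = 1) (x₀ x : E3) :
    ‖x - reflPt n x₀ x‖ = 2 * |wallDist n x₀ x| := by
  have : x - reflPt n x₀ x = (2 * wallDist n x₀ x) • n := by
    simp only [reflPt, reflDir_apply hn, wallDist]
    abel
  rw [this, norm_smul, hn, Real.norm_eq_abs, abs_mul]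
  simp

theorem IsTest.comp_reflPt {n x₀ : E3} {r : ℝ} {ζ : E3 → ℝ} (h : IsTest (Metric.ball x₀ r) ζ) :
    IsTest (Metric.ball x₀ r) (fun x => ζ (reflPt n x₀ x)) :=
  h.comp_isometry _ (contDiff_reflPt n x₀) (reflPt_reflPt n x₀) fun _ hx => reflPt_mem_ball.1 hx

theorem fderiv_comp_reflPt {n x₀ : E3} {ζ : E3 → ℝ} (h : Differentiable ℝ ζ) (x v : E3) :
    fderiv ℝ (fun y => ζ (reflPt n x₀ y)) x v = fderiv ℝ ζ (reflPt n x₀ x) (reflDir n v) := by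
  have h1 := (h (reflPt n x₀ x)).hasFDerivAt.comp x (hasFDerivAt_reflPt n x₀ x)
  have h2 : fderiv ℝ (fun y => ζ (reflPt n x₀ y)) x = _ := h1.fderiv
  rw [h2]; rfl

/-- Test functions that are odd across the wall are harmless. -/
theorem WeakDivOn.integral_odd {n x₀ : E3} (hn : ‖n‖ = 1) {r : ℝ} {F : E3 → E3} {β ζ : E3 → ℝ}
    (h : WeakDivOn (halfBall n x₀ r) (halfBall n x₀ r) F β)
    (hF : IntegrableOn F (halfBall n x₀ r)) (hβ : IntegrableOn β (halfBall n x₀ r))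
    (hζ : IsTest (Metric.ball x₀ r) ζ) :
    ∫ x in halfBall n x₀ r, (ζ x * β x + fderiv ℝ ζ x (F x)) =
    ∫ x in halfBall n x₀ r, (ζ (reflPt n x₀ x) * β x +
      fderiv ℝ (fun y => ζ (reflPt n x₀ y)) x (F x)) := by
  obtain ⟨Z, hZ0, -, hZ⟩ := hζ.exists_bound
  have hζ' := hζ.comp_reflPt (n := n)
  have h0 := h.integral_halfBall hF hβ (g := fun x => 2 * Z * ‖F x‖) (hF.norm.const_mul _)
    (hζ.sub hζ') ?_
  · rw [← sub_eq_zero, ← integral_sub (hζ.integrableOn_add hF hβ) (hζ'.integrableOn_add hF hβ), ← h0]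
    congr 1; ext x
    rw [fderiv_fun_sub (hζ.differentiable x) (hζ'.differentiable x)]
    simp only [sub_apply]
    ring
  · intro x hx
    have h1 : |ζ x - ζ (reflPt n x₀ x)| ≤ Z * ‖x - reflPt n x₀ x‖ :=
      convex_univ.norm_image_sub_le_of_norm_fderiv_le (fun y _ => hζ.differentiable y)
        (fun y _ => hZ y) (mem_univ _) (mem_univ _)
    rw [norm_sub_reflPt hn, abs_of_pos hx.2] at h1
    have h2 : |inner ℝ n (F x)| ≤ ‖F x‖ := by
      simpa [hn] using abs_real_inner_le_norm n (F x)
    rw [abs_mul]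
    have h3 : 0 ≤ wallDist n x₀ x := hx.2.le
    calc |ζ x - ζ (reflPt n x₀ x)| * |inner ℝ n (F x)|
        ≤ (Z * (2 * wallDist n x₀ x)) * ‖F x‖ := by gcongr
      _ = _ := by ring

/-- Extension of a vector field from a half ball by reflection with sign `s`. -/
def reflExt (n x₀ : E3) (r s : ℝ) (u : E3 → E3) (x : E3) : E3 :=
  (halfBall n x₀ r).indicator u x +
    s • reflDir n ((halfBall n x₀ r).indicator u (reflPt n x₀ x))

/-- The Jacobian of the reflected field. -/
def reflExtJac (n x₀ : E3) (r s : ℝ) (A : E3 → E3 →L[ℝ] E3) (x : E3) : E3 →L[ℝ] E3 :=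
  (halfBall n x₀ r).indicator A x +
    s • (((reflDir n : E3 ≃L[ℝ] E3) : E3 →L[ℝ] E3) ∘L
      (halfBall n x₀ r).indicator A (reflPt n x₀ x)) ∘L
        ((reflDir n : E3 ≃L[ℝ] E3) : E3 →L[ℝ] E3)

theorem memL2_reflExt {n x₀ : E3} {r s : ℝ} {u : E3 → E3} (V : Set E3)
    (hu : MemL2 (halfBall n x₀ r) u) : MemL2 V (reflExt n x₀ r s u) := by
  have h1 : MemLp ((halfBall n x₀ r).indicator u) 2 volume :=
    (memLp_indicator_iff_restrict (isOpen_halfBall n x₀ r).measurableSet).2 hu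
  have h2 := h1.comp_measurePreserving (measurePreserving_reflPt n x₀)
  have h3 := ((reflDir n : E3 ≃L[ℝ] E3) : E3 →L[ℝ] E3).comp_memLp' h2
  exact (h1.add (h3.const_smul s)).restrict V

theorem MemLp.fun_add_smul {F : Type*} [NormedAddCommGroup F] [NormedSpace ℝ F] {μ : Measure E3}
    {f g : E3 → F} (hf : MemLp f 2 μ) (hg : MemLp g 2 μ) (s : ℝ) :
    MemLp (fun x => f x + s • g x) 2 μ := hf.add (hg.const_smul s)

theorem memL2_reflExtJac {n x₀ : E3} {r s : ℝ} {A : E3 → E3 →L[ℝ] E3} (V : Set E3)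
    (hA : MemL2 (halfBall n x₀ r) A) : MemL2 V (reflExtJac n x₀ r s A) := by
  have h1 : MemLp ((halfBall n x₀ r).indicator A) 2 volume :=
    (memLp_indicator_iff_restrict (isOpen_halfBall n x₀ r).measurableSet).2 hA
  have h2 := h1.comp_measurePreserving (measurePreserving_reflPt n x₀)
  set R : E3 →L[ℝ] E3 := ((reflDir n : E3 ≃L[ℝ] E3) : E3 →L[ℝ] E3)
  have hm := aestronglyMeasurable_clm_comp (aestronglyMeasurable_clm_comp
    (aestronglyMeasurable_const (b := R)) h2.1) (aestronglyMeasurable_const (b := R))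
  have h3 : MemLp (fun x => (R ∘L (halfBall n x₀ r).indicator A (reflPt n x₀ x)) ∘L R) 2
      volume := by
    refine MemLp.of_le_mul (c := 1) h2 hm (ae_of_all _ fun x => ?_)
    rw [one_mul]
    refine ContinuousLinearMap.opNorm_le_bound _ (norm_nonneg _) fun v => ?_
    have hR : ∀ w, ‖R w‖ = ‖w‖ := (reflDir n).norm_map
    rw [ContinuousLinearMap.comp_apply, ContinuousLinearMap.comp_apply, hR]
    refine (ContinuousLinearMap.le_opNorm _ _).trans (le_of_eq ?_)
    rw [hR, Function.comp_apply]
  have h5 : MemLp (reflExtJac n x₀ r s A) 2 volume := MemLp.fun_add_smul h1 h3 s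
  exact h5.restrict V

theorem reflPt_notMem_halfBall {n x₀ x : E3} (hn : ‖n‖ = 1) {r : ℝ} (hx : x ∈ halfBall n x₀ r) :
    reflPt n x₀ x ∉ halfBall n x₀ r := fun h => by
  have h1 := h.2
  rw [wallDist_reflPt hn] at h1
  linarith [hx.2]

theorem volume_halfBall_ne_top (n x₀ : E3) (r : ℝ) : volume (halfBall n x₀ r) ≠ ⊤ :=
  ((measure_mono fun _ hx => hx.1).trans_lt (Metric.isBounded_ball (x := x₀) (r := r)).measure_lt_top).ne

/-- Near a wall, only the normal derivatives contribute. -/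
theorem WeakJacOn.integral_halfBall_eq {n x₀ : E3} (hn : ‖n‖ = 1) {r : ℝ} {u : E3 → E3}
    {A : E3 → E3 →L[ℝ] E3} (hu : MemL2 (halfBall n x₀ r) u) (hA : MemL2 (halfBall n x₀ r) A)
    (huA : WeakJacOn (halfBall n x₀ r) (halfBall n x₀ r) u A) {φ : E3 → ℝ}
    (hφ : IsTest (Metric.ball x₀ r) φ) (e c : E3) :
    ∫ x in halfBall n x₀ r, (φ x * inner ℝ (A x e) c + fderiv ℝ φ x ((inner ℝ (u x) c : ℝ) • e)) =
    inner ℝ n e * ∫ x in halfBall n x₀ r,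
      (φ x * inner ℝ (A x n) c + fderiv ℝ φ x ((inner ℝ (u x) c : ℝ) • n)) := by
  have hVf := volume_halfBall_ne_top n x₀ r
  have hui : ∀ c e : E3, IntegrableOn (fun x => (inner ℝ (u x) c : ℝ) • e) (halfBall n x₀ r) :=
    fun c e => ((hu.integrableOn hVf).inner_const c).smul_const e
  have hAi : ∀ c e : E3, IntegrableOn (fun x => (inner ℝ (A x e) c : ℝ)) (halfBall n x₀ r) :=
    fun c e => ((memLp_clm_apply hA e).integrableOn hVf).inner_const c
  have h0 := (huA c (e - (inner ℝ n e : ℝ) • n)).integral_halfBall (hui _ _) (hAi _ _)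
    (g := fun _ => 0) integrableOn_zero hφ fun x _ => by
      rw [real_inner_smul_right, inner_sub_right, real_inner_smul_right,
        real_inner_self_eq_norm_sq, hn]
      simp
  rw [← integral_const_mul, ← sub_eq_zero, ← integral_sub (hφ.integrableOn_add (hui c e) (hAi c e))
    ((hφ.integrableOn_add (hui c n) (hAi c n)).const_mul _), ← h0]
  congr 1; ext x
  simp only [map_sub, map_smul, inner_sub_left, real_inner_smul_left, smul_eq_mul]
  ring

/-- If the suitable components of `u` vanish on the wall, then the reflected field has a weak
Jacobian on the full ball. -/
theorem weakJacOn_reflExt {n x₀ : E3} (hn : ‖n‖ = 1) {r s : ℝ} {u : E3 → E3}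
    {A : E3 → E3 →L[ℝ] E3} (hu : MemL2 (halfBall n x₀ r) u) (hA : MemL2 (halfBall n x₀ r) A)
    (huA : WeakJacOn (halfBall n x₀ r) (halfBall n x₀ r) u A)
    (hwall : ∀ c : E3, WeakDivOn (halfBall n x₀ r) (Metric.ball x₀ r)
      (fun x => (inner ℝ (u x) (c - s • reflDir n c) : ℝ) • n)
      (fun x => inner ℝ (A x n) (c - s • reflDir n c))) :
    WeakJacOn (Metric.ball x₀ r) (Metric.ball x₀ r) (reflExt n x₀ r s u)
      (reflExtJac n x₀ r s A) := by
  intro c e ζ hζ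
  set V := halfBall n x₀ r with hV
  have hVm : MeasurableSet V := (isOpen_halfBall n x₀ r).measurableSet
  have hVf := volume_halfBall_ne_top n x₀ r
  set ζ' : E3 → ℝ := fun x => ζ (reflPt n x₀ x) with hζ'
  have hζ't : IsTest (Metric.ball x₀ r) ζ' := hζ.comp_reflPt
  set J : (E3 → ℝ) → E3 → E3 → E3 → ℝ := fun φ e c x =>
    φ x * inner ℝ (A x e) c + fderiv ℝ φ x ((inner ℝ (u x) c : ℝ) • e) with hJ
  have hui : ∀ c e : E3, IntegrableOn (fun x => (inner ℝ (u x) c : ℝ) • e) V := fun c e =>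
    ((hu.integrableOn hVf).inner_const c).smul_const e
  have hAi : ∀ c e : E3, IntegrableOn (fun x => (inner ℝ (A x e) c : ℝ)) V := fun c e =>
    ((memLp_clm_apply hA e).integrableOn hVf).inner_const c
  have hJi : ∀ φ, IsTest (Metric.ball x₀ r) φ → ∀ e c, IntegrableOn (J φ e c) V :=
    fun φ hφ e c => hφ.integrableOn_add (hui c e) (hAi c e)
  have htan : ∀ φ, IsTest (Metric.ball x₀ r) φ → ∀ e c : E3,
      ∫ x in V, J φ e c x = inner ℝ n e * ∫ x in V, J φ n c x := by
    intro φ hφ e c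
    exact huA.integral_halfBall_eq hn hu hA hφ e c
  have hodd : ∫ x in V, J ζ n c x = ∫ x in V, J ζ' n c x :=
    WeakDivOn.integral_odd hn (huA c n) (hui c n) (hAi c n) hζ
  have hw : ∫ x in V, J ζ' n c x = s * ∫ x in V, J ζ' n (reflDir n c) x := by
    rw [← integral_const_mul, ← sub_eq_zero, ← integral_sub (hJi ζ' hζ't n c)
      ((hJi ζ' hζ't n _).const_mul _), ← hwall c ζ' hζ't]
    congr 1; ext x
    simp only [hJ, inner_sub_right, real_inner_smul_right, map_smul, smul_eq_mul]
    ring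
  have hsum : (∫ x in V, J ζ e c x) + s * ∫ x in V, J ζ' (reflDir n e) (reflDir n c) x = 0 := by
    rw [htan ζ hζ e c, htan ζ' hζ't (reflDir n e), hodd, hw, reflDir_apply hn e, inner_sub_right,
      real_inner_smul_right, real_inner_self_eq_norm_sq, hn]
    ring
  rw [← hsum]
  set P : E3 → ℝ := V.indicator (J ζ e c) with hP
  set Q : E3 → ℝ := V.indicator (J ζ' (reflDir n e) (reflDir n c)) with hQ
  have hPi : Integrable P := (integrable_indicator_iff hVm).2 (hJi ζ hζ e c)
  have hQi : Integrable Q := (integrable_indicator_iff hVm).2 (hJi ζ' hζ't _ _)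
  have hQR : Integrable (fun x => Q (reflPt n x₀ x)) :=
    (measurePreserving_reflPt n x₀).integrable_comp_of_integrable hQi
  have e1 : ∫ x in V, J ζ e c x = ∫ x, P x := (integral_indicator hVm).symm
  have e2 : ∫ x in V, J ζ' (reflDir n e) (reflDir n c) x = ∫ x, Q (reflPt n x₀ x) := by
    rw [(measurePreserving_reflPt n x₀).integral_comp (measurableEmbedding_reflPt n x₀) Q]
    exact (integral_indicator hVm).symm
  rw [e1, e2, ← integral_const_mul, ← integral_add hPi (hQR.const_mul s)]
  rw [setIntegral_eq_integral_of_forall_compl_eq_zero fun x hx => by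
    simp [hζ.eq_zero hx, hζ.fderiv_eq_zero hx]]
  congr 1; ext x
  have hQx : Q (reflPt n x₀ x) = ζ x * inner ℝ (V.indicator A (reflPt n x₀ x) (reflDir n e))
      (reflDir n c) + fderiv ℝ ζ x e * inner ℝ (V.indicator u (reflPt n x₀ x)) (reflDir n c) := by
    by_cases hx : reflPt n x₀ x ∈ V
    · simp only [hQ, indicator_of_mem hx, hJ, hζ', reflPt_reflPt,
        fderiv_comp_reflPt hζ.differentiable, map_smul, reflDir_reflDir, smul_eq_mul]
      ring
    · simp [hQ, indicator_of_notMem hx]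
  have hPx : P x = ζ x * inner ℝ (V.indicator A x e) c +
      fderiv ℝ ζ x e * inner ℝ (V.indicator u x) c := by
    by_cases hx : x ∈ V
    · simp only [hP, indicator_of_mem hx, hJ, map_smul, smul_eq_mul]
      ring
    · simp [hP, indicator_of_notMem hx]
  rw [hQx, hPx, ← inner_reflDir_left, ← inner_reflDir_left]
  simp only [reflExt, reflExtJac, ← hV, inner_add_left, real_inner_smul_left, add_apply, smul_apply,
    ContinuousLinearMap.comp_apply, map_smul, smul_eq_mul, ContinuousLinearEquiv.coe_coe,
    LinearIsometryEquiv.coe_toContinuousLinearEquiv]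
  ring

/-- The null Lagrangian has vanishing flux through a wall on which the fields satisfy matching
homogeneous conditions. -/
theorem weakDivOn_lagFlux_halfBall {n x₀ : E3} (hn : ‖n‖ = 1) {r s : ℝ} (hs : s * s = 1)
    {G u v : E3 → E3} {A B : E3 → E3 →L[ℝ] E3} {M : ℝ} (hG : ContDiff ℝ ∞ G)
    (hGM : ∀ y, ‖G y‖ ≤ M) (hGM' : ∀ y, ‖fderiv ℝ G y‖ ≤ M)
    (hGs : ∀ y, G (s • reflDir n y) = s • reflDir n (G y))
    (hu : MemL2 (halfBall n x₀ r) u) (hA : MemL2 (halfBall n x₀ r) A)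
    (hv : MemL2 (halfBall n x₀ r) v) (hB : MemL2 (halfBall n x₀ r) B)
    (huA : WeakJacOn (halfBall n x₀ r) (halfBall n x₀ r) u A)
    (hvB : WeakJacOn (halfBall n x₀ r) (halfBall n x₀ r) v B)
    (hwallu : ∀ c : E3, WeakDivOn (halfBall n x₀ r) (Metric.ball x₀ r)
      (fun x => (inner ℝ (u x) (c - s • reflDir n c) : ℝ) • n)
      (fun x => inner ℝ (A x n) (c - s • reflDir n c)))
    (hwallv : ∀ c : E3, WeakDivOn (halfBall n x₀ r) (Metric.ball x₀ r)
      (fun x => (inner ℝ (v x) (c - s • reflDir n c) : ℝ) • n)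
      (fun x => inner ℝ (B x n) (c - s • reflDir n c))) :
    WeakDivOn (halfBall n x₀ r) (Metric.ball x₀ r) (lagFlux G u B) (lagDens G u A B) := by
  intro ζ hζ
  have hζ' := hζ.comp_reflPt (n := n)
  have hUf : volume (Metric.ball x₀ r) ≠ ⊤ := Metric.isBounded_ball.measure_lt_top.ne
  have hext := weakDivOn_lagFlux Metric.isOpen_ball hUf hG hGM hGM'
    (memL2_reflExt (s := s) _ hu) (memL2_reflExtJac (s := s) _ hA) (memL2_reflExt (s := s) _ hv)
    (memL2_reflExtJac (s := s) _ hB) (weakJacOn_reflExt hn hu hA huA hwallu)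
    (weakJacOn_reflExt hn hv hB hvB hwallv) ζ hζ
  have hint := weakDivOn_lagFlux (isOpen_halfBall n x₀ r) (volume_halfBall_ne_top n x₀ r) hG hGM
    hGM' hu hA hv hB huA hvB
  have hFi : IntegrableOn (lagFlux G u B) (halfBall n x₀ r) :=
    (memL2_lagFlux hG.continuous hGM hu hB).integrableOn (volume_halfBall_ne_top n x₀ r)
  have hβi : IntegrableOn (lagDens G u A B) (halfBall n x₀ r) :=
    integrableOn_lagDens hG hGM' hu hA hB
  have hodd := hint.integral_odd hn hFi hβi hζ
  set V := halfBall n x₀ r with hV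
  have hVm : MeasurableSet V := (isOpen_halfBall n x₀ r).measurableSet
  set R : E3 →L[ℝ] E3 := ((reflDir n : E3 ≃L[ℝ] E3) : E3 →L[ℝ] E3) with hR
  have hRR : ∀ y, R (R y) = y := reflDir_reflDir n
  have hRv : ∀ y, reflDir n y = R y := fun _ => rfl
  have hfd : ∀ w z, fderiv ℝ G (s • R w) (s • R z) = s • R (fderiv ℝ G w z) := by
    intro w z
    have hGd : Differentiable ℝ G := hG.differentiable (by simp)
    have h1 : HasFDerivAt (fun y => G ((s • R) y)) (fderiv ℝ G (s • R w) ∘L (s • R)) w :=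
      (hGd ((s • R) w)).hasFDerivAt.comp w (s • R).hasFDerivAt
    have h2 : HasFDerivAt (fun y => (s • R) (G y)) ((s • R) ∘L fderiv ℝ G w) w :=
      (s • R).hasFDerivAt.comp w (hGd w).hasFDerivAt
    have h3 : (fun y => G ((s • R) y)) = fun y => (s • R) (G y) := funext fun y => hGs y
    rw [h3] at h1
    exact congrArg (fun L : E3 →L[ℝ] E3 => L z) (h1.unique h2)
  have hconj : ∀ K : E3 →L[ℝ] E3, tr ((R ∘L K) ∘L R) = tr K := by
    intro K
    rw [tr_comp_comm]
    congr 1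
    ext1 z
    simp [hRR]
  have hu1 : ∀ x ∈ V, reflExt n x₀ r s u x = u x := fun x hx => by
    have : reflPt n x₀ x ∉ V := reflPt_notMem_halfBall hn hx
    simp [reflExt, ← hV, hx, indicator_of_notMem this]
  have hJ1 : ∀ (A : E3 → E3 →L[ℝ] E3), ∀ x ∈ V, reflExtJac n x₀ r s A x = A x := fun A x hx => by
    have : reflPt n x₀ x ∉ V := reflPt_notMem_halfBall hn hx
    simp [reflExtJac, ← hV, hx, indicator_of_notMem this]
  have hu2 : ∀ x ∈ V, reflExt n x₀ r s u (reflPt n x₀ x) = s • R (u x) := fun x hx => by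
    have : reflPt n x₀ x ∉ V := reflPt_notMem_halfBall hn hx
    simp [reflExt, ← hV, hx, indicator_of_notMem this, reflPt_reflPt, hRv]
  have hJ2 : ∀ (A : E3 → E3 →L[ℝ] E3), ∀ x ∈ V,
      reflExtJac n x₀ r s A (reflPt n x₀ x) = s • (R ∘L A x) ∘L R := fun A x hx => by
    have : reflPt n x₀ x ∉ V := reflPt_notMem_halfBall hn hx
    simp [reflExtJac, ← hV, hx, indicator_of_notMem this, reflPt_reflPt, hR]
  have hJ0 : ∀ (A : E3 → E3 →L[ℝ] E3), ∀ x ∉ V, reflPt n x₀ x ∉ V →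
      reflExtJac n x₀ r s A x = 0 := fun A x hx hx' => by
    simp [reflExtJac, ← hV, indicator_of_notMem hx, indicator_of_notMem hx']
  have hA1 := hJ1 A
  have hB1 := hJ1 B
  have hA2 := hJ2 A
  have hB2 := hJ2 B
  have hA0 := hJ0 A
  have hB0 := hJ0 B
  set u' := reflExt n x₀ r s u
  set A' := reflExtJac n x₀ r s A
  set B' := reflExtJac n x₀ r s B
  have hdens : ∀ x ∈ V, lagDens G u' A' B' (reflPt n x₀ x) = lagDens G u A B x := by
    intro x hx
    have hD : fderiv ℝ G (s • R (u x)) ∘L (s • (R ∘L A x) ∘L R) =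
        s • (R ∘L (fderiv ℝ G (u x) ∘L A x)) ∘L R := by
      ext1 z
      simp only [ContinuousLinearMap.comp_apply, smul_apply]
      exact hfd _ _
    have hDB : (s • (R ∘L (fderiv ℝ G (u x) ∘L A x)) ∘L R) ∘L (s • (R ∘L B x) ∘L R) =
        (R ∘L ((fderiv ℝ G (u x) ∘L A x) ∘L B x)) ∘L R := by
      ext1 z
      simp only [ContinuousLinearMap.comp_apply, smul_apply, map_smul, hRR, smul_smul, hs, one_smul]
    simp only [lagDens]
    rw [hu2 x hx, hA2 x hx, hB2 x hx, hD, hDB, tr_smul, tr_smul, hconj, hconj, hconj]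
    linear_combination (-(tr (fderiv ℝ G (u x) ∘L A x) * tr (B x))) * hs
  have hflux : ∀ x ∈ V, lagFlux G u' B' (reflPt n x₀ x) = R (lagFlux G u B x) := by
    intro x hx
    simp only [lagFlux]
    rw [hu2 x hx, hB2 x hx, ← hRv, hGs, tr_smul, hconj]
    simp only [ContinuousLinearMap.comp_apply, smul_apply, map_smul, hRv, hRR, smul_smul, map_sub]
    rw [hs, one_smul, mul_right_comm, hs, one_mul]
  set P : E3 → ℝ := V.indicator
    (fun x => ζ x * lagDens G u A B x + fderiv ℝ ζ x (lagFlux G u B x)) with hP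
  set Q : E3 → ℝ := V.indicator (fun x => ζ (reflPt n x₀ x) * lagDens G u A B x +
    fderiv ℝ (fun y => ζ (reflPt n x₀ y)) x (lagFlux G u B x)) with hQ
  have hPi : Integrable P := (integrable_indicator_iff hVm).2 (hζ.integrableOn_add hFi hβi)
  have hQi : Integrable Q := (integrable_indicator_iff hVm).2 (hζ'.integrableOn_add hFi hβi)
  have hQR : Integrable (fun x => Q (reflPt n x₀ x)) :=
    (measurePreserving_reflPt n x₀).integrable_comp_of_integrable hQi
  have hΦ : ∀ x, ζ x * lagDens G u' A' B' x + fderiv ℝ ζ x (lagFlux G u' B' x) =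
      P x + Q (reflPt n x₀ x) := by
    intro x
    by_cases hx : x ∈ V
    · have hx' : reflPt n x₀ x ∉ V := reflPt_notMem_halfBall hn hx
      simp only [hP, hQ, indicator_of_mem hx, indicator_of_notMem hx', add_zero, lagDens, lagFlux,
        hu1 x hx, hA1 x hx, hB1 x hx]
    by_cases hx' : reflPt n x₀ x ∈ V
    · have h1 := hdens _ hx'
      have h2 := hflux _ hx'
      rw [reflPt_reflPt] at h1 h2
      simp only [hP, hQ, indicator_of_mem hx', indicator_of_notMem hx, zero_add, h1, h2,
        reflPt_reflPt, fderiv_comp_reflPt hζ.differentiable, hRv]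
    · have h3 := hA0 x hx hx'
      have h4 := hB0 x hx hx'
      simp only [hP, hQ, indicator_of_notMem hx', indicator_of_notMem hx, lagDens, lagFlux,
        h3, h4]
      simp [tr]
  rw [setIntegral_eq_integral_of_forall_compl_eq_zero fun x hx => by
    simp [hζ.eq_zero hx, hζ.fderiv_eq_zero hx]] at hext
  simp_rw [hΦ] at hext
  rw [integral_add hPi hQR,
    (measurePreserving_reflPt n x₀).integral_comp (measurableEmbedding_reflPt n x₀) Q, hP, hQ,
    integral_indicator hVm, integral_indicator hVm, ← hodd] at hext
  linarith

/-! ### A smooth truncation -/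

/-- A smooth bounded radial truncation of the identity. -/
def trunc (δ : ℝ) (y : E3) : E3 := (1 + δ * ‖y‖ ^ 2)⁻¹ • y

theorem trunc_den_pos {δ : ℝ} (hδ : 0 < δ) (y : E3) : 0 < 1 + δ * ‖y‖ ^ 2 := by positivity

theorem contDiff_trunc {δ : ℝ} (hδ : 0 < δ) : ContDiff ℝ ∞ (trunc δ) :=
  ((contDiff_const.add (contDiff_const.mul (contDiff_norm_sq ℝ))).inv
    fun y => (trunc_den_pos hδ y).ne').smul contDiff_id

theorem fderiv_trunc {δ : ℝ} (hδ : 0 < δ) (y : E3) :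
    fderiv ℝ (trunc δ) y = (1 + δ * ‖y‖ ^ 2)⁻¹ • ContinuousLinearMap.id ℝ E3 -
      (2 * δ * ((1 + δ * ‖y‖ ^ 2)⁻¹) ^ 2) • (innerSL ℝ y).smulRight y := by
  have h1 : HasFDerivAt (fun y : E3 => ‖y‖ ^ 2) (2 • innerSL ℝ y) y :=
    (hasStrictFDerivAt_norm_sq y).hasFDerivAt
  have h2 := ((h1.const_mul δ).const_add 1)
  have h3 := (hasDerivAt_inv (trunc_den_pos hδ y).ne').comp_hasFDerivAt y h2
  have h4 := h3.smul (hasFDerivAt_id y)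
  have h5 : fderiv ℝ (trunc δ) y = _ := h4.fderiv
  rw [h5]
  ext1 z
  simp only [add_apply, smul_apply, sub_apply, ContinuousLinearMap.smulRight_apply,
    ContinuousLinearMap.id_apply, innerSL_apply_apply, Function.comp_apply, smul_smul,
    id_eq, nsmul_eq_mul, smul_eq_mul]
  rw [sub_eq_add_neg, ← neg_smul]
  congr 2
  push_cast
  field_simp

theorem norm_trunc_le {δ : ℝ} (hδ : 0 < δ) (y : E3) : ‖trunc δ y‖ ≤ 3 + 1 / δ := by
  have hd := trunc_den_pos hδ y
  rw [trunc, norm_smul, norm_inv, Real.norm_eq_abs, abs_of_pos hd, inv_mul_le_iff₀ hd]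
  have : (1 + δ * ‖y‖ ^ 2) * (3 + 1 / δ) = 3 + 3 * δ * ‖y‖ ^ 2 + 1 / δ + ‖y‖ ^ 2 := by
    field_simp; ring
  rw [this]
  have h1 : 0 < 1 / δ := by positivity
  have h2 : 0 ≤ 3 * δ * ‖y‖ ^ 2 := by positivity
  nlinarith [sq_nonneg (‖y‖ - 1)]

theorem norm_fderiv_trunc_le {δ : ℝ} (hδ : 0 < δ) (y : E3) : ‖fderiv ℝ (trunc δ) y‖ ≤ 3 := by
  have hd := trunc_den_pos hδ y
  have hδy : 0 ≤ δ * ‖y‖ ^ 2 := by positivity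
  set c := (1 + δ * ‖y‖ ^ 2)⁻¹ with hc
  have hc0 : 0 < c := inv_pos.2 hd
  have hc1 : c ≤ 1 := inv_le_one_of_one_le₀ (by linarith)
  have hcd : c * (δ * ‖y‖ ^ 2) ≤ 1 := by
    rw [hc, inv_mul_le_iff₀ hd]; linarith
  rw [fderiv_trunc hδ]
  refine (norm_sub_le _ _).trans ?_
  rw [norm_smul, norm_smul, ContinuousLinearMap.norm_smulRight_apply, innerSL_apply_norm,
    Real.norm_eq_abs, Real.norm_eq_abs, abs_of_pos hc0, abs_of_nonneg (by positivity)]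
  have h1 : c * ‖ContinuousLinearMap.id ℝ E3‖ ≤ 1 :=
    mul_le_one₀ hc1 (norm_nonneg _) ContinuousLinearMap.norm_id_le
  have h2 : 2 * δ * c ^ 2 * (‖y‖ * ‖y‖) = 2 * (c * (c * (δ * ‖y‖ ^ 2))) := by ring
  have h3 : c * (c * (δ * ‖y‖ ^ 2)) ≤ 1 := mul_le_one₀ hc1 (by positivity) hcd
  rw [h2]; linarith

theorem trunc_reflDir {δ s : ℝ} (hs : s * s = 1) (n y : E3) :
    trunc δ (s • reflDir n y) = s • reflDir n (trunc δ y) := by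
  have : ‖s • reflDir n y‖ ^ 2 = ‖y‖ ^ 2 := by
    rw [norm_smul, mul_pow, Real.norm_eq_abs, sq_abs, (reflDir n).norm_map, sq, hs, one_mul]
  simp only [trunc, this, map_smul]
  rw [smul_comm]

theorem tendsto_fderiv_trunc (y : E3) :
    Tendsto (fun k : ℕ => fderiv ℝ (trunc (1 / ((k : ℝ) + 1))) y) atTop
      (𝓝 (ContinuousLinearMap.id ℝ E3)) := by
  have h0 : ∀ k : ℕ, (0 : ℝ) < 1 / ((k : ℝ) + 1) := fun k => by positivity
  simp_rw [fun k => fderiv_trunc (h0 k) y]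
  have hδ : Tendsto (fun k : ℕ => 1 / ((k : ℝ) + 1)) atTop (𝓝 0) :=
    tendsto_one_div_add_atTop_nhds_zero_nat
  have hc : Tendsto (fun k : ℕ => (1 + 1 / ((k : ℝ) + 1) * ‖y‖ ^ 2)⁻¹) atTop (𝓝 1) := by
    have := ((hδ.mul_const (‖y‖ ^ 2)).const_add 1).inv₀ (by simp)
    simpa using this
  have h1 := (hc.smul_const (ContinuousLinearMap.id ℝ E3)).sub
    (((hδ.const_mul 2).mul (hc.pow 2)).smul_const ((innerSL ℝ y).smulRight y))
  simpa using h1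

/-! ### The shape of the domain near a wall -/

theorem IsPreconnected.subset_or_disjoint_of_frontier {α : Type*} [TopologicalSpace α]
    {s Ω : Set α} (hs : IsPreconnected s) (hΩ : IsOpen Ω) (h : Disjoint s (frontier Ω)) :
    s ⊆ Ω ∨ Disjoint s Ω := by
  have hsub : s ⊆ Ω ∪ (closure Ω)ᶜ := by
    intro x hx
    by_cases hxΩ : x ∈ Ω
    · exact Or.inl hxΩ
    · refine Or.inr fun hc => disjoint_left.1 h hx ?_
      rw [hΩ.frontier_eq]
      exact ⟨hc, hxΩ⟩
  have hdisj : Disjoint Ω (closure Ω)ᶜ := disjoint_compl_right_iff_subset.2 subset_closure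
  rcases hs.subset_or_subset hΩ isClosed_closure.isOpen_compl hdisj hsub with h1 | h1
  · exact Or.inl h1
  · exact Or.inr (hdisj.symm.mono_left h1)

theorem IsOpen.exists_add_smul_mem {W : Set E3} (hW : IsOpen W) {y : E3} (hy : y ∈ W) (m : E3) :
    ∃ ε : ℝ, 0 < ε ∧ y + ε • m ∈ W := by
  have hc : ContinuousAt (fun ε : ℝ => y + ε • m) 0 := by fun_prop
  have h1 : ∀ᶠ ε : ℝ in 𝓝 0, y + ε • m ∈ W := hc.eventually_mem (hW.mem_nhds (by simpa using hy))
  have h2 : ∀ᶠ ε : ℝ in 𝓝[>] 0, y + ε • m ∈ W := h1.filter_mono nhdsWithin_le_nhds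
  obtain ⟨ε, h3, h4⟩ := (h2.and self_mem_nhdsWithin).exists
  exact ⟨ε, h4, h3⟩

theorem HasLipschitzBoundary.exists_isOpen_disjoint {Ω : Set E3} (hL : HasLipschitzBoundary Ω)
    (hΩ : IsOpen Ω) {x : E3} (hx : x ∈ frontier Ω) {N : Set E3} (hN : N ∈ 𝓝 x) :
    ∃ W, IsOpen W ∧ W.Nonempty ∧ W ⊆ N ∧ Disjoint W Ω := by
  obtain ⟨A, K, γ, hγ, hev⟩ := hL x hx
  have hxΩ : x ∉ Ω := by
    rw [hΩ.frontier_eq] at hx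
    exact hx.2
  set f : E3 → ℝ := fun y => γ !₂[A y 0, A y 1] - A y 2 with hf
  have hfc : Continuous f := by
    have h1 : Continuous (fun y : E3 => (!₂[A y 0, A y 1] : EuclideanSpace ℝ (Fin 2))) := by
      refine (PiLp.continuous_toLp 2 _).comp (continuous_pi fun i => ?_)
      fin_cases i <;> simp <;> fun_prop
    exact (hγ.continuous.comp h1).sub (by fun_prop)
  obtain ⟨O, hOsub, hOo, hxO⟩ := mem_nhds_iff.1 (inter_mem hN hev)
  have hfx : 0 ≤ f x := by
    have := (hOsub hxO).2
    by_contra hlt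
    exact hxΩ (this.2 (by simp only [hf] at hlt; linarith))
  refine ⟨O ∩ {y | 0 < f y}, hOo.inter (isOpen_lt continuous_const hfc), ?_,
    fun y hy => (hOsub hy.1).1, ?_⟩
  · obtain ⟨ε, hε, hmem⟩ := hOo.exists_add_smul_mem hxO (A.symm (EuclideanSpace.single 2 (-1)))
    refine ⟨_, hmem, ?_⟩
    have : f (x + ε • A.symm (EuclideanSpace.single 2 (-1))) = f x + ε := by
      simp [hf]; ring
    rw [mem_ofPred_eq, this]
    linarith
  · rw [disjoint_left]
    rintro y ⟨hyO, hy⟩ hyΩ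
    have h1 := (hOsub hyO).2.1 hyΩ
    have h2 : 0 < f y := hy
    simp only [hf] at h2
    linarith

theorem wallDist_neg (n x₀ x : E3) : wallDist (-n) x₀ x = - wallDist n x₀ x := by
  simp [wallDist]

theorem wallDist_add_smul {n : E3} (hn : ‖n‖ = 1) (x₀ x : E3) (ε : ℝ) :
    wallDist n x₀ (x + ε • n) = wallDist n x₀ x + ε := by
  have : x + ε • n - x₀ = (x - x₀) + ε • n := by abel
  simp only [wallDist, this, inner_add_right, real_inner_smul_right, real_inner_self_eq_norm_sq, hn]
  ring

theorem isPreconnected_halfBall (n x₀ : E3) (r : ℝ) : IsPreconnected (halfBall n x₀ r) := by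
  refine ((convex_ball x₀ r).inter ?_).isPreconnected
  have : {x | 0 < wallDist n x₀ x} = {x | inner ℝ n x₀ < innerSL ℝ n x} := by
    ext x; simp [wallDist, inner_sub_right]
  show Convex ℝ {x | 0 < wallDist n x₀ x}
  rw [this]
  exact convex_halfSpace_gt (innerSL ℝ n).toLinearMap.isLinear _

theorem inter_ball_eq_halfBall {Ω : Set E3} (hΩ : IsOpen Ω) {n x₀ : E3} (hn : ‖n‖ = 1) {r : ℝ}
    (h1 : halfBall n x₀ r ⊆ Ω) (h2 : Disjoint (halfBall (-n) x₀ r) Ω) :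
    Ω ∩ Metric.ball x₀ r = halfBall n x₀ r := by
  refine Subset.antisymm (fun y hy => ⟨hy.2, ?_⟩) fun y hy => ⟨h1 hy, hy.1⟩
  by_contra hle
  obtain ⟨ε, hε, hmem⟩ := (hΩ.inter Metric.isOpen_ball).exists_add_smul_mem hy (-n)
  refine disjoint_left.1 h2 ⟨hmem.2, ?_⟩ hmem.1
  rw [wallDist_add_smul (by rwa [norm_neg]), wallDist_neg]
  linarith [not_lt.1 hle]

theorem exists_inter_ball_eq_halfBall {Ω : Set E3} (hΩ : IsOpen Ω) (hL : HasLipschitzBoundary Ω)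
    {x₀ : E3} (hx₀ : x₀ ∈ frontier Ω) {p : E3} (hp : p ≠ 0) {r : ℝ} (hr : 0 < r)
    (hloc : ∀ y ∈ Metric.ball x₀ r, y ∈ frontier Ω → inner ℝ p y = inner ℝ p x₀) :
    ∃ n, ‖n‖ = 1 ∧ Ω ∩ Metric.ball x₀ r = halfBall n x₀ r := by
  set m := ‖p‖⁻¹ • p with hm
  have hmn : ‖m‖ = 1 := norm_smul_inv_norm hp
  have hmn' : ‖-m‖ = 1 := by rwa [norm_neg]
  have hwall : ∀ y ∈ Metric.ball x₀ r, y ∈ frontier Ω → wallDist m x₀ y = 0 := by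
    intro y hy hyf
    simp [wallDist, hm, real_inner_smul_left, inner_sub_right, hloc y hy hyf]
  have hd1 : Disjoint (halfBall m x₀ r) (frontier Ω) := disjoint_left.2 fun y hy hyf =>
    hy.2.ne' (hwall y hy.1 hyf)
  have hd2 : Disjoint (halfBall (-m) x₀ r) (frontier Ω) := disjoint_left.2 fun y hy hyf =>
    hy.2.ne' (by rw [wallDist_neg, hwall y hy.1 hyf, neg_zero])
  have hflat : ∀ W : Set E3, IsOpen W → W.Nonempty → W ⊆ Metric.ball x₀ r →
      ∃ y ∈ W, y ∈ halfBall m x₀ r ∨ y ∈ halfBall (-m) x₀ r := by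
    rintro W hW ⟨y, hy⟩ hWb
    rcases lt_trichotomy (wallDist m x₀ y) 0 with h | h | h
    · exact ⟨y, hy, Or.inr ⟨hWb hy, by rw [wallDist_neg]; linarith⟩⟩
    · obtain ⟨ε, hε, hmem⟩ := hW.exists_add_smul_mem hy m
      exact ⟨_, hmem, Or.inl ⟨hWb hmem, by rw [wallDist_add_smul hmn, h]; linarith⟩⟩
    · exact ⟨y, hy, Or.inl ⟨hWb hy, h⟩⟩
  rcases (isPreconnected_halfBall m x₀ r).subset_or_disjoint_of_frontier hΩ hd1 with h1 | h1 <;>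
  rcases (isPreconnected_halfBall (-m) x₀ r).subset_or_disjoint_of_frontier hΩ hd2 with h2 | h2
  · exfalso
    obtain ⟨W, hWo, hWn, hWb, hWd⟩ := hL.exists_isOpen_disjoint hΩ hx₀ (Metric.ball_mem_nhds x₀ hr)
    obtain ⟨y, hyW, hy⟩ := hflat W hWo hWn hWb
    exact disjoint_left.1 hWd hyW (hy.elim (fun h => h1 h) fun h => h2 h)
  · exact ⟨m, hmn, inter_ball_eq_halfBall hΩ hmn h1 h2⟩
  · exact ⟨-m, hmn', inter_ball_eq_halfBall hΩ hmn' h2 (by rwa [neg_neg])⟩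
  · exfalso
    have hne : (Ω ∩ Metric.ball x₀ r).Nonempty := by
      rw [inter_comm]
      exact mem_closure_iff.1 (frontier_subset_closure hx₀) _ Metric.isOpen_ball
        (Metric.mem_ball_self hr)
    obtain ⟨y, hyW, hy⟩ := hflat _ (hΩ.inter Metric.isOpen_ball) hne inter_subset_right
    exact hy.elim (fun h => disjoint_left.1 h1 h hyW.1) fun h => disjoint_left.1 h2 h hyW.1

/-! ### The global identity -/

theorem WeakDivOn.congr_set {V V' W : Set E3} {F : E3 → E3} {β : E3 → ℝ}
    (h : WeakDivOn V W F β) (hV : MeasurableSet V) (hV' : MeasurableSet V')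
    (hVW : V ∩ W = V' ∩ W) : WeakDivOn V' W F β := by
  intro ζ hζ
  have key : ∀ U, MeasurableSet U → ∫ x in U, (ζ x * β x + fderiv ℝ ζ x (F x)) =
      ∫ x in U ∩ W, (ζ x * β x + fderiv ℝ ζ x (F x)) := fun U hU =>
    setIntegral_eq_of_subset_of_forall_sdiff_eq_zero hU inter_subset_left fun x hx => by
      have : x ∉ W := fun hxW => hx.2 ⟨hx.1, hxW⟩
      simp [hζ.eq_zero this, hζ.fderiv_eq_zero this]
  rw [key V' hV', ← hVW, ← key V hV]
  exact h ζ hζ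

theorem WeakDivOn.remove_lines {V : Set E3} {F : E3 → E3} {β : E3 → ℝ}
    (hV : Bornology.IsBounded V) (hVm : MeasurableSet V) (hF : MemL2 V F) (hβ : IntegrableOn β V)
    (T : Finset ((E3 × ℝ) × (E3 × ℝ)))
    (hT : ∀ t ∈ T, LinearIndependent ℝ ![t.1.1, t.2.1])
    (h : WeakDivOn V (⋃ t ∈ T, {x | inner ℝ t.1.1 x = t.1.2 ∧ inner ℝ t.2.1 x = t.2.2})ᶜ F β) :
    WeakDivOn V univ F β := by
  classical
  induction T using Finset.induction_on with
  | empty => simpa using h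
  | insert t T _ ih =>
    refine ih (fun t' ht' => hT t' (Finset.mem_insert_of_mem ht')) ?_
    refine WeakDivOn.remove_line hV hVm (hT t (Finset.mem_insert_self _ _)) hF hβ
      (c := t.1.2) (d := t.2.2) ?_
    rwa [Finset.set_biUnion_insert, union_comm] at h

/-- The flux condition `∑ᵢ ∂ᵢ⟪u, K eᵢ⟫` with zero boundary values gives a condition on the normal
component at a wall. -/
theorem weakDivOn_wall {Ω : Set E3} (hΩ : IsOpen Ω) {n x₀ : E3}
    (hn : ‖n‖ = 1) {r : ℝ}
    (hb : Ω ∩ Metric.ball x₀ r = halfBall n x₀ r) {u : E3 → E3} {A : E3 → E3 →L[ℝ] E3}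
    (hu : MemL2 Ω u) (hA : MemL2 Ω A) (huA : WeakJacOn Ω Ω u A) (K : E3 →L[ℝ] E3)
    (hK : WeakDivOn Ω univ (fun x => ∑ i, (inner ℝ (u x) (K (stdVec i)) : ℝ) • stdVec i)
      (fun x => ∑ i, inner ℝ (A x (stdVec i)) (K (stdVec i)))) :
    WeakDivOn (halfBall n x₀ r) (Metric.ball x₀ r) (fun x => (inner ℝ (u x) (K n) : ℝ) • n)
      (fun x => inner ℝ (A x n) (K n)) := by
  intro ζ hζ
  have hsub : halfBall n x₀ r ⊆ Ω := by rw [← hb]; exact inter_subset_left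
  have hVm := (isOpen_halfBall n x₀ r).measurableSet
  have hu' : MemL2 (halfBall n x₀ r) u := MemLp.mono_measure (Measure.restrict_mono hsub le_rfl) hu
  have hA' : MemL2 (halfBall n x₀ r) A := MemLp.mono_measure (Measure.restrict_mono hsub le_rfl) hA
  have hVf := volume_halfBall_ne_top n x₀ r
  have huA' : WeakJacOn (halfBall n x₀ r) (halfBall n x₀ r) u A := fun c e =>
    ((huA c e).mono hsub).congr_set hΩ.measurableSet hVm
      (by rw [inter_self, inter_eq_right.2 hsub])
  have hK' := ((hK.mono (subset_univ (Metric.ball x₀ r))).congr_set hΩ.measurableSet hVm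
    (by rw [hb, inter_eq_left.2 fun x hx => hx.1])) ζ hζ
  have hi : ∀ e c : E3, IntegrableOn (fun x => ζ x * inner ℝ (A x e) c +
      fderiv ℝ ζ x ((inner ℝ (u x) c : ℝ) • e)) (halfBall n x₀ r) := fun e c =>
    hζ.integrableOn_add (((hu'.integrableOn hVf).inner_const c).smul_const e)
      (((memLp_clm_apply hA' e).integrableOn hVf).inner_const c)
  have h1 : ∀ x, ζ x * ∑ i, inner ℝ (A x (stdVec i)) (K (stdVec i)) +
      fderiv ℝ ζ x (∑ i, (inner ℝ (u x) (K (stdVec i)) : ℝ) • stdVec i) =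
      ∑ i, (ζ x * inner ℝ (A x (stdVec i)) (K (stdVec i)) +
        fderiv ℝ ζ x ((inner ℝ (u x) (K (stdVec i)) : ℝ) • stdVec i)) := fun x => by
    rw [map_sum, Finset.mul_sum, Finset.sum_add_distrib]
  simp_rw [h1] at hK'
  rw [integral_finsetSum _ fun i _ => hi _ _] at hK'
  simp_rw [fun i => huA'.integral_halfBall_eq hn hu' hA' hζ (stdVec i) (K (stdVec i)),
    ← integral_const_mul] at hK'
  rw [← integral_finsetSum _ fun i _ => (hi _ _).const_mul _] at hK'
  rw [← hK']
  congr 1; ext x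
  have hKn : K n = ∑ i, (inner ℝ n (stdVec i) : ℝ) • K (stdVec i) := by
    conv_lhs => rw [← sum_smul_stdVec n]
    simp [map_sum, EuclideanSpace.inner_single_right]
  simp only [hKn, inner_sum, real_inner_smul_right, map_smul, smul_eq_mul, Finset.mul_sum,
    Finset.sum_mul, ← Finset.sum_add_distrib]
  refine Finset.sum_congr rfl fun i _ => ?_
  ring

theorem exists_isTest_eq_one {Ω : Set E3} (hΩ : Bornology.IsBounded Ω) :
    ∃ ζ : E3 → ℝ, IsTest univ ζ ∧ ∀ x ∈ Ω, ζ x = 1 ∧ fderiv ℝ ζ x = 0 := by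
  obtain ⟨r, hr, hsub⟩ := hΩ.subset_ball_lt 0 0
  let f : ContDiffBump (0 : E3) := ⟨r, r + 1, hr, by linarith⟩
  refine ⟨f, ⟨f.contDiff, f.hasCompactSupport, subset_univ _⟩, fun x hx => ?_⟩
  refine ⟨f.one_of_mem_closedBall (Metric.ball_subset_closedBall (hsub hx)), ?_⟩
  have : (f : E3 → ℝ) =ᶠ[𝓝 x] fun _ => 1 := by
    filter_upwards [Metric.isOpen_ball.mem_nhds (hsub hx)] with y hy
    exact f.one_of_mem_closedBall (Metric.ball_subset_closedBall hy)
  rw [this.fderiv_eq]; simp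

/-- On a polyhedral domain the null Lagrangian of two fields with matching homogeneous boundary
conditions has vanishing integral. -/
theorem integral_nullLagrangian_eq_zero {Ω : Set E3} (hΩ : IsPolyhedralDomain Ω) {u v : E3 → E3}
    {A B : E3 → E3 →L[ℝ] E3} (hu : MemL2 Ω u) (hA : MemL2 Ω A) (hv : MemL2 Ω v) (hB : MemL2 Ω B)
    (huA : WeakJacOn Ω Ω u A) (hvB : WeakJacOn Ω Ω v B) {s : ℝ} (hs : s * s = 1)
    (hbu : ∀ n c : E3, ‖n‖ = 1 → ∃ K : E3 →L[ℝ] E3, K n = c - s • reflDir n c ∧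
      WeakDivOn Ω univ (fun x => ∑ i, (inner ℝ (u x) (K (stdVec i)) : ℝ) • stdVec i)
      (fun x => ∑ i, inner ℝ (A x (stdVec i)) (K (stdVec i))))
    (hbv : ∀ n c : E3, ‖n‖ = 1 → ∃ K : E3 →L[ℝ] E3, K n = c - s • reflDir n c ∧
      WeakDivOn Ω univ (fun x => ∑ i, (inner ℝ (v x) (K (stdVec i)) : ℝ) • stdVec i)
      (fun x => ∑ i, inner ℝ (B x (stdVec i)) (K (stdVec i)))) :
    ∫ x in Ω, (tr (A x ∘L B x) - tr (A x) * tr (B x)) = 0 := by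
  classical
  have hΩf : volume Ω ≠ ⊤ := hΩ.isBounded.measure_lt_top.ne
  have hΩm := hΩ.isOpen.measurableSet
  obtain ⟨P, hP0, hP⟩ := hΩ.planar
  have hδ : ∀ k : ℕ, (0 : ℝ) < 1 / ((k : ℝ) + 1) := fun k => by positivity
  have hzero : ∀ k : ℕ, ∫ x in Ω, lagDens (trunc (1 / ((k : ℝ) + 1))) u A B x = 0 := by
    intro k
    set δ : ℝ := 1 / ((k : ℝ) + 1) with hδdef
    have hδ0 : 0 < δ := hδ k
    have hG := contDiff_trunc hδ0
    have hGM := norm_trunc_le hδ0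
    have hGM' : ∀ y, ‖fderiv ℝ (trunc δ) y‖ ≤ 3 + 1 / δ := fun y =>
      (norm_fderiv_trunc_le hδ0 y).trans (le_add_of_nonneg_right (one_div_pos.2 hδ0).le)
    have hF2 : MemL2 Ω (lagFlux (trunc δ) u B) := memL2_lagFlux hG.continuous hGM hu hB
    have hFi := hF2.integrableOn hΩf
    have hβi : IntegrableOn (lagDens (trunc δ) u A B) Ω := integrableOn_lagDens hG hGM' hu hA hB
    have hall : WeakDivOn Ω univ (lagFlux (trunc δ) u B) (lagDens (trunc δ) u A B) := by
      refine WeakDivOn.remove_lines hΩ.isBounded hΩm hF2 hβi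
        ((P ×ˢ P).filter fun t => LinearIndependent ℝ ![t.1.1, t.2.1])
        (fun t ht => (Finset.mem_filter.1 ht).2) ?_
      refine WeakDivOn.of_local hΩ.isOpen hFi hβi fun x hxS hxc => ?_
      by_cases hxΩ : x ∈ Ω
      · exact ⟨Ω, hΩ.isOpen, hxΩ, weakDivOn_lagFlux hΩ.isOpen hΩf hG hGM hGM' hu hA hv hB huA hvB⟩
      have hxf : x ∈ frontier Ω := by rw [hΩ.isOpen.frontier_eq]; exact ⟨hxc, hxΩ⟩
      obtain ⟨p, hpP, hpx⟩ := hP x hxf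
      have hfar : ∀ᶠ y in 𝓝 x, ∀ q ∈ P, inner ℝ q.1 x ≠ q.2 → inner ℝ q.1 y ≠ q.2 := by
        rw [Filter.eventually_all_finset]
        intro q _
        by_cases hq : inner ℝ q.1 x = q.2
        · exact Eventually.of_forall fun y h => absurd hq h
        · have hc : ContinuousAt (fun y : E3 => (inner ℝ q.1 y : ℝ)) x := by fun_prop
          filter_upwards [hc.eventually_ne hq] with y hy _ using hy
      obtain ⟨r, hr, hball⟩ := Metric.eventually_nhds_iff_ball.1 hfar
      have hloc : ∀ y ∈ Metric.ball x r, y ∈ frontier Ω → inner ℝ p.1 y = inner ℝ p.1 x := by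
        intro y hy hyf
        obtain ⟨q, hqP, hqy⟩ := hP y hyf
        have hqx : inner ℝ q.1 x = q.2 := by
          by_contra hne
          exact hball y hy q hqP hne hqy
        have hdep : ¬ LinearIndependent ℝ ![q.1, p.1] := fun hli => by
          refine hxS (mem_iUnion₂.2 ⟨(q, p), ?_, hqx, hpx⟩)
          exact Finset.mem_filter.2 ⟨Finset.mem_product.2 ⟨hqP, hpP⟩, hli⟩
        rw [LinearIndependent.pair_iff' (hP0 q hqP)] at hdep
        push Not at hdep
        obtain ⟨a, ha⟩ := hdep
        rw [← ha, real_inner_smul_left, real_inner_smul_left, hqy, hqx]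
      obtain ⟨n, hn, hΩn⟩ := exists_inter_ball_eq_halfBall hΩ.isOpen hΩ.lipschitz hxf (hP0 p hpP)
        hr hloc
      refine ⟨Metric.ball x r, Metric.isOpen_ball, Metric.mem_ball_self hr, ?_⟩
      have hsub : halfBall n x r ⊆ Ω := by rw [← hΩn]; exact inter_subset_left
      have hVm := (isOpen_halfBall n x r).measurableSet
      have hmono := Measure.restrict_mono (μ := (volume : Measure E3)) hsub le_rfl
      have hjac : ∀ {u : E3 → E3} {A : E3 → E3 →L[ℝ] E3}, WeakJacOn Ω Ω u A →
          WeakJacOn (halfBall n x r) (halfBall n x r) u A := fun h c e =>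
        ((h c e).mono hsub).congr_set hΩm hVm
          (by rw [inter_self, inter_eq_right.2 hsub])
      have hhalf := weakDivOn_lagFlux_halfBall hn hs (x₀ := x) (r := r) hG hGM hGM'
        (trunc_reflDir hs n) (MemLp.mono_measure hmono hu) (MemLp.mono_measure hmono hA)
        (MemLp.mono_measure hmono hv) (MemLp.mono_measure hmono hB) (hjac huA) (hjac hvB)
        (fun c => by
          obtain ⟨K, hKn, hK⟩ := hbu n c hn
          rw [← hKn]
          exact weakDivOn_wall hΩ.isOpen hn hΩn hu hA huA K hK)
        (fun c => by
          obtain ⟨K, hKn, hK⟩ := hbv n c hn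
          rw [← hKn]
          exact weakDivOn_wall hΩ.isOpen hn hΩn hv hB hvB K hK)
      exact hhalf.congr_set hVm hΩm
        (by rw [hΩn, inter_eq_left.2 fun x hx => hx.1])
    obtain ⟨ζ, hζ, hζ1⟩ := exists_isTest_eq_one hΩ.isBounded
    rw [← hall ζ hζ]
    refine setIntegral_congr_fun hΩm fun x hx => ?_
    simp [(hζ1 x hx).1, (hζ1 x hx).2]
  have hlim : Tendsto (fun k : ℕ => ∫ x in Ω, lagDens (trunc (1 / ((k : ℝ) + 1))) u A B x) atTop
      (𝓝 (∫ x in Ω, (tr (A x ∘L B x) - tr (A x) * tr (B x)))) := by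
    refine tendsto_integral_of_dominated_convergence
      (fun x => 6 * 3 * (‖A x‖ ^ 2 + ‖B x‖ ^ 2)) (fun k => ?_) ?_ (fun k => ?_) ?_
    · exact aestronglyMeasurable_lagDens (contDiff_trunc (hδ k)) hu.1 hA.1 hB.1
    · exact ((hA.integrable_norm_pow (by norm_num)).add
        (hB.integrable_norm_pow (by norm_num))).const_mul _
    · exact ae_of_all _ fun x => abs_lagDens_le (norm_fderiv_trunc_le (hδ k)) x
    · refine ae_of_all _ fun x => ?_
      have hL := tendsto_fderiv_trunc (u x)
      have hc1 : Continuous (fun L : E3 →L[ℝ] E3 => L ∘L A x) :=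
        continuous_id.clm_comp continuous_const
      have hc2 : Continuous (fun L : E3 →L[ℝ] E3 => (L ∘L A x) ∘L B x) :=
        hc1.clm_comp continuous_const
      have h1 := ((continuous_tr.comp hc1).tendsto (ContinuousLinearMap.id ℝ E3)).comp hL
      have h2 := ((continuous_tr.comp hc2).tendsto (ContinuousLinearMap.id ℝ E3)).comp hL
      exact h2.sub (h1.mul_const (tr (B x)))
  simp_rw [hzero] at hlim
  exact (tendsto_nhds_unique hlim tendsto_const_nhds)

/-! ### Functions with vanishing integral -/

/-- `f` is integrable over `V` and its integral vanishes. -/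
def IntegralZero (V : Set E3) (f : E3 → ℝ) : Prop := IntegrableOn f V ∧ ∫ x in V, f x = 0

theorem IntegralZero.add {V : Set E3} {f g : E3 → ℝ} (hf : IntegralZero V f)
    (hg : IntegralZero V g) : IntegralZero V (fun x => f x + g x) :=
  ⟨hf.1.add hg.1, by rw [integral_add hf.1 hg.1, hf.2, hg.2, add_zero]⟩

theorem IntegralZero.sub {V : Set E3} {f g : E3 → ℝ} (hf : IntegralZero V f)
    (hg : IntegralZero V g) : IntegralZero V (fun x => f x - g x) :=
  ⟨hf.1.sub hg.1, by rw [integral_sub hf.1 hg.1, hf.2, hg.2, sub_zero]⟩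

theorem IntegralZero.const_mul {V : Set E3} {f : E3 → ℝ} (hf : IntegralZero V f) (c : ℝ) :
    IntegralZero V (fun x => c * f x) :=
  ⟨hf.1.const_mul c, by rw [integral_const_mul, hf.2, mul_zero]⟩

theorem IntegralZero.sum {ι : Type*} {V : Set E3} {s : Finset ι} {f : ι → E3 → ℝ}
    (hf : ∀ i ∈ s, IntegralZero V (f i)) : IntegralZero V (fun x => ∑ i ∈ s, f i x) :=
  ⟨integrable_finsetSum _ fun i hi => (hf i hi).1, by
    rw [integral_finsetSum _ fun i hi => (hf i hi).1]
    exact Finset.sum_eq_zero fun i hi => (hf i hi).2⟩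

theorem IntegralZero.congr_ae {V : Set E3} {f g : E3 → ℝ} (hf : IntegralZero V f)
    (h : f =ᵐ[volume.restrict V] g) : IntegralZero V g :=
  ⟨hf.1.congr h, by rw [← integral_congr_ae h, hf.2]⟩

theorem IntegralZero.congr {V : Set E3} {f g : E3 → ℝ} (hf : IntegralZero V f)
    (h : ∀ x, g x = f x) : IntegralZero V g :=
  hf.congr_ae (ae_of_all _ fun x => (h x).symm)

theorem IntegralZero.integral_eq {V : Set E3} {f g : E3 → ℝ} (hf : IntegrableOn f V)
    (hg : IntegrableOn g V) (h : IntegralZero V (fun x => f x - g x)) :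
    ∫ x in V, f x = ∫ x in V, g x := by
  rw [← sub_eq_zero, ← integral_sub hf hg, h.2]

theorem MemL2.integrableOn_mul {V : Set E3} {f g : E3 → ℝ} (hf : MemL2 V f) (hg : MemL2 V g) :
    IntegrableOn (fun x => f x * g x) V :=
  MemLp.integrable_mul hf hg

theorem MemL2.integrableOn_inner {V : Set E3} {f g : E3 → E3} (hf : MemL2 V f) (hg : MemL2 V g) :
    IntegrableOn (fun x => (inner ℝ (f x) (g x) : ℝ)) V := by
  simp only [PiLp.inner_apply]
  exact integrable_finsetSum _ fun i _ => (memLp_coord hg i).integrableOn_mul (memLp_coord hf i)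

theorem memL2_of_coord {V : Set E3} {f : E3 → E3} (h : ∀ i, MemL2 V (fun x => f x i)) :
    MemL2 V f := by
  have h1 : MemL2 V (fun x => ∑ i, f x i • stdVec i) := memLp_finsetSum _ fun i _ =>
    (ContinuousLinearMap.smulRight (ContinuousLinearMap.id ℝ ℝ) (stdVec i)).comp_memLp' (h i)
  simpa only [sum_smul_stdVec] using h1

theorem IsTest.memL2 {F : Type*} [NormedAddCommGroup F] [NormedSpace ℝ F] {W : Set E3}
    {φ : E3 → F} (h : IsTest W φ) (V : Set E3) : MemL2 V φ :=
  (h.continuous.memLp_of_hasCompactSupport h.hasCompactSupport).restrict V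

/-! ### Test functions and partial derivatives -/

theorem pd_eq (i : Fin 3) (φ : E3 → ℝ) (x : E3) : pd i φ x = fderiv ℝ φ x (stdVec i) := rfl

theorem IsTest.partialDeriv {W : Set E3} {φ : E3 → ℝ} (h : IsTest W φ) (i : Fin 3) : IsTest W (pd i φ) :=
  h.fderiv_apply (stdVec i)

theorem classGrad_apply (φ : E3 → ℝ) (x : E3) (i : Fin 3) : classGrad φ x i = pd i φ x := by
  fin_cases i <;> simp [classGrad]

theorem pd_mul_const {φ : E3 → ℝ} {x : E3} (h : DifferentiableAt ℝ φ x) (i : Fin 3) (c : ℝ) :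
    pd i (fun y => φ y * c) x = pd i φ x * c := by
  rw [pd, fderiv_mul_const h]
  simp [pd, mul_comm]

theorem pd_comm {W : Set E3} {φ : E3 → ℝ} (h : IsTest W φ) (i j : Fin 3) (x : E3) :
    pd i (pd j φ) x = pd j (pd i φ) x := by
  have hc : ContDiffAt ℝ 2 φ x := (contDiff_infty.1 h.contDiff 2).contDiffAt
  have hs := hc.isSymmSndFDerivAt (by simp)
  have hd : DifferentiableAt ℝ (fderiv ℝ φ) x :=
    ((h.contDiff.fderiv_right (m := ∞) (by simp)).differentiable (by simp)) x
  have hf : ∀ v w : E3, fderiv ℝ (fun y => fderiv ℝ φ y v) x w =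
      fderiv ℝ (fderiv ℝ φ) x w v := fun v w => by
    rw [fderiv_clm_apply hd (differentiableAt_const v)]
    simp
  simp only [pd_eq]
  rw [show pd j φ = fun y => fderiv ℝ φ y (stdVec j) from rfl,
    show pd i φ = fun y => fderiv ℝ φ y (stdVec i) from rfl, hf, hf]
  exact hs _ _

/-! ### The chosen weak derivatives -/

theorem MemH1.isWeakGrad {Ω : Set E3} {f : E3 → ℝ} (h : MemH1 Ω f) :
    IsWeakGrad Ω f (wgrad Ω f) := by
  rw [wgrad, dif_pos h.2]; exact h.2.choose_spec

theorem IsWeakDiv.isWeakDiv_wdiv {Ω : Set E3} {u : E3 → E3} {d : E3 → ℝ} (h : IsWeakDiv Ω u d) :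
    IsWeakDiv Ω u (wdiv Ω u) := by
  have h' : ∃ d, IsWeakDiv Ω u d := ⟨d, h⟩
  rw [wdiv, dif_pos h']; exact h'.choose_spec

theorem IsWeakCurl.isWeakCurl_wcurl {Ω : Set E3} {u w : E3 → E3} (h : IsWeakCurl Ω u w) :
    IsWeakCurl Ω u (wcurl Ω u) := by
  have h' : ∃ w, IsWeakCurl Ω u w := ⟨w, h⟩
  rw [wcurl, dif_pos h']; exact h'.choose_spec

theorem MemL2.ae_eq {Ω : Set E3} (hΩ : IsOpen Ω) {f g : E3 → ℝ} (hf : MemL2 Ω f)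
    (hg : MemL2 Ω g)
    (h : ∀ ζ : E3 → ℝ, IsTest Ω ζ → ∫ x in Ω, f x * ζ x = ∫ x in Ω, g x * ζ x) :
    f =ᵐ[volume.restrict Ω] g := by
  have hloc : LocallyIntegrableOn (fun x => f x - g x) Ω := by
    refine (locallyIntegrableOn_iff hΩ.isLocallyClosed).2 fun k hk hkc => ?_
    have h1 : MemL2 k (fun x => f x - g x) :=
      MemLp.mono_measure (Measure.restrict_mono hk le_rfl) (hf.sub hg)
    exact h1.integrableOn hkc.measure_lt_top.ne
  have h0 := hΩ.ae_eq_zero_of_integral_contDiff_smul_eq_zero hloc fun ζ h1 h2 h3 => by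
    have ht : IsTest Ω ζ := ⟨h1, h2, h3⟩
    have hfi := hf.integrableOn_mul (ht.memL2 Ω)
    have hgi := hg.integrableOn_mul (ht.memL2 Ω)
    rw [← setIntegral_eq_integral_of_forall_compl_eq_zero (s := Ω)
      fun x hx => by rw [ht.eq_zero hx, zero_smul]]
    have : ∀ x, ζ x • (f x - g x) = f x * ζ x - g x * ζ x := fun x => by
      rw [smul_eq_mul]; ring
    simp_rw [this]
    rw [integral_sub hfi hgi, h ζ ht, sub_self]
  rw [EventuallyEq, ae_restrict_iff' hΩ.measurableSet]
  filter_upwards [h0] with x hx hxΩ using sub_eq_zero.1 (hx hxΩ)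

theorem MemL2.ae_eq_vec {Ω : Set E3} (hΩ : IsOpen Ω) {f g : E3 → E3} (hf : MemL2 Ω f)
    (hg : MemL2 Ω g)
    (h : ∀ Φ : E3 → E3, IsTest Ω Φ →
      ∫ x in Ω, (inner ℝ (f x) (Φ x) : ℝ) = ∫ x in Ω, (inner ℝ (g x) (Φ x) : ℝ)) :
    f =ᵐ[volume.restrict Ω] g := by
  have hj : ∀ j, (fun x => f x j) =ᵐ[volume.restrict Ω] fun x => g x j := fun j =>
    MemL2.ae_eq hΩ (memLp_coord hf j) (memLp_coord hg j) fun ζ hζ => by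
      have := h _ (hζ.smul_const (stdVec j))
      simpa [inner_smul_right, EuclideanSpace.inner_single_right, mul_comm] using this
  filter_upwards [ae_all_iff.2 hj] with x hx
  ext j; exact hx j

theorem IsWeakGrad.wgrad_ae_eq {Ω : Set E3} (hΩ : IsOpen Ω) {f : E3 → ℝ} {g : E3 → E3}
    (hf : MemL2 Ω f) (h : IsWeakGrad Ω f g) : wgrad Ω f =ᵐ[volume.restrict Ω] g := by
  have h' := MemH1.isWeakGrad ⟨hf, g, h⟩
  exact MemL2.ae_eq_vec hΩ h'.1 h.1 fun Φ hΦ => neg_inj.1 ((h'.2 Φ hΦ).symm.trans (h.2 Φ hΦ))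

theorem IsWeakDiv.wdiv_ae_eq {Ω : Set E3} (hΩ : IsOpen Ω) {u : E3 → E3} {d : E3 → ℝ}
    (h : IsWeakDiv Ω u d) : wdiv Ω u =ᵐ[volume.restrict Ω] d := by
  have h' := h.isWeakDiv_wdiv
  exact MemL2.ae_eq hΩ h'.1 h.1 fun φ hφ => neg_inj.1 ((h'.2 φ hφ).symm.trans (h.2 φ hφ))

theorem IsWeakCurl.wcurl_ae_eq {Ω : Set E3} (hΩ : IsOpen Ω) {u w : E3 → E3}
    (h : IsWeakCurl Ω u w) : wcurl Ω u =ᵐ[volume.restrict Ω] w := by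
  have h' := h.isWeakCurl_wcurl
  exact MemL2.ae_eq_vec hΩ h'.1 h.1 fun Φ hΦ => (h'.2 Φ hΦ).symm.trans (h.2 Φ hΦ)

/-! ### Weak derivatives of `H¹` fields -/

theorem MemH1.integralZero {Ω : Set E3} {f ζ : E3 → ℝ} (h : MemH1 Ω f) (hζ : IsTest Ω ζ)
    (i : Fin 3) : IntegralZero Ω (fun x => ζ x * wgrad Ω f x i + f x * pd i ζ x) := by
  have hi1 := (hζ.memL2 Ω).integrableOn_mul (memLp_coord h.isWeakGrad.1 i)
  have hi2 := h.1.integrableOn_mul ((hζ.partialDeriv i).memL2 Ω)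
  refine ⟨hi1.add hi2, ?_⟩
  have h1 := h.isWeakGrad.2 _ (hζ.smul_const (stdVec i))
  have h2 : ∀ x, ∑ k, pd k (fun y => (ζ y • stdVec i) k) x = pd i ζ x := fun x => by
    have : ∀ k, pd k (fun y => (ζ y • stdVec i) k) x = pd k ζ x * stdVec i k := fun k =>
      pd_mul_const (hζ.differentiable x) k _
    simp_rw [this]
    simp [stdVec]
  have h3 : ∀ x, (inner ℝ (wgrad Ω f x) (ζ x • stdVec i) : ℝ) = ζ x * wgrad Ω f x i := fun x => by
    simp [inner_smul_right, EuclideanSpace.inner_single_right]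
  simp_rw [h2, h3] at h1
  rw [integral_add hi1 hi2, h1, add_neg_cancel]

theorem MemH1Vec.memL2 {Ω : Set E3} {u : E3 → E3} (h : MemH1Vec Ω u) : MemL2 Ω u :=
  memL2_of_coord fun j => (h j).1

theorem MemH1Vec.memL2_gradVec {Ω : Set E3} {u : E3 → E3} (h : MemH1Vec Ω u) (j i : Fin 3) :
    MemL2 Ω (fun x => gradVec Ω u x j i) := memLp_coord (h j).isWeakGrad.1 i

theorem MemH1Vec.integralZero {Ω : Set E3} {u : E3 → E3} {ζ : E3 → ℝ} (h : MemH1Vec Ω u)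
    (hζ : IsTest Ω ζ) (j i : Fin 3) :
    IntegralZero Ω (fun x => ζ x * gradVec Ω u x j i + u x j * pd i ζ x) :=
  (h j).integralZero hζ i

/-- The trace of a matrix `M j i = ∂ᵢ uⱼ`. -/
def matDiv (M : Matrix (Fin 3) (Fin 3) ℝ) : ℝ := ∑ i, M i i

/-- The axial vector of a matrix `M j i = ∂ᵢ uⱼ`. -/
def matCurl (M : Matrix (Fin 3) (Fin 3) ℝ) : E3 :=
  !₂[M 2 1 - M 1 2, M 0 2 - M 2 0, M 1 0 - M 0 1]

theorem MemH1Vec.isWeakDiv {Ω : Set E3} {u : E3 → E3} (h : MemH1Vec Ω u) :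
    IsWeakDiv Ω u (fun x => matDiv (gradVec Ω u x)) := by
  have hd : MemL2 Ω (fun x => matDiv (gradVec Ω u x)) :=
    memLp_finsetSum _ fun i _ => h.memL2_gradVec i i
  refine ⟨hd, fun φ hφ => ?_⟩
  have hg : MemL2 Ω (classGrad φ) := memL2_of_coord fun i => by
    simp only [classGrad_apply]; exact (hφ.partialDeriv i).memL2 Ω
  rw [← integral_neg]
  refine IntegralZero.integral_eq (h.memL2.integrableOn_inner hg)
    (hd.integrableOn_mul (hφ.memL2 Ω)).neg ?_
  refine (IntegralZero.sum (s := Finset.univ) fun i _ => h.integralZero hφ i i).congr fun x => ?_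
  simp [matDiv, Fin.sum_univ_three, PiLp.inner_apply, classGrad_apply]
  ring

theorem memL2_matCurl {Ω : Set E3} {M : E3 → Matrix (Fin 3) (Fin 3) ℝ}
    (h : ∀ j i, MemL2 Ω (fun x => M x j i)) : MemL2 Ω (fun x => matCurl (M x)) := by
  refine memL2_of_coord fun i => ?_
  fin_cases i
  · exact (h 2 1).sub (h 1 2)
  · exact (h 0 2).sub (h 2 0)
  · exact (h 1 0).sub (h 0 1)

theorem memL2_classCurl {V W : Set E3} {Φ : E3 → E3} (h : IsTest W Φ) : MemL2 V (classCurl Φ) :=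
  memL2_matCurl (M := fun x => Matrix.of fun j i => pd i (fun y => Φ y j) x)
    fun j i => ((h.coord j).partialDeriv i).memL2 V

theorem MemH1Vec.isWeakCurl {Ω : Set E3} {u : E3 → E3} (h : MemH1Vec Ω u) :
    IsWeakCurl Ω u (fun x => matCurl (gradVec Ω u x)) := by
  have hd := memL2_matCurl h.memL2_gradVec
  refine ⟨hd, fun Φ hΦ => ?_⟩
  refine IntegralZero.integral_eq (h.memL2.integrableOn_inner (memL2_classCurl hΦ))
    (hd.integrableOn_inner (hΦ.memL2 Ω)) ?_
  have T := fun k j i => h.integralZero (hΦ.coord k) j i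
  refine ((((T 2 0 1).sub (T 1 0 2)).add ((T 0 1 2).sub (T 2 1 0))).add
    ((T 1 2 0).sub (T 0 2 1))).congr fun x => ?_
  simp [matCurl, classCurl, Fin.sum_univ_three, PiLp.inner_apply]
  ring

theorem MemH1Vec.wdiv_ae_eq {Ω : Set E3} (hΩ : IsOpen Ω) {u : E3 → E3} (h : MemH1Vec Ω u) :
    wdiv Ω u =ᵐ[volume.restrict Ω] fun x => matDiv (gradVec Ω u x) :=
  h.isWeakDiv.wdiv_ae_eq hΩ

theorem MemH1Vec.wcurl_ae_eq {Ω : Set E3} (hΩ : IsOpen Ω) {u : E3 → E3} (h : MemH1Vec Ω u) :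
    wcurl Ω u =ᵐ[volume.restrict Ω] fun x => matCurl (gradVec Ω u x) :=
  h.isWeakCurl.wcurl_ae_eq hΩ

theorem IsTest.isWeakGrad {Ω W : Set E3} {ζ : E3 → ℝ} (hζ : IsTest W ζ) :
    IsWeakGrad Ω ζ (classGrad ζ) := by
  have hg : MemL2 Ω (classGrad ζ) := memL2_of_coord fun i => by
    simp only [classGrad_apply]; exact (hζ.partialDeriv i).memL2 Ω
  refine ⟨hg, fun Φ hΦ => ?_⟩
  have hdΦ : MemL2 Ω (fun x => ∑ i, pd i (fun y => Φ y i) x) :=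
    memLp_finsetSum _ fun i _ => ((hΦ.coord i).partialDeriv i).memL2 Ω
  rw [← integral_neg]
  refine IntegralZero.integral_eq ((hζ.memL2 Ω).integrableOn_mul hdΦ)
    (hg.integrableOn_inner (hΦ.memL2 Ω)).neg ?_
  have key : ∀ i, IntegralZero Ω (fun x => ζ x * pd i (fun y => Φ y i) x + pd i ζ x * Φ x i) := by
    intro i
    have hi1 := (hζ.memL2 univ).integrableOn_mul (((hΦ.coord i).partialDeriv i).memL2 univ)
    have hi2 := ((hζ.partialDeriv i).memL2 univ).integrableOn_mul ((hΦ.coord i).memL2 univ)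
    have hi3 := (hζ.memL2 univ).integrableOn_mul ((hΦ.coord i).memL2 univ)
    rw [integrableOn_univ] at hi1 hi2 hi3
    refine ⟨(hi1.add hi2).integrableOn, ?_⟩
    rw [setIntegral_eq_integral_of_forall_compl_eq_zero fun x hx => by
      rw [((hΦ.coord i).partialDeriv i).eq_zero hx, (hΦ.coord i).eq_zero hx, mul_zero, mul_zero, add_zero],
      integral_add hi1 hi2]
    have := integral_mul_fderiv_eq_neg_fderiv_mul_of_integrable (μ := volume) (v := stdVec i)
      hi2 hi1 hi3 (fun x _ => hζ.differentiable x) (fun x _ => (hΦ.coord i).differentiable x)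
    simp only [pd_eq]
    rw [this, neg_add_cancel]
  refine (IntegralZero.sum (s := Finset.univ) fun i _ => key i).congr fun x => ?_
  simp [Fin.sum_univ_three, PiLp.inner_apply, classGrad_apply]
  ring

theorem IsTest.memH1 {Ω W : Set E3} {ζ : E3 → ℝ} (hζ : IsTest W ζ) : MemH1 Ω ζ :=
  ⟨hζ.memL2 Ω, _, hζ.isWeakGrad⟩

theorem IsTest.wgrad_ae_eq {Ω W : Set E3} (hΩ : IsOpen Ω) {ζ : E3 → ℝ} (hζ : IsTest W ζ) :
    wgrad Ω ζ =ᵐ[volume.restrict Ω] classGrad ζ := hζ.isWeakGrad.wgrad_ae_eq hΩ (hζ.memL2 Ω)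

theorem IsTest.memH1Vec {Ω W : Set E3} {Φ : E3 → E3} (hΦ : IsTest W Φ) : MemH1Vec Ω Φ :=
  fun j => (hΦ.coord j).memH1

theorem IsTest.wcurl_ae_eq {Ω W : Set E3} (hΩ : IsOpen Ω) {Φ : E3 → E3} (hΦ : IsTest W Φ) :
    wcurl Ω Φ =ᵐ[volume.restrict Ω] classCurl Φ := by
  filter_upwards [hΦ.memH1Vec.wcurl_ae_eq hΩ,
    ae_all_iff.2 fun j => (hΦ.coord j).wgrad_ae_eq hΩ] with x hx hj
  rw [hx]
  simp [matCurl, gradVec, hj, classGrad_apply, classCurl]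

/-! ### The Jacobian as a linear map -/

/-- The linear map with matrix `M`. -/
def matMap (M : Matrix (Fin 3) (Fin 3) ℝ) : E3 →L[ℝ] E3 :=
  ∑ j, ∑ i, M j i • (EuclideanSpace.proj i : E3 →L[ℝ] ℝ).smulRight (stdVec j)

theorem matMap_apply (M : Matrix (Fin 3) (Fin 3) ℝ) (v : E3) (j : Fin 3) :
    matMap M v j = ∑ i, M j i * v i := by
  fin_cases j <;> simp [matMap, Fin.sum_univ_three]

theorem matMap_stdVec (M : Matrix (Fin 3) (Fin 3) ℝ) (i j : Fin 3) :
    matMap M (stdVec i) j = M j i := by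
  rw [matMap_apply]; simp

theorem tr_matMap (M : Matrix (Fin 3) (Fin 3) ℝ) : tr (matMap M) = matDiv M := by
  simp only [tr, matMap_stdVec, matDiv]

theorem memL2_matMap {Ω : Set E3} {M : E3 → Matrix (Fin 3) (Fin 3) ℝ}
    (h : ∀ j i, MemL2 Ω (fun x => M x j i)) : MemL2 Ω (fun x => matMap (M x)) :=
  memLp_finsetSum _ fun j _ => memLp_finsetSum _ fun i _ =>
    (ContinuousLinearMap.smulRight (ContinuousLinearMap.id ℝ ℝ)
      ((EuclideanSpace.proj i : E3 →L[ℝ] ℝ).smulRight (stdVec j))).comp_memLp' (h j i)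

theorem fderiv_eq_sum_pd (φ : E3 → ℝ) (x v : E3) :
    fderiv ℝ φ x v = ∑ i, v i * pd i φ x := by
  conv_lhs => rw [← sum_smul_stdVec v]
  simp [pd_eq]

theorem MemH1Vec.weakJacOn {Ω : Set E3} {u : E3 → E3} (h : MemH1Vec Ω u) :
    WeakJacOn Ω Ω u (fun x => matMap (gradVec Ω u x)) := by
  intro c e ζ hζ
  have key := IntegralZero.sum (s := Finset.univ) fun j _ =>
    IntegralZero.sum (s := Finset.univ) fun i _ => (h.integralZero hζ j i).const_mul (c j * e i)
  refine (key.congr fun x => ?_).2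
  rw [fderiv_eq_sum_pd]
  simp [PiLp.inner_apply, matMap_apply, Fin.sum_univ_three]
  ring

/-! ### Boundary conditions -/

theorem MemH0div.weakDivOn {Ω : Set E3} (hΩ : IsOpen Ω) {u : E3 → E3} (h : MemH1Vec Ω u)
    (h0 : MemH0div Ω u) (n c : E3) (hn : ‖n‖ = 1) :
    ∃ K : E3 →L[ℝ] E3, K n = c - (1 : ℝ) • reflDir n c ∧
      WeakDivOn Ω univ (fun x => ∑ i, (inner ℝ (u x) (K (stdVec i)) : ℝ) • stdVec i)
      (fun x => ∑ i, inner ℝ (matMap (gradVec Ω u x) (stdVec i)) (K (stdVec i))) := by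
  refine ⟨(2 * inner ℝ n c : ℝ) • ContinuousLinearMap.id ℝ E3, ?_, fun ζ hζ => ?_⟩
  · rw [reflDir_apply hn]; simp
  have h1 := h0.2 ζ hζ.memH1
  rw [normalTrace] at h1
  rw [← mul_zero (2 * inner ℝ n c : ℝ), ← h1, ← integral_const_mul]
  refine integral_congr_ae ?_
  filter_upwards [h.wdiv_ae_eq hΩ, hζ.wgrad_ae_eq hΩ] with x hx hx'
  rw [hx, hx', fderiv_eq_sum_pd]
  simp [PiLp.inner_apply, matMap_apply, Fin.sum_univ_three, classGrad_apply, matDiv]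
  ring

/-- The cross product. -/
def crossVec (a b : E3) : E3 :=
  !₂[a 1 * b 2 - a 2 * b 1, a 2 * b 0 - a 0 * b 2, a 0 * b 1 - a 1 * b 0]

/-- The linear map `y ↦ d × y`. -/
def crossMap (d : E3) : E3 →L[ℝ] E3 :=
  matMap !![0, -d 2, d 1; d 2, 0, -d 0; -d 1, d 0, 0]

theorem crossMap_apply (d y : E3) : crossMap d y = crossVec d y := by
  ext j
  rw [crossMap, matMap_apply]
  fin_cases j <;> simp [crossVec, Fin.sum_univ_three] <;> ring

theorem crossVec_crossVec_self {n : E3} (hn : ‖n‖ = 1) (c : E3) :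
    crossVec (crossVec n ((2 : ℝ) • c)) n = c - (-1 : ℝ) • reflDir n c := by
  have h1 : n 0 * n 0 + n 1 * n 1 + n 2 * n 2 = 1 := by
    have := real_inner_self_eq_norm_sq n
    rw [hn, PiLp.inner_apply, Fin.sum_univ_three] at this
    simpa only [RCLike.inner_apply, conj_trivial, one_pow] using this
  rw [reflDir_apply hn]
  ext j
  fin_cases j <;> simp [crossVec, PiLp.inner_apply, Fin.sum_univ_three]
  · linear_combination 2 * c 0 * h1
  · linear_combination 2 * c 1 * h1
  · linear_combination 2 * c 2 * h1

theorem MemH0curl.weakDivOn {Ω : Set E3} (hΩ : IsOpen Ω) {u : E3 → E3} (h : MemH1Vec Ω u)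
    (h0 : MemH0curl Ω u) (n c : E3) (hn : ‖n‖ = 1) :
    ∃ K : E3 →L[ℝ] E3, K n = c - (-1 : ℝ) • reflDir n c ∧
      WeakDivOn Ω univ (fun x => ∑ i, (inner ℝ (u x) (K (stdVec i)) : ℝ) • stdVec i)
      (fun x => ∑ i, inner ℝ (matMap (gradVec Ω u x) (stdVec i)) (K (stdVec i))) := by
  set d := crossVec n ((2 : ℝ) • c) with hd
  refine ⟨crossMap d, by rw [crossMap_apply, crossVec_crossVec_self hn], fun ζ hζ => ?_⟩
  have hΦ : IsTest univ (fun x => ζ x • d) := hζ.smul_const d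
  have h1 := h0.2 _ hΦ.memH1Vec
  rw [tangentialTrace] at h1
  rw [← h1]
  refine integral_congr_ae ?_
  filter_upwards [h.wcurl_ae_eq hΩ, hΦ.wcurl_ae_eq hΩ] with x hx hx'
  have hp : ∀ i j, pd i (fun y => (ζ y • d) j) x = pd i ζ x * d j := fun i j =>
    pd_mul_const (hζ.differentiable x) i (d j)
  rw [hx, hx', fderiv_eq_sum_pd]
  simp only [classCurl, hp]
  simp [PiLp.inner_apply, matMap_apply, Fin.sum_univ_three, matCurl, crossMap_apply, crossVec]
  ring

/-! ### Pointwise identities -/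

theorem inner_matCurl_matCurl (M N : Matrix (Fin 3) (Fin 3) ℝ) :
    (inner ℝ (matCurl M) (matCurl N) : ℝ) = ddot M N - tr (matMap M ∘L matMap N) := by
  rw [tr_comp]
  simp only [matMap_stdVec]
  simp [matCurl, ddot, PiLp.inner_apply, Fin.sum_univ_three]
  ring

theorem ddot_devStrain {Ω : Set E3} {u v : E3 → E3} {x : E3}
    (hu0 : wdiv Ω u x = 0) (hu : wdiv Ω u x = matDiv (gradVec Ω u x)) :
    2 * ddot (devStrain Ω u x) (devStrain Ω v x) = ddot (gradVec Ω u x) (gradVec Ω v x) +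
      tr (matMap (gradVec Ω u x) ∘L matMap (gradVec Ω v x)) := by
  rw [tr_comp]
  simp only [matMap_stdVec]
  have h0 : gradVec Ω u x 2 2 = -(gradVec Ω u x 0 0 + gradVec Ω u x 1 1) := by
    rw [hu0, matDiv, Fin.sum_univ_three] at hu; linarith
  simp [devStrain, hu0, ddot, Fin.sum_univ_three, Matrix.one_apply, h0]
  ring

/-! ### Integral identities for solenoidal fields -/

theorem MemH1Vec.integrableOn_ddot {Ω : Set E3} {u v : E3 → E3} (hu : MemH1Vec Ω u)
    (hv : MemH1Vec Ω v) : IntegrableOn (fun x => ddot (gradVec Ω u x) (gradVec Ω v x)) Ω :=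
  integrable_finsetSum _ fun i _ => integrable_finsetSum _ fun j _ =>
    (hu.memL2_gradVec i j).integrableOn_mul (hv.memL2_gradVec i j)

theorem MemH1Vec.integrableOn_tr_comp {Ω : Set E3} {u v : E3 → E3} (hu : MemH1Vec Ω u)
    (hv : MemH1Vec Ω v) :
    IntegrableOn (fun x => tr (matMap (gradVec Ω u x) ∘L matMap (gradVec Ω v x))) Ω := by
  simp only [tr_comp, matMap_stdVec]
  exact integrable_finsetSum _ fun i _ => integrable_finsetSum _ fun j _ =>
    (hv.memL2_gradVec j i).integrableOn_mul (hu.memL2_gradVec i j)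

theorem ddot_devStrain_ae_eq {Ω : Set E3} (hΩ : IsOpen Ω) {u : E3 → E3} (v : E3 → E3)
    (hu : MemH1Vec Ω u) (hdiv : wdiv Ω u =ᵐ[volume.restrict Ω] 0) (μ : ℝ) :
    (fun x => 2 * μ * ddot (devStrain Ω u x) (devStrain Ω v x)) =ᵐ[volume.restrict Ω]
      fun x => μ * (ddot (gradVec Ω u x) (gradVec Ω v x) +
        tr (matMap (gradVec Ω u x) ∘L matMap (gradVec Ω v x))) := by
  filter_upwards [hu.wdiv_ae_eq hΩ, hdiv] with x h1 h2
  rw [← ddot_devStrain h2 h1]; ring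

theorem integral_curl_mul_curl_eq {Ω : Set E3} (hΩ : IsPolyhedralDomain Ω) {u v : E3 → E3}
    (hu : MemH1Vec Ω u) (hv : MemH1Vec Ω v) (hdiv : wdiv Ω u =ᵐ[volume.restrict Ω] 0)
    (h : (MemH0div Ω u ∧ MemH0div Ω v) ∨ (MemH0curl Ω u ∧ MemH0curl Ω v)) (μ : ℝ) :
    ∫ x in Ω, μ * inner ℝ (wcurl Ω u x) (wcurl Ω v x) =
      ∫ x in Ω, 2 * μ * ddot (devStrain Ω u x) (devStrain Ω v x) := by
  have h0 : ∫ x in Ω, (tr (matMap (gradVec Ω u x) ∘L matMap (gradVec Ω v x)) -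
      tr (matMap (gradVec Ω u x)) * tr (matMap (gradVec Ω v x))) = 0 := by
    rcases h with ⟨h1, h2⟩ | ⟨h1, h2⟩
    · exact integral_nullLagrangian_eq_zero hΩ hu.memL2 (memL2_matMap hu.memL2_gradVec) hv.memL2
        (memL2_matMap hv.memL2_gradVec) hu.weakJacOn hv.weakJacOn (one_mul 1)
        (h1.weakDivOn hΩ.isOpen hu) (h2.weakDivOn hΩ.isOpen hv)
    · exact integral_nullLagrangian_eq_zero hΩ hu.memL2 (memL2_matMap hu.memL2_gradVec) hv.memL2
        (memL2_matMap hv.memL2_gradVec) hu.weakJacOn hv.weakJacOn (by norm_num)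
        (h1.weakDivOn hΩ.isOpen hu) (h2.weakDivOn hΩ.isOpen hv)
  have h1 : ∫ x in Ω, tr (matMap (gradVec Ω u x) ∘L matMap (gradVec Ω v x)) = 0 := by
    rw [← h0]
    refine integral_congr_ae ?_
    filter_upwards [hu.wdiv_ae_eq hΩ.isOpen, hdiv] with x h1 h2
    rw [tr_matMap, ← h1, h2, Pi.zero_apply, zero_mul, sub_zero]
  rw [integral_congr_ae (ddot_devStrain_ae_eq hΩ.isOpen v hu hdiv μ), integral_const_mul,
    integral_const_mul, integral_add (hu.integrableOn_ddot hv) (hu.integrableOn_tr_comp hv), h1,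
    add_zero]
  congr 1
  have h2 : (fun x => (inner ℝ (wcurl Ω u x) (wcurl Ω v x) : ℝ)) =ᵐ[volume.restrict Ω]
      fun x => ddot (gradVec Ω u x) (gradVec Ω v x) -
        tr (matMap (gradVec Ω u x) ∘L matMap (gradVec Ω v x)) := by
    filter_upwards [hu.wcurl_ae_eq hΩ.isOpen, hv.wcurl_ae_eq hΩ.isOpen] with x h3 h4
    rw [h3, h4, inner_matCurl_matCurl]
  rw [integral_congr_ae h2, integral_sub (hu.integrableOn_ddot hv) (hu.integrableOn_tr_comp hv),
    h1, sub_zero]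

/-! ### The traction -/

theorem IsWeakDiv.congr_ae {Ω : Set E3} {u u' : E3 → E3} {d : E3 → ℝ} (h : IsWeakDiv Ω u d)
    (hu : u =ᵐ[volume.restrict Ω] u') : IsWeakDiv Ω u' d := by
  refine ⟨h.1, fun φ hφ => ?_⟩
  rw [← h.2 φ hφ]
  refine integral_congr_ae ?_
  filter_upwards [hu] with x hx
  rw [hx]

/-- The rows of twice the symmetric gradient. -/
def symRow (M : Matrix (Fin 3) (Fin 3) ℝ) (j : Fin 3) : E3 :=
  WithLp.toLp 2 fun i => M j i + M i j

theorem rowField_devStrain_ae_eq {Ω : Set E3} {u : E3 → E3}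
    (hdiv : wdiv Ω u =ᵐ[volume.restrict Ω] 0) (μ : ℝ) (j : Fin 3) :
    (fun x => μ • symRow (gradVec Ω u x) j) =ᵐ[volume.restrict Ω]
      rowField (fun x => (2 * μ) • devStrain Ω u x) j := by
  filter_upwards [hdiv] with x hx
  ext i
  simp [rowField, symRow, devStrain, hx]
  ring

theorem MemH1Vec.memL2_symRow {Ω : Set E3} {u : E3 → E3} (hu : MemH1Vec Ω u) (μ : ℝ)
    (j : Fin 3) : MemL2 Ω (fun x => μ • symRow (gradVec Ω u x) j) :=
  memL2_of_coord fun i => ((hu.memL2_gradVec j i).add (hu.memL2_gradVec i j)).const_mul μ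

theorem inner_matCurl_classCurl_smul {φ : E3 → ℝ} {x : E3} (hφ : DifferentiableAt ℝ φ x)
    (M : Matrix (Fin 3) (Fin 3) ℝ) (j : Fin 3) :
    (inner ℝ (matCurl M) (classCurl (fun y => φ y • stdVec j) x) : ℝ) =
      ∑ i, (M j i - M i j) * pd i φ x := by
  have hp : ∀ i k, pd i (fun y => (φ y • stdVec j) k) x = pd i φ x * stdVec j k := fun i k =>
    pd_mul_const hφ i _
  simp only [classCurl, hp]
  fin_cases j <;> simp [matCurl, PiLp.inner_apply, Fin.sum_univ_three] <;> ring

theorem MemH1Vec.integralZero_sum_mul_pd {Ω : Set E3} (hΩ : IsOpen Ω) {u : E3 → E3}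
    (hu : MemH1Vec Ω u) (hdiv : wdiv Ω u =ᵐ[volume.restrict Ω] 0) {φ : E3 → ℝ}
    (hφ : IsTest Ω φ) (j : Fin 3) :
    IntegralZero Ω (fun x => ∑ i, gradVec Ω u x i j * pd i φ x) := by
  have h1 := IntegralZero.sum (s := Finset.univ) fun i _ =>
    (hu.integralZero (hφ.partialDeriv i) i j).sub (hu.integralZero (hφ.partialDeriv j) i i)
  refine h1.congr_ae ?_
  filter_upwards [hu.wdiv_ae_eq hΩ, hdiv] with x h2 h3
  have h4 : ∑ i, gradVec Ω u x i i = 0 := by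
    rw [h3, matDiv] at h2; exact h2.symm
  have h5 : ∑ i, pd j φ x * gradVec Ω u x i i = 0 := by rw [← Finset.mul_sum, h4, mul_zero]
  rw [← add_zero (∑ i, gradVec Ω u x i j * pd i φ x), ← neg_zero, ← h5, ← sub_eq_add_neg,
    ← Finset.sum_sub_distrib]
  refine Finset.sum_congr rfl fun i _ => ?_
  rw [pd_comm hφ i j]; ring

theorem MemH1Vec.isWeakDiv_symRow {Ω : Set E3} (hΩ : IsOpen Ω) {u w : E3 → E3}
    (hu : MemH1Vec Ω u) (hdiv : wdiv Ω u =ᵐ[volume.restrict Ω] 0)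
    (hw : IsWeakCurl Ω (wcurl Ω u) w) (μ : ℝ) (j : Fin 3) :
    IsWeakDiv Ω (fun x => μ • symRow (gradVec Ω u x) j) (fun x => -(μ * w x j)) := by
  refine ⟨((memLp_coord hw.1 j).const_mul μ).neg, fun φ hφ => ?_⟩
  have hΦ : IsTest Ω (fun x => φ x • stdVec j) := hφ.smul_const _
  have h1 := hw.2 _ hΦ
  have h2 : ∀ x, (inner ℝ (w x) (φ x • stdVec j) : ℝ) = w x j * φ x := fun x => by
    simp [inner_smul_right, EuclideanSpace.inner_single_right, mul_comm]
  simp_rw [h2] at h1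
  simp_rw [neg_mul, mul_assoc]
  rw [integral_neg, neg_neg, integral_const_mul, ← h1, ← integral_const_mul]
  have hg : MemL2 Ω (classGrad φ) := memL2_of_coord fun i => by
    simp only [classGrad_apply]; exact (hφ.partialDeriv i).memL2 Ω
  refine IntegralZero.integral_eq ((hu.memL2_symRow μ j).integrableOn_inner hg)
    ((hu.isWeakCurl.isWeakCurl_wcurl.1.integrableOn_inner (memL2_classCurl hΦ)).const_mul μ) ?_
  refine ((hu.integralZero_sum_mul_pd hΩ hdiv hφ j).const_mul (2 * μ)).congr_ae ?_
  filter_upwards [hu.wcurl_ae_eq hΩ] with x hx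
  rw [hx, inner_matCurl_classCurl_smul (hφ.differentiable x)]
  simp [symRow, PiLp.inner_apply, Fin.sum_univ_three, classGrad_apply]
  ring

theorem sum_inner_symRow (M N : Matrix (Fin 3) (Fin 3) ℝ) (g : Fin 3 → E3)
    (hg : ∀ j i, g j i = N j i) :
    ∑ j, (inner ℝ (symRow M j) (g j) : ℝ) = ddot M N + tr (matMap M ∘L matMap N) := by
  rw [tr_comp]
  simp only [matMap_stdVec]
  simp [symRow, ddot, PiLp.inner_apply, Fin.sum_univ_three, hg]
  ring

theorem memHdivTensor_devStrain {Ω : Set E3} (hΩ : IsOpen Ω) {u w : E3 → E3}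
    (hu : MemH1Vec Ω u) (hdiv : wdiv Ω u =ᵐ[volume.restrict Ω] 0)
    (hw : IsWeakCurl Ω (wcurl Ω u) w) (μ : ℝ) :
    MemHdivTensor Ω (fun x => (2 * μ) • devStrain Ω u x) := fun j =>
  have h := rowField_devStrain_ae_eq hdiv μ j
  ⟨(memLp_congr_ae h).1 (hu.memL2_symRow μ j), _,
    (hu.isWeakDiv_symRow hΩ hdiv hw μ j).congr_ae h⟩

theorem tractionPairing_eq {Ω : Set E3} (hΩ : IsOpen Ω) {u v : E3 → E3}
    (hu : MemH1Vec Ω u) (hv : MemH1Vec Ω v) (hdiv : wdiv Ω u =ᵐ[volume.restrict Ω] 0)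
    (h0 : MemH0curl Ω (wcurl Ω u)) (μ : ℝ) :
    tractionPairing Ω (fun x => (2 * μ) • devStrain Ω u x) v =
      (∫ x in Ω, 2 * μ * ddot (devStrain Ω u x) (devStrain Ω v x)) -
        ∫ x in Ω, μ * inner ℝ (wcurl Ω u x) (wcurl Ω v x) := by
  obtain ⟨w', hw'⟩ := h0.1.2
  have hw := hw'.isWeakCurl_wcurl
  set w := wcurl Ω (wcurl Ω u)
  have hcu := hu.isWeakCurl.isWeakCurl_wcurl.1
  have hcv := hv.isWeakCurl.isWeakCurl_wcurl.1
  have hi1 := hw.1.integrableOn_inner hv.memL2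
  have hi2 := hcu.integrableOn_inner hcv
  have h1 : ∫ x in Ω, (inner ℝ (wcurl Ω u x) (wcurl Ω v x) : ℝ) =
      ∫ x in Ω, (inner ℝ (w x) (v x) : ℝ) := by
    have := h0.2 v hv
    rw [tangentialTrace, integral_sub hi1 hi2] at this
    linarith
  have h2 : ∀ j, normalTrace Ω (rowField (fun x => (2 * μ) • devStrain Ω u x) j)
      (fun x => v x j) = ∫ x in Ω, (inner ℝ (μ • symRow (gradVec Ω u x) j)
        (wgrad Ω (fun y => v y j) x) + -(μ * w x j) * v x j) := fun j => by
    have h := rowField_devStrain_ae_eq hdiv μ j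
    refine integral_congr_ae ?_
    filter_upwards [h, ((hu.isWeakDiv_symRow hΩ hdiv hw μ j).congr_ae h).wdiv_ae_eq hΩ] with x h3 h4
    rw [← h3, h4]
  have h3 : ∀ j, IntegrableOn (fun x => inner ℝ (μ • symRow (gradVec Ω u x) j)
      (wgrad Ω (fun y => v y j) x) + -(μ * w x j) * v x j) Ω := fun j =>
    ((hu.memL2_symRow μ j).integrableOn_inner (hv j).isWeakGrad.1).add
      (MemL2.integrableOn_mul ((memLp_coord hw.1 j).const_mul μ).neg (hv j).1)
  have h4 : IntegrableOn (fun x => μ * (ddot (gradVec Ω u x) (gradVec Ω v x) +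
      tr (matMap (gradVec Ω u x) ∘L matMap (gradVec Ω v x)))) Ω :=
    ((hu.integrableOn_ddot hv).add (hu.integrableOn_tr_comp hv)).const_mul μ
  rw [tractionPairing, Finset.sum_congr rfl fun j _ => h2 j, ← integral_finsetSum _ fun j _ => h3 j,
    integral_congr_ae (ddot_devStrain_ae_eq hΩ v hu hdiv μ), integral_const_mul _ (fun x =>
      (inner ℝ (wcurl Ω u x) (wcurl Ω v x) : ℝ)), h1, ← integral_const_mul,
    ← integral_sub h4 (hi1.const_mul μ)]
  refine integral_congr_ae (ae_of_all _ fun x => ?_)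
  simp only
  rw [← sum_inner_symRow (gradVec Ω u x) (gradVec Ω v x) (fun j => wgrad Ω (fun y => v y j) x)
    fun j i => rfl, Finset.sum_add_distrib]
  simp only [inner_smul_left, PiLp.inner_apply, Fin.sum_univ_three, RCLike.inner_apply,
    conj_trivial]
  ring

end

theorem mainTheorem3 (Ω : Set E3) (hΩ : IsPolyhedralDomain Ω) (μ : ℝ) (hμ : 0 < μ)
    (u v : E3 → E3) (hu : MemH1Vec Ω u) (hv : MemH1Vec Ω v)
    (hdiv : wdiv Ω u =ᵐ[volume.restrict Ω] 0) :
    (MemH0curl Ω (wcurl Ω u) →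
      MemHdivTensor Ω (fun x => (2 * μ) • devStrain Ω u x) ∧
      ∫ x in Ω, μ * inner ℝ (wcurl Ω u x) (wcurl Ω v x) =
        (∫ x in Ω, 2 * μ * ddot (devStrain Ω u x) (devStrain Ω v x)) -
          tractionPairing Ω (fun x => (2 * μ) • devStrain Ω u x) v) ∧
    ((MemH0div Ω u ∧ MemH0div Ω v) ∨ (MemH0curl Ω u ∧ MemH0curl Ω v) →
      ∫ x in Ω, μ * inner ℝ (wcurl Ω u x) (wcurl Ω v x) =
        ∫ x in Ω, 2 * μ * ddot (devStrain Ω u x) (devStrain Ω v x)) := by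
  refine ⟨fun h0 => ?_, fun h => integral_curl_mul_curl_eq hΩ hu hv hdiv h μ⟩
  obtain ⟨w, hw⟩ := h0.1.2
  refine ⟨memHdivTensor_devStrain hΩ.isOpen hu hdiv hw μ, ?_⟩
  rw [tractionPairing_eq hΩ.isOpen hu hv hdiv h0 μ, sub_sub_cancel]
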